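/- Write $e(u)=e^{2\pi i u}$, $\zeta_N=e(1/N)$, let $\left(\frac{\cdot}{\cdot}\right)$ be the Kronecker symbol, and let $T=\{1,\dots,6\}$. For $m\in T$ and $n\ge 1$ let $\chi_m(n)$ be $$\left(\tfrac{-4}{n}\right),\ \left(\tfrac{-2}{n}\right),\ \left(\tfrac{n}{3}\right),\ \left(\tfrac{-6}{n}\right),\ \left(\tfrac{n}{12}\right),\ 2\left(\tfrac{n}{12}\right)-\left(\tfrac{n}{3}\right)\qquad(m=1,2,3,4,5,6),$$ and put $E_m(\tau)=\sum_{n\ge1}\chi_m(n)\,n\,e(n^2\tau)$ for $\mathrm{Im}(\tau)>0$ (the odd eta-theta functions) and $\widetilde E_m(z)=\sum_{n\ge1}\chi_m(n)\,e(-n^2z)$ for $\mathrm{Im}(z)<0$. For $r\in\mathbb Q$ let $\widetilde E_m(r)=\lim_{t\to0^+}\widetilde E_m(r-it)$. Constants: $\ell_m=2$ for $m=1,3,5$ and $\ell_m=1$ for $m=2,4,6$; $(a_1,\dots,a_6)=(8,8,3,24,12,3)$; $(b_1,\dots,b_6)=(4,4,6,12,6,6)$; $(c_1,\dots,c_6)=(8,8,6,24,12,6)$.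 A pair $(m,n)$ with $m\in T$, $1\le n\le 8$ is admissible if it is not one of $(1,6),(2,5),(3,8),(5,4),(6,7)$. For admissible $(m,n)$ let $\ell_{m1}=\ell_m$ and $\ell_{mn}=2$ if $n\ne1$; let $\kappa_{mn}=3$ if $m\in\{1,2\}$ and $n\in\{3,4,7,8\}$, $\kappa_{mn}=2$ if $m\in\{3,5,6\}$ and $n\in\{5,6\}$, and $\kappa_{mn}=1$ otherwise. With $M_r=\left(\begin{smallmatrix}1&0\\r&1\end{smallmatrix}\right)$, let $G_{mn}\subset \mathrm{SL}_2(\mathbb Z)$ be the group generated by $M_{\ell_{mn}}$ and $\left(\begin{smallmatrix}1&\kappa_{mn}b_m\\0&1\end{smallmatrix}\right)$. Let $S$ be the set of rationals $h/k$ in lowest terms, $k>0$, with $h$ odd; let $S'$, $S_{ev}$, $S_{od}$ be the subsets of $S$ given by $h\equiv\pm1\pmod 6$, by $k$ even, and by $k$ odd, respectively. Put $S_{11},S_{17},S_{21},S_{27},S_{41},S_{45},S_{47}:=S$; $S_{12},S_{18},S_{22},S_{28},S_{42},S_{52}:=S_{ev}$; $S_{13},S_{23},S_{31},S_{34},S_{35},S_{36},S_{43},S_{53},S_{61},S_{63},S_{64},S_{65},S_{66}:=S'$;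 $S_{14},S_{15},S_{24},S_{26}:=S_{od}$; $S_{32},S_{33},S_{62}:=S'\cap S_{ev}$; $S_{37},S_{68}:=S'\cap S_{od}$; $S_{44}:=S'\cup S_{od}$; $S_{46},S_{48},S_{51},S_{55},S_{56},S_{57},S_{58}:=S'\cup S_{ev}$. A function $f$ is a quantum modular form of weight $k$ on $R\subseteq\mathbb Q$ for $\Gamma\subseteq\mathrm{SL}_2(\mathbb Z)$ if $f(x)$ and $f(\gamma x)$ exist for all $x\in R$ and $\gamma=\left(\begin{smallmatrix}a&b\\c&d\end{smallmatrix}\right)\in\Gamma$ with $cx+d\ne0$, and if there are complex numbers $\epsilon(\gamma)$ of absolute value $1$ such that for each $\gamma\in\Gamma$ the function $f(x)-\epsilon(\gamma)(cx+d)^{-k}f(\gamma x)$ of $x\in R$, $cx+d\neq 0$, is the restriction of a real analytic function on $\{x\in\mathbb R: cx+d\ne0\}$. Here $(cx+d)^{-k}$ is the boundary value of the principal branch of $(c\tau+d)^{-k}$ as $\tau\to x$ from the upper half-plane. **Proposition 1.4.** Let $m\in T$. The value $\widetilde E_m(r)$ exists for every $r\in\mathbb Q$, and $\widetilde E_m(-r)=\overline{\widetilde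 E_m(r)}$. For every $n$ such that $(m,n)$ is admissible, $x\mapsto\widetilde E_m(2x/c_m^2)$ is a quantum modular form of weight $1/2$ on $S_{mn}\setminus\{-1/\ell_{mn}\}$ for the group $G_{mn}$. Moreover there is a constant $\alpha_m\ne0$ such that for every such $n$ the function $V(x):=\alpha_m\widetilde E_m(2x/c_m^2)$ (equivalently, a constant multiple of the complex conjugate of $\widetilde E_m(-2x/c_m^2)$) satisfies the following, where roots and powers are principal (with argument $\pi$ for negative reals) and the integrals over vertical paths converge absolutely. (i) For all $x\in S_{mn}\setminus\{-\frac12\}$, $$V(x)+\zeta_4^{\ell_m}(2x+1)^{-\frac12}\,V\!\left(\frac{x}{2x+1}\right)=-\frac{i}{c_m}\int_{1/2}^{i\infty}\frac{E_m(2u/c_m^2)}{\sqrt{-i(u+x)}}\,du .$$ (ii) If $n=1$ and $m\in\{2,4,6\}$, then for all $x\in S_{mn}\setminus\{-1\}$, $$V(x)-\zeta_8^{-1}(x+1)^{-\frac12}\,V\!\left(\frac{x}{x+1}\right)=-\frac{i}{c_m}\int_{1}^{i\infty}\frac{E_m(2u/c_m^2)}{\sqrt{-i(u+x)}}\,du .$$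 (iii) For all $x\in S_{mn}$, $\;V(x)-\zeta_{a_m}^{\kappa_{mn}}\,V(x+\kappa_{mn}b_m)=0$. -/

import Mathlib

open Filter Topology MeasureTheory
open scoped MatrixGroups ComplexConjugate

namespace EtaTheta

/-! ### The characters, the eta-theta functions and the partial theta functions -/

/-- The coefficients `χ_m(n)`, `n ≥ 1`: the Kronecker symbols
`(-4/n)`, `(-2/n)`, `(n/3)`, `(-6/n)`, `(n/12)` and the combination `2 (n/12) - (n/3)`.
(For `n ≥ 1` each of these Kronecker symbols is equal to the symbol `jacobiSym` of Mathlib: at the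
prime `2` both vanish on even arguments, and the symbols at `2` of odd arguments occur squared.) -/
def chi (m n : ℕ) : ℤ :=
  match m with
  | 1 => jacobiSym (-4) n
  | 2 => jacobiSym (-2) n
  | 3 => jacobiSym n 3
  | 4 => jacobiSym (-6) n
  | 5 => jacobiSym n 12
  | 6 => 2 * jacobiSym n 12 - jacobiSym n 3
  | _ => 0

/-- The odd eta-theta function `E_m(τ) = ∑_{n ≥ 1} χ_m(n) n q^{n²}`, `q = e^{2πiτ}`, for `τ` in the
upper half-plane. -/
noncomputable def E (m : ℕ) (τ : ℂ) : ℂ :=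
  ∑' n : ℕ+, (chi m n : ℂ) * (n : ℂ) * Complex.exp (2 * Real.pi * Complex.I * τ * (n : ℂ) ^ 2)

/-- The partial theta function `Ẽ_m(z) = ∑_{n ≥ 1} χ_m(n) e^{-2πi z n²}`, for `z` in the lower
half-plane. -/
noncomputable def Etilde (m : ℕ) (z : ℂ) : ℂ :=
  ∑' n : ℕ+, (chi m n : ℂ) * Complex.exp (-2 * Real.pi * Complex.I * z * (n : ℂ) ^ 2)

/-- `Ẽ_m` has the value `L` at the rational number `r`: the vertical limit of `Ẽ_m` at `r` from the
lower half-plane is `L`. -/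
def HasValueAt (m : ℕ) (r : ℚ) (L : ℂ) : Prop :=
  Tendsto (fun t : ℝ => Etilde m ((r : ℂ) - Complex.I * t)) (𝓝[>] 0) (𝓝 L)

/-- The value of `Ẽ_m` at a rational number `r` (meaningful when `HasValueAt m r L` for some `L`,
which is then unique). -/
noncomputable def EtildeRat (m : ℕ) (r : ℚ) : ℂ :=
  limUnder (𝓝[>] (0 : ℝ)) (fun t : ℝ => Etilde m ((r : ℂ) - Complex.I * t))

/-! ### The numerical constants -/

/-- The index set `T`. -/
def T : Set ℕ := {1, 2, 3, 4, 5, 6}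

/-- The 43 admissible pairs `(m, n)` with `m ∈ T`. -/
def Admissible (m n : ℕ) : Prop :=
  m ∈ T ∧ 1 ≤ n ∧ n ≤ 8 ∧
    (m, n) ≠ (1, 6) ∧ (m, n) ≠ (2, 5) ∧ (m, n) ≠ (3, 8) ∧ (m, n) ≠ (5, 4) ∧ (m, n) ≠ (6, 7)

/-- `ℓ_m`. -/
def ell (m : ℕ) : ℕ := if m = 1 ∨ m = 3 ∨ m = 5 then 2 else 1

/-- `ℓ_{mn}`, equal to `ℓ_m` if `n = 1` and to `2` otherwise. -/
def ellPair (m n : ℕ) : ℕ := if n = 1 then ell m else 2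

/-- `a_m`. -/
def a (m : ℕ) : ℕ :=
  match m with
  | 1 => 8
  | 2 => 8
  | 3 => 3
  | 4 => 24
  | 5 => 12
  | 6 => 3
  | _ => 1

/-- `b_m`. -/
def b (m : ℕ) : ℕ := if m = 3 ∨ m = 6 then 2 * a m else a m / 2

/-- `c_m`. -/
def c (m : ℕ) : ℕ := if m = 3 ∨ m = 6 then 2 * a m else a m

/-- `κ_{mn}`. -/
def kappa (m n : ℕ) : ℕ :=
  if (m = 1 ∨ m = 2) ∧ (n = 3 ∨ n = 4 ∨ n = 7 ∨ n = 8) then 3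
  else if (m = 3 ∨ m = 5 ∨ m = 6) ∧ (n = 5 ∨ n = 6) then 2
  else 1

/-- `ζ_N = e^{2πi/N}`. -/
noncomputable def zeta (N : ℕ) : ℂ := Complex.exp (2 * Real.pi * Complex.I / N)

/-! ### The sets `S_{mn}` and the groups `G_{mn}` -/

/-- Rationals with odd numerator (in lowest terms, with positive denominator). -/
def S : Set ℚ := {x | Odd x.num}

/-- Rationals whose numerator is congruent to `± 1` modulo `6`. -/
def S' : Set ℚ := {x | x ∈ S ∧ (x.num ≡ 1 [ZMOD 6] ∨ x.num ≡ -1 [ZMOD 6])}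

/-- Rationals with odd numerator and even denominator. -/
def Sev : Set ℚ := {x | x ∈ S ∧ Even x.den}

/-- Rationals with odd numerator and odd denominator. -/
def Sod : Set ℚ := {x | x ∈ S ∧ Odd x.den}

/-- The set `S_{mn}` for an admissible pair `(m, n)`. -/
def Sset (m n : ℕ) : Set ℚ :=
  match m, n with
  | 1, 1 | 1, 7 | 2, 1 | 2, 7 | 4, 1 | 4, 5 | 4, 7 => S
  | 1, 2 | 1, 8 | 2, 2 | 2, 8 | 4, 2 | 5, 2 => Sev
  | 1, 3 | 2, 3 | 3, 1 | 3, 4 | 3, 5 | 3, 6 | 4, 3 | 5, 3 | 6, 1 | 6, 3 | 6, 4 | 6, 5 | 6, 6 => S'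
  | 1, 4 | 1, 5 | 2, 4 | 2, 6 => Sod
  | 3, 2 | 3, 3 | 6, 2 => S' ∩ Sev
  | 3, 7 | 6, 8 => S' ∩ Sod
  | 4, 4 => S' ∪ Sod
  | 4, 6 | 4, 8 | 5, 1 | 5, 5 | 5, 6 | 5, 7 | 5, 8 => S' ∪ Sev
  | _, _ => ∅

/-- The matrix `M_r` with rows `(1, 0)` and `(r, 1)`. -/
def lowerUnip (r : ℤ) : SL(2, ℤ) := ⟨!![1, 0; r, 1], by simp [Matrix.det_fin_two]⟩

/-- The matrix with rows `(1, s)` and `(0, 1)`. -/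
def upperUnip (s : ℤ) : SL(2, ℤ) := ⟨!![1, s; 0, 1], by simp [Matrix.det_fin_two]⟩

/-- The group `G_{mn}`, generated by `M_{ℓ_{mn}}` and the translation by `κ_{mn} b_m`.  Thus the two
off-diagonal entries of the generators are `(2, 4)` for `11, 12, 15, 22, 26`, `(1, 4)` for `21`,
`(1, 12)` for `41`, `(1, 6)` for `61`, `(2, 12)` for `13, 14, 17, 18, 23, 24, 27, 28, 35, 36, 55, 56,
65, 66` and `4n` with `n ≠ 1`, and `(2, 6)` for the other pairs. -/
def G (m n : ℕ) : Subgroup SL(2, ℤ) :=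
  Subgroup.closure {lowerUnip (ellPair m n), upperUnip (kappa m n * b m : ℕ)}

/-! ### Quantum modular forms -/

/-- The denominator `c x + d` of the action of `γ` on `x`. -/
def den (γ : SL(2, ℤ)) (x : ℚ) : ℚ := (γ 1 0 : ℚ) * x + (γ 1 1 : ℚ)

/-- The Möbius action `γ x = (a x + b) / (c x + d)` on rationals with `c x + d ≠ 0`. -/
def act (γ : SL(2, ℤ)) (x : ℚ) : ℚ := ((γ 0 0 : ℚ) * x + (γ 0 1 : ℚ)) / den γ x

/-- The factor `(c x + d)^{-k}` for real `x` with `c x + d ≠ 0`, as the boundary value of the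
(principal branch of the) function `(c τ + d)^{-k}` of `τ` in the upper half-plane.  If `c x + d < 0`
and `c < 0`, then `c τ + d` approaches the negative axis from below, where the principal branch of
Mathlib, which has argument `π` on the negative axis, has to be conjugated. -/
noncomputable def factor (k : ℚ) (γ : SL(2, ℤ)) (x : ℚ) : ℂ :=
  if 0 ≤ γ 1 0 then (den γ x : ℂ) ^ (-(k : ℂ)) else conj ((den γ x : ℂ) ^ (-(k : ℂ)))

/-- `f` is a quantum modular form of weight `k` on the set `R ⊆ ℚ` for the group `Γ ⊆ SL₂(ℤ)`, where
`D` is the set of rationals at which `f` exists: `R` is a quantum set for `f` with respect to `Γ`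
(that is, `f(x)` and `f(γ x)` exist for all `x ∈ R`, `γ ∈ Γ`, `x ≠ -d/c`), and there are multipliers
`ε(γ)` of absolute value one such that each error function
`h_γ(x) = f(x) - ε(γ) (c x + d)^{-k} f(γ x)`, `x ∈ R`, `x ≠ -d/c`, is real analytic, i.e. is the
restriction of a real analytic function on `{x ∈ ℝ | c x + d ≠ 0}`. -/
structure IsQuantumModularForm (k : ℚ) (R : Set ℚ) (Γ : Subgroup SL(2, ℤ)) (D : Set ℚ)
    (f : ℚ → ℂ) : Prop where
  exists_self : ∀ x ∈ R, x ∈ D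
  exists_act : ∀ γ ∈ Γ, ∀ x ∈ R, den γ x ≠ 0 → act γ x ∈ D
  modular : ∃ ε : SL(2, ℤ) → ℂ, ∀ γ ∈ Γ, ‖ε γ‖ = 1 ∧
    ∃ h : ℝ → ℂ, AnalyticOnNhd ℝ h {x : ℝ | (γ 1 0 : ℝ) * x + (γ 1 1 : ℝ) ≠ 0} ∧
      ∀ x ∈ R, den γ x ≠ 0 → h x = f x - ε γ * factor k γ x * f (act γ x)

/-! ### The period integrals -/

/-- The integrand of `∫_ρ^{i∞} E_m(2u/c_m²) (-i(u+x))^{-1/2} du` along the vertical path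
`u = ρ + i t`, `0 < t < ∞`, including `du/dt = i`. -/
noncomputable def periodIntegrand (m : ℕ) (ρ x : ℝ) (t : ℝ) : ℂ :=
  E m (2 * (ρ + Complex.I * t) / (c m : ℂ) ^ 2) /
    (-Complex.I * ((ρ + Complex.I * t) + x)) ^ (1 / 2 : ℂ) * Complex.I

/-- The period integral `∫_ρ^{i∞} E_m(2u/c_m²) (-i(u+x))^{-1/2} du`. -/
noncomputable def periodIntegral (m : ℕ) (ρ x : ℝ) : ℂ :=
  ∫ t in Set.Ioi (0 : ℝ), periodIntegrand m ρ x t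

/-- The transformation laws for a function `V` on `S_{mn}`:
(i) `V(x) + ζ_4^{ℓ_m} (2x+1)^{-1/2} V(M_2 x) = -(i/c_m) ∫_{1/2}^{i∞} E_m(2u/c_m²)/√(-i(u+x)) du`
for `x ∈ S_{mn}`, `x ≠ -1/2`;
(ii) if `n = 1` and `m ∈ {2, 4, 6}`, then
`V(x) - ζ_8^{-1} (x+1)^{-1/2} V(M_1 x) = -(i/c_m) ∫_1^{i∞} E_m(2u/c_m²)/√(-i(u+x)) du`
for `x ∈ S_{mn}`, `x ≠ -1`;
(iii) `V(x) - ζ_{a_m}^{κ_{mn}} V(x + κ_{mn} b_m) = 0` for `x ∈ S_{mn}`.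
The integrals converge absolutely. -/
structure TransformationLaws (m n : ℕ) (V : ℚ → ℂ) : Prop where
  integrable_half : ∀ x ∈ Sset m n, x ≠ -1 / 2 →
    IntegrableOn (periodIntegrand m (1 / 2) x) (Set.Ioi 0)
  law_i : ∀ x ∈ Sset m n, x ≠ -1 / 2 →
    V x + zeta 4 ^ ell m * (2 * (x : ℂ) + 1) ^ (-1 / 2 : ℂ) * V (x / (2 * x + 1)) =
      -(Complex.I / (c m : ℂ)) * periodIntegral m (1 / 2) x
  integrable_one : n = 1 → (m = 2 ∨ m = 4 ∨ m = 6) → ∀ x ∈ Sset m n, x ≠ -1 →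
    IntegrableOn (periodIntegrand m 1 x) (Set.Ioi 0)
  law_ii : n = 1 → (m = 2 ∨ m = 4 ∨ m = 6) → ∀ x ∈ Sset m n, x ≠ -1 →
    V x - (zeta 8)⁻¹ * ((x : ℂ) + 1) ^ (-1 / 2 : ℂ) * V (x / (x + 1)) =
      -(Complex.I / (c m : ℂ)) * periodIntegral m 1 x
  law_iii : ∀ x ∈ Sset m n,
    V x - zeta (a m) ^ kappa m n * V (x + kappa m n * b m) = 0

end EtaTheta

/-! Put f(u) = E_m(2u/c_m²), a unary theta series of weight 3/2. Integrating f against t^(-1/2)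
along the vertical line over -x removes the factor n from each term, so the value of Ẽ_m at 2x/c_m²
is the Eichler integral -(2i/c_m) ∫ f(u)/√(-i(u+x)) du from the cusp -x to i∞
(`integral_shifted_scaledE`, `hasValueAt`). The modularity of f under τ ↦ -γ(-τ) therefore governs
how the values at x and γx compare.

For γ with lower row (c, d), c ≠ 0, this map has its pole at ρ = d/c. Changing variables turns the
integral from -γx to i∞ into one from -x to ρ, that is, the difference of the integrals from -x and
from ρ to i∞ (`IsCuspidal.vertInt_mob`). The integral from ρ is the error function. It is real
analytic in x away from -ρ, because there u + x stays off the cut of the square root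
(`IsCuspidal.analyticAt_vertInt`). For c = 0 the error vanishes.

Modularity is needed only for the generators. Poisson summation (`tsum_residue`, `theta_inversion`)
turns a lower unipotent matrix into a translation acting on the series of the discrete Fourier
transform of χ_m. A half-period symmetry of χ_m confines that transform to one parity class, on
which the translation is a scalar (`dft_eq_zero`, `dft_multiplier`). Translation by b_m is a scalar
since n² ≡ 1 mod a_m wherever χ_m(n) ≠ 0. The factor n kills the constant term at every cusp, which
gives decay at i∞ and boundedness over each rational, hence convergence.

Branches of square roots are never followed along paths. The relevant quotient of automorphy factors
has constant square on a connected set, so it is itself constant (`exists_branch`). Connectedness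
through the lower half-plane is what yields one multiplier for x on both sides of -ρ. In the
explicit laws the constant is found by evaluation at a single point (`transformation_lower`), and α
= 1/2 turns 2i/c_m into i/c_m. -/

namespace EtaTheta

open Complex Set

/-! ### The square root `√(-iz)` -/

/-- The principal branch of `√(-iz)`. -/
noncomputable def rt (z : ℂ) : ℂ := (-I * z) ^ (1 / 2 : ℂ)

lemma rt_sq (z : ℂ) : rt z ^ 2 = -I * z := by
  simp [rt, one_div]

lemma rt_ne_zero {z : ℂ} (hz : z ≠ 0) : rt z ≠ 0 := by
  intro h
  have := rt_sq z
  rw [h] at this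
  simp [hz] at this

lemma norm_rt (z : ℂ) : ‖rt z‖ = √‖z‖ := by
  have h := congrArg norm (rt_sq z)
  rw [norm_pow, norm_mul, norm_neg, norm_I, one_mul] at h
  rw [← h, Real.sqrt_sq (norm_nonneg _)]

/-- The cut of `rt` is the closed negative imaginary half-axis, so the real axis minus 0 lies inside
the domain of holomorphy. -/
lemma neg_I_mul_mem_slitPlane {z : ℂ} (h : 0 < z.im ∨ z.re ≠ 0) : -I * z ∈ slitPlane := by
  rw [Complex.mem_slitPlane_iff]
  simpa using h

lemma differentiableAt_rt {z : ℂ} (h : 0 < z.im ∨ z.re ≠ 0) : DifferentiableAt ℂ rt z := by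
  unfold rt
  exact (by fun_prop : DifferentiableAt ℂ (fun z : ℂ => -I * z) z).cpow_const
    (neg_I_mul_mem_slitPlane h)

lemma ne_zero_of_im_pos {z : ℂ} (h : 0 < z.im) : z ≠ 0 := by
  rintro rfl; simp at h

/-! ### Primitives on the upper half-plane -/

/-- The integral of `g` along the vertical path from `s` to `i∞`. -/
noncomputable def vertInt (g : ℂ → ℂ) (s : ℂ) : ℂ := ∫ t in Ioi (0 : ℝ), g (s + I * t) * I

lemma vert_continuousOn {g : ℂ → ℂ} (hg : ∀ u : ℂ, 0 < u.im → DifferentiableAt ℂ g u) {s : ℂ}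
    (hs : 0 ≤ s.im) : ContinuousOn (fun t : ℝ => g (s + I * t) * I) (Ioi 0) := by
  intro t ht
  have h1 : ContinuousAt g (s + I * t) := (hg _ (by simpa using add_pos_of_nonneg_of_pos hs ht)).continuousAt
  have h2 : ContinuousAt (fun t : ℝ => s + I * (t : ℂ)) t := by fun_prop
  exact ((ContinuousAt.comp (f := fun t : ℝ => s + I * (t : ℂ)) h1 h2).mul
    continuousAt_const).continuousWithinAt

lemma vert_aestronglyMeasurable {g : ℂ → ℂ}
    (hg : ∀ u : ℂ, 0 < u.im → DifferentiableAt ℂ g u) {s : ℂ} (hs : 0 ≤ s.im) :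
    AEStronglyMeasurable (fun t : ℝ => g (s + I * t) * I) (volume.restrict (Ioi 0)) :=
  (vert_continuousOn hg hs).aestronglyMeasurable measurableSet_Ioi

lemma integrableOn_exp_neg_mul {p : ℝ} (hp : 0 < p) (C : ℝ) :
    IntegrableOn (fun t : ℝ => C * Real.exp (-p * t)) (Ioi 0) :=
  (exp_neg_integrableOn_Ioi 0 hp).const_mul C

lemma vert_integrable {g : ℂ → ℂ} (hg : ∀ u : ℂ, 0 < u.im → DifferentiableAt ℂ g u)
    {p : ℝ} (hp : 0 < p)
    (hb : ∀ δ > 0, ∃ C : ℝ, 0 ≤ C ∧ ∀ u : ℂ, δ ≤ u.im → ‖g u‖ ≤ C * Real.exp (-p * u.im))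
    {s : ℂ} (hs : 0 < s.im) : IntegrableOn (fun t : ℝ => g (s + I * t) * I) (Ioi 0) := by
  obtain ⟨C, hC, hb⟩ := hb _ hs
  refine (integrableOn_exp_neg_mul hp C).mono' (vert_aestronglyMeasurable hg hs.le) ?_
  refine (ae_restrict_iff' measurableSet_Ioi).2 (Eventually.of_forall fun t ht => ?_)
  have ht : (0 : ℝ) < t := ht
  rw [norm_mul, norm_I, mul_one]
  refine (hb _ (by simpa using ht.le)).trans ?_
  gcongr C * Real.exp ?_
  simp only [add_im, mul_im, I_re, I_im, ofReal_re, ofReal_im]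
  nlinarith

/-- A uniform exponential bound in the half-plane Im ≥ 1 lets the factor exp(-p Im s) be pulled out
of the integral. The limit is uniform in the real part, as needed when a Moebius image of a path
runs off to i∞. -/
lemma tendsto_vertInt {g : ℂ → ℂ} {p : ℝ} (hp : 0 < p)
    (hb : ∀ δ > 0, ∃ C : ℝ, 0 ≤ C ∧ ∀ u : ℂ, δ ≤ u.im → ‖g u‖ ≤ C * Real.exp (-p * u.im)) :
    Tendsto (vertInt g) (comap im atTop) (𝓝 0) := by
  obtain ⟨C, hC, hb⟩ := hb 1 one_pos
  have key : ∀ s : ℂ, 1 ≤ s.im → ‖vertInt g s‖ ≤ Real.exp (-p * s.im) *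
      ∫ t in Ioi (0 : ℝ), C * Real.exp (-p * t) := by
    intro s hs
    rw [← integral_const_mul]
    refine norm_integral_le_of_norm_le ((integrableOn_exp_neg_mul hp C).const_mul _) ?_
    refine (ae_restrict_iff' measurableSet_Ioi).2 (Eventually.of_forall fun t ht => ?_)
    have ht : (0 : ℝ) < t := ht
    rw [norm_mul, norm_I, mul_one]
    have him : (s + I * t).im = s.im + t := by simp
    refine (hb _ (by rw [him]; linarith)).trans (le_of_eq ?_)
    rw [him, mul_add, Real.exp_add]; ring
  have hlim : Tendsto (fun s : ℂ => Real.exp (-p * s.im) *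
      ∫ t in Ioi (0 : ℝ), C * Real.exp (-p * t)) (comap im atTop) (𝓝 0) := by
    have h : Tendsto (fun s : ℂ => Real.exp (-p * s.im)) (comap im atTop) (𝓝 0) :=
      Real.tendsto_exp_atBot.comp (tendsto_comap.const_mul_atTop_of_neg (by linarith))
    simpa using h.mul_const (∫ t in Ioi (0 : ℝ), C * Real.exp (-p * t))
  refine squeeze_zero_norm' ?_ hlim
  have : ∀ᶠ s : ℂ in comap im atTop, 1 ≤ s.im := tendsto_comap.eventually_ge_atTop 1
  filter_upwards [this] with s hs using key s hs

/-- Differentiating under the integral leaves the integral of a total derivative along the path, so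
only the endpoint value survives. Having primitives replaces all contour deformation later on. -/
lemma hasDerivAt_vertInt {g : ℂ → ℂ} (hg : ∀ u : ℂ, 0 < u.im → DifferentiableAt ℂ g u)
    {p : ℝ} (hp : 0 < p)
    (hb : ∀ δ > 0, ∃ C : ℝ, 0 ≤ C ∧ ∀ u : ℂ, δ ≤ u.im → ‖g u‖ ≤ C * Real.exp (-p * u.im))
    {s : ℂ} (hs : 0 < s.im) : HasDerivAt (vertInt g) (-g s) s := by
  have hU : IsOpen {u : ℂ | 0 < u.im} := isOpen_lt continuous_const continuous_im
  have hgo : DifferentiableOn ℂ g {u : ℂ | 0 < u.im} :=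
    fun u hu => (hg u hu).differentiableWithinAt
  have hg' : ∀ u : ℂ, 0 < u.im → DifferentiableAt ℂ (deriv g) u := fun u hu =>
    (hgo.deriv hU).differentiableAt (hU.mem_nhds hu)
  -- With a quarter of the height, the ball of radius 2δ about s lies above height 2δ, and Cauchy
  -- discs of radius δ about points of the shifted paths stay at height at least δ, where the bound
  -- for g holds.
  set δ : ℝ := s.im / 4 with hδ
  have hδ0 : 0 < δ := by positivity
  obtain ⟨C, hC, hbd⟩ := hb δ hδ0
  have hball : ∀ x ∈ Metric.ball s (2 * δ), 2 * δ < x.im := by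
    intro x hx
    have h1 : |(x - s).im| < 2 * δ := (abs_im_le_norm _).trans_lt (mem_ball_iff_norm.1 hx)
    rw [sub_im, abs_lt] at h1
    have := h1.1
    linarith
  have hd : ∀ (u : ℂ) (t : ℝ), 0 < t → 2 * δ + t ≤ u.im →
      ‖deriv g u‖ ≤ C / δ * Real.exp (-p * t) := by
    intro u t ht hu
    have := norm_deriv_le_of_forall_mem_sphere_norm_le (c := u) (R := δ) (f := g)
      (C := C * Real.exp (-p * t)) hδ0 ?_ ?_
    · exact this.trans (le_of_eq (by ring))
    · refine (hgo.mono ?_).diffContOnCl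
      intro x hx
      rw [closure_ball _ hδ0.ne'] at hx
      have h1 : |(x - u).im| ≤ δ := (abs_im_le_norm _).trans (mem_closedBall_iff_norm.1 hx)
      rw [sub_im, abs_le] at h1
      show 0 < x.im
      linarith [h1.1]
    · intro x hx
      have h1 : |(x - u).im| ≤ δ := (abs_im_le_norm _).trans (mem_sphere_iff_norm.1 hx).le
      rw [sub_im, abs_le] at h1
      refine (hbd x (by linarith [h1.1])).trans ?_
      gcongr C * Real.exp ?_
      nlinarith [h1.1]
  have him : ∀ (x : ℂ) (t : ℝ), (x + I * t).im = x.im + t := by simp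
  have main := hasDerivAt_integral_of_dominated_loc_of_deriv_le (𝕜 := ℂ)
    (μ := volume.restrict (Ioi (0 : ℝ))) (F := fun x t => g (x + I * t) * I)
    (F' := fun x t => deriv g (x + I * t) * I) (x₀ := s) (s := Metric.ball s (2 * δ))
    (bound := fun t => C / δ * Real.exp (-p * t)) (Metric.ball_mem_nhds s (by positivity))
    ?_ ?_ ?_ ?_ ?_ ?_
  · obtain ⟨hint, hder⟩ := main
    have hftc := integral_Ioi_of_hasDerivAt_of_tendsto' (a := (0 : ℝ)) (m := 0)
      (f := fun t : ℝ => g (s + I * t)) (f' := fun t : ℝ => deriv g (s + I * t) * I) ?_ hint ?_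
    · rw [hftc] at hder
      rw [ofReal_zero, mul_zero, add_zero, zero_sub] at hder
      exact hder
    · intro t ht
      have ht : (0 : ℝ) ≤ t := ht
      have h1 : HasDerivAt g (deriv g (s + I * t)) (s + I * t) :=
        (hg _ (by rw [him]; linarith)).hasDerivAt
      have h2 : HasDerivAt (fun t : ℝ => s + I * (t : ℂ)) I t := by
        simpa using ((hasDerivAt_id t).ofReal_comp.const_mul I).const_add s
      exact h1.comp t h2
    · have hlim : Tendsto (fun t : ℝ => C * Real.exp (-p * t)) atTop (𝓝 0) := by
        rw [← mul_zero C]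
        refine (Real.tendsto_exp_atBot.comp ?_).const_mul C
        exact tendsto_id.const_mul_atTop_of_neg (by linarith)
      refine squeeze_zero_norm' ?_ hlim
      filter_upwards [eventually_ge_atTop 0] with t ht
      refine (hbd _ (by rw [him]; linarith)).trans ?_
      gcongr C * Real.exp ?_
      rw [him]; nlinarith
  · filter_upwards [Metric.ball_mem_nhds s (by positivity : 0 < 2 * δ)] with x hx
    exact vert_aestronglyMeasurable hg (by linarith [hball x hx])
  · exact vert_integrable hg hp hb hs
  · exact vert_aestronglyMeasurable hg' hs.le
  · refine (ae_restrict_iff' measurableSet_Ioi).2 (Eventually.of_forall fun t ht x hx => ?_)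
    rw [norm_mul, norm_I, mul_one]
    exact hd _ t ht (by rw [him]; linarith [hball x hx])
  · exact integrableOn_exp_neg_mul hp _
  · refine (ae_restrict_iff' measurableSet_Ioi).2 (Eventually.of_forall fun t ht x hx => ?_)
    have ht : (0 : ℝ) < t := ht
    have h1 : HasDerivAt g (deriv g (x + I * t)) (x + I * t) :=
      (hg _ (by rw [him]; linarith [hball x hx])).hasDerivAt
    have h2 : HasDerivAt (fun x : ℂ => x + I * (t : ℂ)) 1 x := (hasDerivAt_id x).add_const _
    simpa using (h1.comp x h2).mul_const I

/-- The integral from height ε differs from the full one by the integral over (0, ε], which tends to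
0 by absolute continuity. This extends the primitive to the boundary along a vertical line. -/
lemma tendsto_vertInt_real {g : ℂ → ℂ} (ρ : ℝ)
    (hint : IntegrableOn (fun t : ℝ => g (ρ + I * t) * I) (Ioi 0)) :
    Tendsto (fun ε : ℝ => vertInt g (ρ + I * ε)) (𝓝[>] 0) (𝓝 (vertInt g ρ)) := by
  have hrw : ∀ ε ∈ Ioi (0 : ℝ), vertInt g ρ - (∫ t in (0 : ℝ)..ε, g (ρ + I * t) * I) =
      vertInt g (ρ + I * ε) := by
    intro ε hε
    have h1 : vertInt g (ρ + I * ε) = ∫ t in Ioi ε, g (ρ + I * t) * I := by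
      have := (measurePreserving_add_right volume ε).setIntegral_preimage_emb
        (measurableEmbedding_addRight ε) (fun t : ℝ => g (ρ + I * t) * I) (Ioi ε)
      rw [preimage_add_const_Ioi, sub_self] at this
      rw [← this]
      unfold vertInt
      congr 1; ext t; push_cast; ring_nf
    rw [h1, intervalIntegral.integral_of_le (le_of_lt hε)]
    unfold vertInt
    rw [← Ioc_union_Ioi_eq_Ioi (le_of_lt hε),
      setIntegral_union (Ioc_disjoint_Ioi le_rfl) measurableSet_Ioi
        (hint.mono_set Ioc_subset_Ioi_self) (hint.mono_set (Ioi_subset_Ioi (le_of_lt hε)))]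
    ring
  have h0 : Tendsto (fun ε : ℝ => vertInt g ρ - ∫ t in (0 : ℝ)..ε, g (ρ + I * t) * I)
      (𝓝[>] 0) (𝓝 (vertInt g ρ - 0)) := by
    refine tendsto_const_nhds.sub ?_
    have hc : ContinuousOn (fun ε : ℝ => ∫ t in (0 : ℝ)..ε, g (ρ + I * t) * I) (Icc 0 1) :=
      intervalIntegral.continuousOn_primitive_interval
        (by
          rw [uIcc_of_le zero_le_one, integrableOn_Icc_iff_integrableOn_Ioc]
          exact hint.mono_set Ioc_subset_Ioi_self)
      |>.mono (by rw [uIcc_of_le zero_le_one])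
    have := hc 0 (by simp)
    have h2 : Tendsto (fun ε : ℝ => ∫ t in (0 : ℝ)..ε, g (ρ + I * t) * I) (𝓝[Icc 0 1] 0)
        (𝓝 0) := by simpa [ContinuousWithinAt] using this
    refine h2.mono_left ?_
    rw [← nhdsWithin_Ioc_eq_nhdsGT (zero_lt_one (α := ℝ))]
    exact nhdsWithin_mono _ Ioc_subset_Icc_self
  rw [sub_zero] at h0
  refine h0.congr' ?_
  filter_upwards [self_mem_nhdsWithin] with ε hε using hrw ε hε

/-! ### Period integrals of functions that are small at the rational cusps -/

/-- A holomorphic function on the upper half-plane with exponential decay at `i∞`, with moderate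
growth towards the real line and bounded on the vertical lines over rational numbers. -/
structure IsCuspidal (f : ℂ → ℂ) : Prop where
  differentiableAt : ∀ u : ℂ, 0 < u.im → DifferentiableAt ℂ f u
  growth : ∃ C p : ℝ, 0 ≤ C ∧ 0 < p ∧
    ∀ u : ℂ, 0 < u.im → ‖f u‖ ≤ C * u.im ^ (-(5 / 4) : ℝ) * Real.exp (-p * u.im)
  bounded : ∀ ρ : ℚ, ∃ C : ℝ, ∀ t : ℝ, 0 < t → ‖f (ρ + I * t)‖ ≤ C

/-- The function `f(u) / √(-i(u - σ))`. -/
noncomputable def kern (f : ℂ → ℂ) (σ : ℝ) (u : ℂ) : ℂ := f u / rt (u - σ)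

lemma sub_ofReal_im (u : ℂ) (σ : ℝ) : (u - σ).im = u.im := by simp

lemma sqrt_im_le_norm_rt (u : ℂ) (σ : ℝ) : √u.im ≤ ‖rt (u - σ)‖ := by
  rw [norm_rt]
  apply Real.sqrt_le_sqrt
  rw [← sub_ofReal_im u σ]
  exact (le_abs_self _).trans (abs_im_le_norm _)

lemma sub_ofReal_ne_zero {u : ℂ} (hu : 0 < u.im) (σ : ℝ) : u - σ ≠ 0 :=
  ne_zero_of_im_pos (by rwa [sub_ofReal_im])

lemma IsCuspidal.differentiableAt_kern {f : ℂ → ℂ} (hf : IsCuspidal f) (σ : ℝ) (u : ℂ)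
    (hu : 0 < u.im) : DifferentiableAt ℂ (kern f σ) u := by
  refine (hf.differentiableAt u hu).div ?_ (rt_ne_zero (sub_ofReal_ne_zero hu σ))
  exact DifferentiableAt.comp u (differentiableAt_rt (Or.inl (by rwa [sub_ofReal_im])))
    (by fun_prop)

lemma norm_kern_le {f : ℂ → ℂ} {u : ℂ} (hu : 0 < u.im) (σ : ℝ) :
    ‖kern f σ u‖ ≤ ‖f u‖ * u.im ^ (-(1 / 2) : ℝ) := by
  rw [kern, norm_div, div_eq_mul_inv, Real.rpow_neg hu.le, ← Real.sqrt_eq_rpow]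
  gcongr
  exact sqrt_im_le_norm_rt u σ

lemma IsCuspidal.growth_kern {f : ℂ → ℂ} (hf : IsCuspidal f) : ∃ C p : ℝ, 0 ≤ C ∧ 0 < p ∧
    ∀ (σ : ℝ) (u : ℂ), 0 < u.im →
      ‖kern f σ u‖ ≤ C * u.im ^ (-(7 / 4) : ℝ) * Real.exp (-p * u.im) := by
  obtain ⟨C, p, hC, hp, h⟩ := hf.growth
  refine ⟨C, p, hC, hp, fun σ u hu => (norm_kern_le hu σ).trans ?_⟩
  calc ‖f u‖ * u.im ^ (-(1 / 2) : ℝ)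
      ≤ C * u.im ^ (-(5 / 4) : ℝ) * Real.exp (-p * u.im) * u.im ^ (-(1 / 2) : ℝ) := by
        gcongr
        exact h u hu
    _ = C * (u.im ^ (-(5 / 4) : ℝ) * u.im ^ (-(1 / 2) : ℝ)) * Real.exp (-p * u.im) := by ring
    _ = _ := by rw [← Real.rpow_add hu]; norm_num

lemma IsCuspidal.decay_kern {f : ℂ → ℂ} (hf : IsCuspidal f) : ∃ p : ℝ, 0 < p ∧ ∀ σ : ℝ,
    ∀ δ > 0, ∃ C : ℝ, 0 ≤ C ∧ ∀ u : ℂ, δ ≤ u.im → ‖kern f σ u‖ ≤ C * Real.exp (-p * u.im) := by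
  obtain ⟨C, p, hC, hp, h⟩ := hf.growth_kern
  refine ⟨p, hp, fun σ δ hδ => ⟨C * δ ^ (-(7 / 4) : ℝ), by positivity, fun u hu => ?_⟩⟩
  refine (h σ u (hδ.trans_le hu)).trans ?_
  gcongr C * ?_ * _
  exact Real.rpow_le_rpow_of_nonpos hδ hu (by norm_num)

lemma IsCuspidal.vertical_bound {f : ℂ → ℂ} (hf : IsCuspidal f) (ρ : ℚ) : ∃ C p : ℝ, 0 ≤ C ∧ 0 < p ∧
    ∀ t : ℝ, 0 < t → ‖f (ρ + I * t)‖ ≤ C * Real.exp (-p * t) := by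
  obtain ⟨C, p, hC, hp, h⟩ := hf.growth
  obtain ⟨B, hB⟩ := hf.bounded ρ
  refine ⟨max C (B * Real.exp p), p, le_max_of_le_left hC, hp, fun t ht => ?_⟩
  rcases le_total 1 t with h1 | h1
  · have := h (ρ + I * t) (by simpa using ht)
    have him : ((ρ : ℂ) + I * t).im = t := by simp
    rw [him] at this
    refine this.trans ?_
    have h2 : t ^ (-(5 / 4) : ℝ) ≤ 1 := Real.rpow_le_one_of_one_le_of_nonpos h1 (by norm_num)
    gcongr
    calc C * t ^ (-(5 / 4) : ℝ) ≤ C * 1 := by gcongr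
      _ ≤ _ := by rw [mul_one]; exact le_max_left _ _
  · have hB0 : 0 ≤ B := (norm_nonneg _).trans (hB t ht)
    calc ‖f (ρ + I * t)‖ ≤ B := hB t ht
      _ ≤ B * Real.exp p * Real.exp (-p * t) := by
        rw [mul_assoc, ← Real.exp_add]
        apply le_mul_of_one_le_right hB0
        apply Real.one_le_exp
        nlinarith
      _ ≤ _ := by gcongr; exact le_max_right _ _

lemma integrableOn_rpow_mul_exp {p : ℝ} (hp : 0 < p) :
    IntegrableOn (fun t : ℝ => t ^ (-(1 / 2) : ℝ) * Real.exp (-p * t)) (Ioi 0) := by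
  have := integrableOn_rpow_mul_exp_neg_mul_rpow (s := -(1 / 2)) (p := 1) (b := p) (by norm_num)
    one_pos hp
  simpa using this

/-- The worst case is ρ = σ, where the denominator has modulus √t. Boundedness of f over ρ still
leaves the integrable singularity t^(-1/2). -/
lemma IsCuspidal.integrableOn_kern {f : ℂ → ℂ} (hf : IsCuspidal f) (ρ : ℚ) (σ : ℝ) :
    IntegrableOn (fun t : ℝ => kern f σ ((ρ : ℝ) + I * t) * I) (Ioi 0) := by
  obtain ⟨C, p, hC, hp, h⟩ := hf.vertical_bound ρ
  refine ((integrableOn_rpow_mul_exp hp).const_mul C).mono'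
    (vert_aestronglyMeasurable (hf.differentiableAt_kern σ) (by simp)) ?_
  refine (ae_restrict_iff' measurableSet_Ioi).2 (Eventually.of_forall fun t ht => ?_)
  have ht : (0 : ℝ) < t := ht
  have him : (((ρ : ℝ) : ℂ) + I * t).im = t := by simp
  rw [norm_mul, norm_I, mul_one]
  refine (norm_kern_le (by rwa [him]) σ).trans ?_
  rw [him]
  calc _ ≤ C * Real.exp (-p * t) * t ^ (-(1 / 2) : ℝ) := by gcongr; exact_mod_cast h t ht
    _ = _ := by ring

/-! ### Moebius transformations -/

/-- The Moebius transformation with real coefficients. -/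
noncomputable def mob (a b c d : ℝ) (τ : ℂ) : ℂ := (a * τ + b) / (c * τ + d)

lemma mob_den_ne_zero {a b c d : ℝ} (hdet : a * d - b * c = 1) {τ : ℂ} (hτ : 0 < τ.im) :
    (c : ℂ) * τ + d ≠ 0 := by
  intro h
  have h1 := congrArg im h
  have h2 := congrArg re h
  simp only [add_im, mul_im, ofReal_re, ofReal_im, zero_mul, add_zero, zero_im, add_re, mul_re,
    sub_zero, zero_re] at h1 h2
  have hc : c = 0 := by
    rcases mul_eq_zero.1 h1 with h | h
    · exact h
    · exact absurd h hτ.ne'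
  subst hc
  have hd : d = 0 := by simpa using h2
  subst hd
  simp at hdet

lemma mob_im {a b c d : ℝ} (hdet : a * d - b * c = 1) (τ : ℂ) :
    (mob a b c d τ).im = τ.im / normSq (c * τ + d) := by
  rw [mob, div_im]
  simp only [add_im, mul_im, ofReal_re, ofReal_im, zero_mul, add_zero, add_re, mul_re,
    sub_zero]
  rw [div_sub_div_same]
  congr 1
  linear_combination τ.im * hdet

lemma mob_im_pos {a b c d : ℝ} (hdet : a * d - b * c = 1) {τ : ℂ} (hτ : 0 < τ.im) :
    0 < (mob a b c d τ).im := by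
  rw [mob_im hdet]
  exact div_pos hτ (normSq_pos.2 (mob_den_ne_zero hdet hτ))

lemma hasDerivAt_mob {a b c d : ℝ} (hdet : a * d - b * c = 1) {τ : ℂ}
    (h0 : (c : ℂ) * τ + d ≠ 0) :
    HasDerivAt (mob a b c d) (1 / (c * τ + d) ^ 2) τ := by
  have h1 : HasDerivAt (fun τ : ℂ => (a : ℂ) * τ + b) a τ := by
    simpa using ((hasDerivAt_id τ).const_mul (a : ℂ)).add_const (b : ℂ)
  have h2 : HasDerivAt (fun τ : ℂ => (c : ℂ) * τ + d) c τ := by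
    simpa using ((hasDerivAt_id τ).const_mul (c : ℂ)).add_const (d : ℂ)
  refine (h1.div h2 h0).congr_deriv ?_
  congr 1
  have : (a : ℂ) * d - b * c = 1 := by exact_mod_cast hdet
  linear_combination this

/-! ### The transformation of the period integrals -/

lemma IsCuspidal.hasDerivAt_vertInt {f : ℂ → ℂ} (hf : IsCuspidal f) (σ : ℝ) {s : ℂ}
    (hs : 0 < s.im) : HasDerivAt (vertInt (kern f σ)) (-kern f σ s) s := by
  obtain ⟨p, hp, h⟩ := hf.decay_kern
  exact EtaTheta.hasDerivAt_vertInt (hf.differentiableAt_kern σ) hp (h σ) hs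

lemma IsCuspidal.tendsto_vertInt {f : ℂ → ℂ} (hf : IsCuspidal f) (σ : ℝ) :
    Tendsto (vertInt (kern f σ)) (comap im atTop) (𝓝 0) := by
  obtain ⟨p, hp, h⟩ := hf.decay_kern
  exact EtaTheta.tendsto_vertInt hp (h σ)

lemma IsCuspidal.tendsto_vertInt_rat {f : ℂ → ℂ} (hf : IsCuspidal f) (σ : ℝ) (ρ : ℚ) :
    Tendsto (fun ε : ℝ => vertInt (kern f σ) (ρ + I * ε)) (𝓝[>] 0) (𝓝 (vertInt (kern f σ) ρ)) := by
  have := tendsto_vertInt_real (ρ : ℝ) (hf.integrableOn_kern ρ σ)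
  simpa using this

/-- The mean value inequality on a horizontal line, where the derivative is bounded by the growth
estimate at that height. -/
lemma IsCuspidal.norm_vertInt_sub_le {f : ℂ → ℂ} (hf : IsCuspidal f) : ∃ C : ℝ, 0 ≤ C ∧
    ∀ (σ : ℝ) (s w : ℂ), 0 < w.im → s.im = w.im →
      ‖vertInt (kern f σ) s - vertInt (kern f σ) w‖ ≤
        C * w.im ^ (-(7 / 4) : ℝ) * |s.re - w.re| := by
  obtain ⟨C, p, hC, hp, h⟩ := hf.growth_kern
  refine ⟨C, hC, fun σ s w hw hs => ?_⟩
  have hconv : Convex ℝ {u : ℂ | u.im = w.im} := by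
    intro x hx y hy a b ha hb hab
    simp only [mem_ofPred_eq] at hx hy ⊢
    simp [hx, hy, ← add_mul, hab]
  have := hconv.norm_image_sub_le_of_norm_hasDerivWithin_le (f := vertInt (kern f σ))
    (f' := fun u => -kern f σ u) (C := C * w.im ^ (-(7 / 4) : ℝ)) (x := w) (y := s)
    (fun x hx => (hf.hasDerivAt_vertInt σ (by rw [hx]; exact hw)).hasDerivWithinAt) ?_ rfl hs
  · refine this.trans (le_of_eq ?_)
    congr 1
    have : s - w = ((s.re - w.re : ℝ) : ℂ) := by
      apply Complex.ext <;> simp [hs]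
    rw [this, norm_real, Real.norm_eq_abs]
  · intro x hx
    have hx : x.im = w.im := hx
    rw [norm_neg]
    refine (h σ x (by rw [hx]; exact hw)).trans ?_
    rw [hx]
    apply mul_le_of_le_one_right (by positivity)
    rw [Real.exp_le_one_iff]
    nlinarith

/-- The path is the semicircle from σ orthogonal to the real axis, which is tangent to the vertical
line there. At height y its horizontal deviation is O(y²), while the kernel grows at most like
y^(-7/4), so the values on the path and on the vertical line differ by O(y^(1/4)). -/
lemma IsCuspidal.tendsto_horocycle {f : ℂ → ℂ} (hf : IsCuspidal f) (σ : ℚ) (c D : ℝ)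
    (hD : D ≠ 0) (s : ℝ → ℂ)
    (hs : ∀ t : ℝ, s t = ⟨σ - c * D ^ 3 * t ^ 2 / (1 + c ^ 2 * D ^ 2 * t ^ 2),
      D ^ 2 * t / (1 + c ^ 2 * D ^ 2 * t ^ 2)⟩) :
    Tendsto (fun t : ℝ => vertInt (kern f σ) (s t)) (𝓝[>] 0) (𝓝 (vertInt (kern f σ) σ)) := by
  obtain ⟨C, hC, h⟩ := hf.norm_vertInt_sub_le
  set y : ℝ → ℝ := fun t => D ^ 2 * t / (1 + c ^ 2 * D ^ 2 * t ^ 2) with hy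
  have hden : ∀ t : ℝ, 0 < 1 + c ^ 2 * D ^ 2 * t ^ 2 := fun t => by positivity
  have hy0 : Tendsto y (𝓝[>] 0) (𝓝[>] 0) := by
    rw [tendsto_nhdsWithin_iff]
    constructor
    · have : ContinuousAt y 0 := by
        rw [hy]
        exact ContinuousAt.div (by fun_prop) (by fun_prop) (hden 0).ne'
      have h0 : y 0 = 0 := by simp [hy]
      rw [ContinuousAt, h0] at this
      exact this.mono_left nhdsWithin_le_nhds
    · filter_upwards [self_mem_nhdsWithin] with t ht
      have ht : 0 < t := ht
      have := hden t
      simp only [hy, mem_Ioi]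
      positivity
  have h1 := (hf.tendsto_vertInt_rat σ σ).comp hy0
  have h2 : Tendsto (fun t : ℝ => vertInt (kern f σ) (s t) -
      vertInt (kern f σ) (σ + I * y t)) (𝓝[>] 0) (𝓝 0) := by
    have hlim : Tendsto (fun t : ℝ => C * ((|c| * |D| * (1 + c ^ 2 * D ^ 2) / D ^ 2) *
        y t ^ (1 / 4 : ℝ))) (𝓝[>] 0) (𝓝 0) := by
      have : Tendsto (fun t : ℝ => y t ^ (1 / 4 : ℝ)) (𝓝[>] 0) (𝓝 0) := by
        have := ((Real.continuousAt_rpow_const 0 (1 / 4) (Or.inr (by norm_num))).tendsto).comp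
          (hy0.mono_right nhdsWithin_le_nhds)
        simpa [Function.comp_def] using this
      simpa using (this.const_mul (|c| * |D| * (1 + c ^ 2 * D ^ 2) / D ^ 2)).const_mul C
    refine squeeze_zero_norm' ?_ hlim
    filter_upwards [Ioo_mem_nhdsGT (zero_lt_one (α := ℝ))] with t ht
    have ht0 : 0 < t := ht.1
    have hd := hden t
    have hyt : 0 < y t := by simp only [hy]; positivity
    have him : ((σ : ℂ) + I * y t).im = y t := by simp
    have hre : ((σ : ℂ) + I * y t).re = σ := by simp
    refine (h σ (s t) (σ + I * y t) (by rwa [him]) (by rw [him, hs])).trans ?_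
    rw [him, hre, hs, mul_assoc]
    gcongr C * ?_
    have hre2 : ((σ : ℝ) - c * D ^ 3 * t ^ 2 / (1 + c ^ 2 * D ^ 2 * t ^ 2)) - σ =
        -(c * D * t * y t) := by
      simp only [hy]; ring
    simp only
    rw [hre2, abs_neg, abs_mul, abs_mul, abs_mul, abs_of_pos ht0, abs_of_pos hyt]
    have hty : t ≤ (1 + c ^ 2 * D ^ 2) / D ^ 2 * y t := by
      simp only [hy]
      rw [div_mul_div_comm, le_div_iff₀ (by positivity)]
      have : t ^ 2 ≤ 1 := by nlinarith [ht.2]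
      have h3 : c ^ 2 * D ^ 2 * t ^ 2 ≤ c ^ 2 * D ^ 2 := by
        apply mul_le_of_le_one_right (by positivity) this
      have h4 : 0 ≤ D ^ 2 * t := by positivity
      nlinarith
    have hpow : y t ^ (-(7 / 4) : ℝ) * (y t * y t) = y t ^ (1 / 4 : ℝ) := by
      rw [← pow_two, ← Real.rpow_natCast, ← Real.rpow_add hyt]; norm_num
    calc y t ^ (-(7 / 4) : ℝ) * (|c| * |D| * t * y t)
        ≤ y t ^ (-(7 / 4) : ℝ) * (|c| * |D| * ((1 + c ^ 2 * D ^ 2) / D ^ 2 * y t) * y t) := by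
          gcongr
      _ = |c| * |D| * (1 + c ^ 2 * D ^ 2) / D ^ 2 * (y t ^ (-(7 / 4) : ℝ) * (y t * y t)) := by
          ring
      _ = _ := by rw [hpow]
  have h3 := h2.add h1
  simp only [Function.comp_def, sub_add_cancel, zero_add] at h3
  exact h3

/-- The transformation of the period integral from a rational number `σ` to `i∞` under a Moebius
transformation `γ` with `f(γ τ) = J(τ) f(τ)`. -/
theorem IsCuspidal.vertInt_mob {f : ℂ → ℂ} (hf : IsCuspidal f) {a b c d : ℝ}
    (hdet : a * d - b * c = 1) (hc : c ≠ 0) {σ σ' ρ : ℚ} (hD : c * σ + d ≠ 0)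
    (hσ' : (σ' : ℝ) = (a * σ + b) / (c * σ + d)) (hρ : (ρ : ℝ) = -d / c) {J : ℂ → ℂ} {P : ℂ}
    (hJ : ∀ τ : ℂ, 0 < τ.im → f (mob a b c d τ) = J τ * f τ)
    (hP : ∀ τ : ℂ, 0 < τ.im →
      J τ / (rt (mob a b c d τ - σ') * (c * τ + d) ^ 2) = P / rt (τ - σ)) :
    vertInt (kern f σ') σ' = P * (vertInt (kern f σ) σ - vertInt (kern f σ) ρ) := by
  -- The chain rule and `hP` make the derivative of Ψ vanish. The constant is then computed twice,
  -- by letting s tend to ρ vertically and to σ along the preimage of a vertical line.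
  set Ψ : ℂ → ℂ := fun s => vertInt (kern f σ') (mob a b c d s) - P * vertInt (kern f σ) s with hΨ
  have hder : ∀ s : ℂ, 0 < s.im → HasDerivAt Ψ 0 s := by
    intro s hs
    have h1 := (hf.hasDerivAt_vertInt σ' (mob_im_pos hdet hs)).comp s
      (hasDerivAt_mob hdet (mob_den_ne_zero hdet hs))
    have h2 := (hf.hasDerivAt_vertInt σ hs).const_mul P
    refine (h1.sub h2).congr_deriv ?_
    have h3 := hP s hs
    simp only [kern, hJ s hs, ofReal_ratCast]
    have h4 : J s * f s / rt (mob a b c d s - σ') * (1 / (c * s + d) ^ 2) =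
        f s * (J s / (rt (mob a b c d s - σ') * (c * s + d) ^ 2)) := by
      simp only [div_eq_mul_inv, mul_inv]; ring
    rw [neg_mul, h4, h3]
    ring
  have hU : IsOpen {u : ℂ | 0 < u.im} := isOpen_lt continuous_const continuous_im
  have hconst : ∃ A, ∀ s : ℂ, 0 < s.im → Ψ s = A := by
    have := hU.exists_is_const_of_deriv_eq_zero (convex_halfSpace_im_gt 0).isPreconnected
      (f := Ψ) (fun s hs => (hder s hs).differentiableAt.differentiableWithinAt)
      (fun s hs => (hder s hs).deriv)
    exact this
  obtain ⟨A, hA⟩ := hconst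
  -- As s descends to the pole ρ, its image rises to i∞ with height 1/(c²t), so the first term of Ψ
  -- disappears.
  have hA1 : A = -(P * vertInt (kern f σ) ρ) := by
    have hlim : Tendsto (fun t : ℝ => Ψ (ρ + I * t)) (𝓝[>] 0)
        (𝓝 (0 - P * vertInt (kern f σ) ρ)) := by
      refine Tendsto.sub ?_ ((hf.tendsto_vertInt_rat σ ρ).const_mul P)
      refine (hf.tendsto_vertInt σ').comp ?_
      rw [tendsto_comap_iff]
      have : Tendsto (fun t : ℝ => (c ^ 2)⁻¹ * t⁻¹) (𝓝[>] 0) atTop :=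
        tendsto_inv_nhdsGT_zero.const_mul_atTop (by positivity)
      refine this.congr' ?_
      filter_upwards [self_mem_nhdsWithin] with t ht
      have ht : 0 < t := ht
      have : (c : ℂ) * (ρ + I * t) + d = I * (c * t : ℝ) := by
        have : (ρ : ℂ) = -d / c := by exact_mod_cast congrArg ((↑) : ℝ → ℂ) hρ
        have hc' : (c : ℂ) ≠ 0 := by exact_mod_cast hc
        rw [this]; push_cast; field_simp; ring
      simp only [Function.comp_apply]
      rw [mob_im hdet, this]
      simp only [normSq_mul, normSq_I, normSq_ofReal, one_mul]
      simp
      field_simp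
    have hlim2 : Tendsto (fun t : ℝ => Ψ (ρ + I * t)) (𝓝[>] 0) (𝓝 A) := by
      refine tendsto_const_nhds.congr' ?_
      filter_upwards [self_mem_nhdsWithin] with t ht
      exact (hA _ (by simpa using ht)).symm
    rw [tendsto_nhds_unique hlim2 hlim, zero_sub]
  set D : ℝ := c * σ + d with hDdef
  set s : ℝ → ℂ := fun t => ⟨σ - c * D ^ 3 * t ^ 2 / (1 + c ^ 2 * D ^ 2 * t ^ 2),
      D ^ 2 * t / (1 + c ^ 2 * D ^ 2 * t ^ 2)⟩ with hs
  -- The path s is the preimage of the vertical line over σ'. In closed form it is σ + i t D²/(1 - i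
  -- c D t).
  have hsmob : ∀ t : ℝ, 0 < t → mob a b c d (s t) = σ' + I * t := by
    intro t ht
    have hden : 1 + c ^ 2 * D ^ 2 * t ^ 2 ≠ 0 := by positivity
    obtain ⟨w, hw⟩ : ∃ w : ℂ, w = 1 - I * c * D * t := ⟨_, rfl⟩
    obtain ⟨v, hv⟩ : ∃ v : ℂ, v = 1 + I * c * D * t := ⟨_, rfl⟩
    have hw0 : w ≠ 0 := by
      intro h
      have := congrArg re (hw.symm.trans h)
      simp at this
    have hv0 : v ≠ 0 := by
      intro h
      have := congrArg re (hv.symm.trans h)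
      simp at this
    have hst : s t = σ + I * t * D ^ 2 / w := by
      have hprod : (1 : ℂ) + c ^ 2 * D ^ 2 * t ^ 2 = w * v := by
        rw [hw, hv]
        linear_combination (c ^ 2 * D ^ 2 * t ^ 2 : ℂ) * I_sq
      have : s t = ((σ - c * D ^ 3 * t ^ 2 / (1 + c ^ 2 * D ^ 2 * t ^ 2) : ℝ) : ℂ) +
          ((D ^ 2 * t / (1 + c ^ 2 * D ^ 2 * t ^ 2) : ℝ) : ℂ) * I := by
        rw [hs]; exact Complex.mk_eq_add_mul_I _ _
      rw [this]
      push_cast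
      rw [hprod]
      field_simp
      rw [hw, hv]
      linear_combination (-(c * D ^ 3 * t ^ 2 : ℂ)) * I_sq
    have hDC : (D : ℂ) = c * σ + d := by rw [hDdef]; push_cast; rfl
    have hDC0 : (D : ℂ) ≠ 0 := by exact_mod_cast hD
    have hnum : (c : ℂ) * s t + d = D / w := by
      rw [hst]; field_simp; rw [hw, hDC]; ring
    have hdetC : (a : ℂ) * d - b * c = 1 := by exact_mod_cast hdet
    have hσC : (σ' : ℂ) = (a * σ + b) / D := by
      rw [hDC]; exact_mod_cast congrArg ((↑) : ℝ → ℂ) hσ'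
    rw [mob, hnum, hst, hσC]
    field_simp
    rw [hw, hDC]
    linear_combination (I * t * (c * σ + d) : ℂ) * hdetC
  have hlim := (hf.tendsto_horocycle σ c D hD s (fun t => rfl)).const_mul P
  have hlim' := (hf.tendsto_vertInt_rat σ' σ').sub hlim
  have hlim2 : Tendsto (fun t : ℝ => vertInt (kern f σ') (σ' + I * t) -
      P * vertInt (kern f σ) (s t)) (𝓝[>] 0) (𝓝 A) := by
    refine tendsto_const_nhds.congr' ?_
    filter_upwards [self_mem_nhdsWithin] with t ht
    have ht : 0 < t := ht
    have : 0 < (s t).im := by simp only [hs]; positivity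
    rw [← hA _ this]
    simp only [hΨ, hsmob t ht]
  have := tendsto_nhds_unique hlim2 hlim'
  rw [hA1] at this
  linear_combination -this

/-! ### Branches of the automorphy factors -/

lemma mob_sub_mob {a b c d : ℝ} (hdet : a * d - b * c = 1) {τ σ : ℂ} (hτ : (c : ℂ) * τ + d ≠ 0)
    (hσ : (c : ℂ) * σ + d ≠ 0) :
    mob a b c d τ - mob a b c d σ = (τ - σ) / ((c * τ + d) * (c * σ + d)) := by
  have : (a : ℂ) * d - b * c = 1 := by exact_mod_cast hdet
  rw [mob, mob, div_sub_div _ _ hτ hσ]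
  congr 1
  linear_combination (τ - σ) * this

/-- The set lies between the open lower half-plane and its closure. Thus the two real rays separated
by ρ belong to one connected set. -/
lemma isPreconnected_lower (ρ : ℝ) : IsPreconnected {σ : ℂ | σ.im ≤ 0 ∧ σ ≠ ρ} := by
  refine (convex_halfSpace_im_lt 0).isPreconnected.subset_closure (fun σ hσ => ?_) (fun σ hσ => ?_)
  · refine ⟨le_of_lt hσ, ?_⟩
    rintro rfl
    simp at hσ
  · rw [closure_setOfPred_im_lt]
    exact hσ.1

/-- By the difference formula `mob_sub_mob` and cσ + d = -c(ρ - σ), every dependence on τ and σ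
cancels once the roots are squared. -/
lemma branch_sq {a b c d : ℝ} (hdet : a * d - b * c = 1) (hc : c ≠ 0) {ρ : ℝ} (hρ : ρ = -d / c)
    {J : ℂ → ℂ} {ω : ℂ} (hJ : ∀ τ : ℂ, 0 < τ.im → J τ ^ 2 = ω * (c * τ + d) ^ 3)
    {τ σ : ℂ} (hτ : 0 < τ.im) (hσ : σ.im ≤ 0) (hσρ : σ ≠ ρ) :
    (J τ * rt (τ - σ) /
      (rt (mob a b c d τ - mob a b c d σ) * (c * τ + d) ^ 2 * rt (ρ - σ))) ^ 2 =
        -I * c * ω := by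
  have hc' : (c : ℂ) ≠ 0 := by exact_mod_cast hc
  have h1 : (c : ℂ) * τ + d ≠ 0 := mob_den_ne_zero hdet hτ
  have hρσ : (ρ : ℂ) - σ ≠ 0 := sub_ne_zero.2 hσρ.symm
  have h2 : (c : ℂ) * σ + d = -c * (ρ - σ) := by
    rw [hρ]; push_cast; field_simp; ring
  have h2' : (c : ℂ) * σ + d ≠ 0 := by
    rw [h2]; exact mul_ne_zero (neg_ne_zero.2 hc') hρσ
  have h3 : τ - σ ≠ 0 := by
    intro h
    have := congrArg im h
    simp at this
    linarith
  rw [div_pow, mul_pow, mul_pow, mul_pow, hJ τ hτ, rt_sq, rt_sq, rt_sq,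
    mob_sub_mob hdet h1 h2', h2]
  generalize (c : ℂ) * τ + d = u at *
  generalize (ρ : ℂ) - σ = v at *
  generalize τ - σ = w at *
  field_simp
  linear_combination ω * I_sq

/-- The constancy of the branch of a quotient of automorphy factors. -/
theorem exists_branch {a b c d : ℝ} (hdet : a * d - b * c = 1) (hc : c ≠ 0) {ρ : ℝ}
    (hρ : ρ = -d / c) {J : ℂ → ℂ} (hJc : ContinuousOn J {τ | 0 < τ.im}) {ω : ℂ} (hω : ‖ω‖ = 1)
    (hJ : ∀ τ : ℂ, 0 < τ.im → J τ ^ 2 = ω * (c * τ + d) ^ 3) :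
    ∃ δ : ℂ, ‖δ‖ = √|c| ∧ ∀ τ σ : ℂ, 0 < τ.im → σ.im ≤ 0 → σ ≠ ρ →
      J τ * rt (τ - σ) =
        δ * (rt (mob a b c d τ - mob a b c d σ) * (c * τ + d) ^ 2 * rt (ρ - σ)) := by
  set S : Set (ℂ × ℂ) := {τ : ℂ | 0 < τ.im} ×ˢ {σ : ℂ | σ.im ≤ 0 ∧ σ ≠ ρ} with hS
  have hSc : IsPreconnected S :=
    (convex_halfSpace_im_gt 0).isPreconnected.prod (isPreconnected_lower ρ)
  set R : ℂ × ℂ → ℂ := fun z => J z.1 * rt (z.1 - z.2) /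
      (rt (mob a b c d z.1 - mob a b c d z.2) * (c * z.1 + d) ^ 2 * rt (ρ - z.2)) with hR
  have hc' : (c : ℂ) ≠ 0 := by exact_mod_cast hc
  have hσne : ∀ σ : ℂ, σ ≠ ρ → (c : ℂ) * σ + d ≠ 0 := by
    intro σ hσ h
    apply hσ
    rw [hρ]; push_cast; field_simp; linear_combination h
  have him : ∀ z ∈ S, 0 < (z.1 - z.2).im := by
    rintro ⟨τ, σ⟩ ⟨hτ, hσ, -⟩
    have hτ : 0 < τ.im := hτ
    simp only [sub_im] at *
    linarith
  have himm : ∀ z ∈ S, 0 < (mob a b c d z.1 - mob a b c d z.2).im := by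
    rintro ⟨τ, σ⟩ ⟨hτ, hσ, -⟩
    rw [sub_im, sub_pos]
    refine lt_of_le_of_lt ?_ (mob_im_pos hdet hτ)
    rw [mob_im hdet]
    exact div_nonpos_of_nonpos_of_nonneg hσ (normSq_nonneg _)
  have himρ : ∀ z ∈ S, 0 < ((ρ : ℂ) - z.2).im ∨ ((ρ : ℂ) - z.2).re ≠ 0 := by
    rintro ⟨τ, σ⟩ ⟨hτ, hσ, hσ'⟩
    simp only [sub_im, ofReal_im, zero_sub, sub_re, ofReal_re] at *
    rcases hσ.lt_or_eq with h | h
    · left; linarith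
    · right
      intro h'
      apply hσ'
      apply Complex.ext <;> simp
      · linarith
      · exact h
  have hden : ∀ z ∈ S, rt (mob a b c d z.1 - mob a b c d z.2) * (c * z.1 + d) ^ 2 *
      rt (ρ - z.2) ≠ 0 := by
    intro z hz
    refine mul_ne_zero (mul_ne_zero (rt_ne_zero (ne_zero_of_im_pos (himm z hz)))
      (pow_ne_zero _ (mob_den_ne_zero hdet hz.1))) (rt_ne_zero (sub_ne_zero.2 hz.2.2.symm))
  have hRc : ContinuousOn R S := by
    refine ContinuousOn.div ?_ ?_ hden
    · refine (hJc.comp continuousOn_fst fun z hz => hz.1).mul fun z hz => ?_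
      have := (differentiableAt_rt (Or.inl (him z hz))).continuousAt
      exact (ContinuousAt.comp (f := fun z : ℂ × ℂ => z.1 - z.2) this
        (by fun_prop)).continuousWithinAt
    · refine ContinuousOn.mul (ContinuousOn.mul (fun z hz => ?_) (by fun_prop)) fun z hz => ?_
      · have h1 := (differentiableAt_rt (Or.inl (himm z hz))).continuousAt
        have h2 := (hasDerivAt_mob hdet (mob_den_ne_zero hdet hz.1)).continuousAt
        have h3 := (hasDerivAt_mob hdet (hσne z.2 hz.2.2)).continuousAt
        exact (ContinuousAt.comp (f := fun z : ℂ × ℂ => mob a b c d z.1 - mob a b c d z.2) h1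
          ((ContinuousAt.comp h2 continuousAt_fst).sub
            (ContinuousAt.comp h3 continuousAt_snd))).continuousWithinAt
      · have := (differentiableAt_rt (himρ z hz)).continuousAt
        exact (ContinuousAt.comp (f := fun z : ℂ × ℂ => (ρ : ℂ) - z.2) this
          (by fun_prop)).continuousWithinAt
  have hR2 : ∀ z ∈ S, R z ^ 2 = -I * c * ω := fun z hz =>
    branch_sq hdet hc hρ hJ hz.1 hz.2.1 hz.2.2
  have hω0 : ω ≠ 0 := by rintro rfl; simp at hω
  obtain ⟨δ₀, hδ₀⟩ : ∃ δ₀ : ℂ, δ₀ ^ 2 = -I * c * ω :=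
    IsAlgClosed.exists_pow_nat_eq _ (by norm_num)
  have hδ0 : δ₀ ≠ 0 := by
    rintro rfl
    simp [hc, hω0] at hδ₀
  have hδn : ‖δ₀‖ = √|c| := by
    have := congrArg norm hδ₀
    rw [norm_pow, norm_mul, norm_mul, norm_neg, norm_I, one_mul, hω, mul_one, norm_real,
      Real.norm_eq_abs] at this
    rw [← this, Real.sqrt_sq (norm_nonneg _)]
  have key : ∀ δ : ℂ, (∀ z ∈ S, R z = δ) → ∀ τ σ : ℂ, 0 < τ.im → σ.im ≤ 0 → σ ≠ ρ →
      J τ * rt (τ - σ) =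
        δ * (rt (mob a b c d τ - mob a b c d σ) * (c * τ + d) ^ 2 * rt (ρ - σ)) := by
    intro δ h τ σ hτ hσ hσρ
    have hz : ((τ, σ) : ℂ × ℂ) ∈ S := ⟨hτ, hσ, hσρ⟩
    rw [← h _ hz, hR]
    simp only
    rw [div_mul_cancel₀ _ (hden _ hz)]
  -- A continuous function on a preconnected set with constant nonzero square is one of the two
  -- square roots throughout.
  rcases hSc.eq_or_eq_neg_of_sq_eq hRc (continuousOn_const (c := δ₀))
    (fun z hz => by simp only [Pi.pow_apply]; rw [hR2 z hz, hδ₀]) (fun _ => hδ0) with h | h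
  · exact ⟨δ₀, hδn, key δ₀ h⟩
  · exact ⟨-δ₀, by rwa [norm_neg], key (-δ₀) h⟩

/-! ### Scaling and boundary values of the square root on the real line -/

lemma ofReal_mul_cpow {r : ℝ} (hr : 0 ≤ r) (z s : ℂ) (hs : s ≠ 0) :
    ((r : ℂ) * z) ^ s = (r : ℂ) ^ s * z ^ s := by
  rcases hr.eq_or_lt with rfl | hr
  · simp [hs]
  rcases eq_or_ne z 0 with rfl | hz
  · simp [hs]
  have hr' : (r : ℂ) ≠ 0 := by exact_mod_cast hr.ne'
  rw [cpow_def_of_ne_zero (mul_ne_zero hr' hz), cpow_def_of_ne_zero hr', cpow_def_of_ne_zero hz,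
    log_ofReal_mul hr hz, ofReal_log hr.le, add_mul, Complex.exp_add]

lemma rt_ofReal_mul {r : ℝ} (hr : 0 ≤ r) (z : ℂ) : rt (r * z) = (r : ℂ) ^ (1 / 2 : ℂ) * rt z := by
  unfold rt
  rw [← ofReal_mul_cpow hr _ _ (by norm_num), mul_left_comm]

/-- The two values are e^(πi/4) and e^(-πi/4). Their ratio is i, the principal root of -1, which is
why `rt_ofReal` holds with the same constant on both half-lines. -/
lemma rt_neg_one : rt (-1) = I * rt 1 := by
  unfold rt
  have h1 : -I * 1 = cexp (-(Real.pi / 2 * I)) := by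
    rw [Complex.exp_neg, exp_pi_div_two_mul_I, inv_I, mul_one]
  have h2 : -I * -1 = cexp (Real.pi / 2 * I) := by
    rw [exp_pi_div_two_mul_I]; ring
  have hpi := Real.pi_pos
  rw [h1, h2, cpow_def_of_ne_zero (exp_ne_zero _), cpow_def_of_ne_zero (exp_ne_zero _), log_exp,
    log_exp]
  · have : cexp (Real.pi / 2 * I * (1 / 2)) =
        cexp (Real.pi / 2 * I) * cexp (-(Real.pi / 2 * I) * (1 / 2)) := by
      rw [← Complex.exp_add]; congr 1; ring
    rw [this, exp_pi_div_two_mul_I]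
  all_goals simp
  all_goals linarith

lemma cpow_half_neg_one : (-1 : ℂ) ^ (1 / 2 : ℂ) = I := by
  rw [cpow_def_of_ne_zero (by norm_num), log_neg_one, mul_one_div, mul_div_right_comm,
    exp_pi_div_two_mul_I]

/-- On the real line, `√(-iy)` is the principal square root of `y`, up to a constant. -/
lemma rt_ofReal (y : ℝ) : rt y = (y : ℂ) ^ (1 / 2 : ℂ) * rt 1 := by
  rcases le_total 0 y with hy | hy
  · simpa using rt_ofReal_mul hy 1
  · have h1 := rt_ofReal_mul (neg_nonneg.2 hy) (-1)
    have h2 := ofReal_mul_cpow (neg_nonneg.2 hy) (-1) (1 / 2) (by norm_num)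
    rw [rt_neg_one, ofReal_neg, neg_mul_neg, mul_one] at h1
    rw [cpow_half_neg_one, ofReal_neg, neg_mul_neg, mul_one] at h2
    rw [h1, h2]
    ring

lemma rt_neg_ofReal (y : ℝ) : rt (-y) = conj (rt y) := by
  unfold rt
  have h : (-I * y).arg ≠ Real.pi := by
    intro h
    rw [arg_eq_pi_iff] at h
    simp at h
  rw [show -I * -(y : ℂ) = conj (-I * y) by simp, conj_cpow _ _ h]
  simp only [map_div₀, map_one, map_ofNat]

/-! ### Unary theta functions of weight `3/2` -/

/-- The theta function `∑_n ψ(n) n e^{πi n² τ / N}`. -/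
noncomputable def theta (ψ : ℤ → ℂ) (N : ℕ) (τ : ℂ) : ℂ :=
  ∑' n : ℤ, ψ n * n * cexp (Real.pi * I * n ^ 2 * τ / N)

lemma rpow_le_two_mul_exp {x : ℝ} (hx : 0 < x) : x ^ (5 / 4 : ℝ) ≤ 2 * Real.exp x := by
  rcases le_total x 1 with h | h
  · have h1 : x ^ (5 / 4 : ℝ) ≤ 1 := Real.rpow_le_one hx.le h (by norm_num)
    linarith [Real.one_le_exp hx.le]
  · have h1 : x ^ (5 / 4 : ℝ) ≤ x ^ (2 : ℝ) := Real.rpow_le_rpow_of_exponent_le h (by norm_num)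
    rw [Real.rpow_two] at h1
    linarith [Real.quadratic_le_exp_of_nonneg hx.le]

lemma exp_neg_le_rpow {x : ℝ} (hx : 0 < x) : Real.exp (-x) ≤ 2 * x ^ (-(5 / 4) : ℝ) := by
  rw [Real.exp_neg, Real.rpow_neg hx.le, ← div_eq_mul_inv, inv_eq_one_div,
    div_le_div_iff₀ (Real.exp_pos x) (Real.rpow_pos_of_pos hx _), one_mul]
  exact rpow_le_two_mul_exp hx

lemma norm_cexp_theta (N : ℕ) (n : ℤ) (τ : ℂ) :
    ‖cexp (Real.pi * I * n ^ 2 * τ / N)‖ = Real.exp (-(Real.pi * n ^ 2 * τ.im / N)) := by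
  rw [norm_exp]
  congr 1
  have : (Real.pi * I * n ^ 2 * τ / N : ℂ) = ((Real.pi * n ^ 2 / N : ℝ) : ℂ) * (I * τ) := by
    push_cast; ring
  rw [this, re_ofReal_mul]
  simp
  ring

/-- Half of the Gaussian exponent supplies exp(-p Im τ), since n² ≥ 1 for nonzero n. The other half
is traded for (p n² Im τ)^(-5/4). Any exponent above 1 makes the sum over n converge, and any
exponent below 3/2 suffices for the limit in `IsCuspidal.tendsto_horocycle`; 5/4 lies between. -/
lemma norm_theta_term_le {ψ : ℤ → ℂ} {B : ℝ} (hB : ∀ n, ‖ψ n‖ ≤ B) {N : ℕ} (hN : 0 < N) :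
    ∃ C p : ℝ, 0 ≤ C ∧ 0 < p ∧ ∀ (τ : ℂ) (n : ℤ), 0 < τ.im →
      ‖ψ n * n * cexp (Real.pi * I * n ^ 2 * τ / N)‖ ≤
        C * τ.im ^ (-(5 / 4) : ℝ) * Real.exp (-p * τ.im) * |(n : ℝ)| ^ (-(3 / 2) : ℝ) := by
  have hB0 : 0 ≤ B := (norm_nonneg _).trans (hB 0)
  have hN' : (0 : ℝ) < N := by exact_mod_cast hN
  have hpi := Real.pi_pos
  set p : ℝ := Real.pi / (2 * N) with hp
  have hp0 : 0 < p := by positivity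
  refine ⟨B * (2 * p ^ (-(5 / 4) : ℝ)), p, by positivity, hp0, fun τ n hτ => ?_⟩
  rcases eq_or_ne n 0 with rfl | hn
  · simp
  have hn1 : (1 : ℝ) ≤ |(n : ℝ)| := by exact_mod_cast Int.one_le_abs hn
  have hn0 : 0 < |(n : ℝ)| := by linarith
  have hn2 : (1 : ℝ) ≤ (n : ℝ) ^ 2 := by rw [← sq_abs]; nlinarith
  rw [norm_mul, norm_mul, norm_cexp_theta, norm_intCast]
  have hy : -(Real.pi * n ^ 2 * τ.im / N) = -(p * τ.im * n ^ 2) + -(p * τ.im * n ^ 2) := by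
    rw [hp]; field_simp; ring
  have h1 : Real.exp (-(p * τ.im * n ^ 2)) ≤ Real.exp (-p * τ.im) := by
    apply Real.exp_le_exp.2
    have : 0 < p * τ.im := by positivity
    nlinarith
  have h2 := exp_neg_le_rpow (x := p * τ.im * (n : ℝ) ^ 2) (by positivity)
  have h3 : (p * τ.im * (n : ℝ) ^ 2) ^ (-(5 / 4) : ℝ) =
      p ^ (-(5 / 4) : ℝ) * τ.im ^ (-(5 / 4) : ℝ) * |(n : ℝ)| ^ (-(5 / 2) : ℝ) := by
    rw [Real.mul_rpow (by positivity) (by positivity), Real.mul_rpow hp0.le hτ.le, ← sq_abs,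
      ← Real.rpow_natCast, ← Real.rpow_mul hn0.le]
    norm_num
  have h4 : |(n : ℝ)| * |(n : ℝ)| ^ (-(5 / 2) : ℝ) = |(n : ℝ)| ^ (-(3 / 2) : ℝ) := by
    nth_rw 1 [← Real.rpow_one |(n : ℝ)|]
    rw [← Real.rpow_add hn0]; norm_num
  rw [hy, Real.exp_add]
  calc ‖ψ n‖ * |(n : ℝ)| * (Real.exp (-(p * τ.im * n ^ 2)) * Real.exp (-(p * τ.im * n ^ 2)))
      ≤ B * |(n : ℝ)| * (Real.exp (-p * τ.im) * (2 * (p * τ.im * (n : ℝ) ^ 2) ^ (-(5 / 4) : ℝ))) := by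
        gcongr
        exact hB n
    _ = B * (2 * p ^ (-(5 / 4) : ℝ)) * τ.im ^ (-(5 / 4) : ℝ) * Real.exp (-p * τ.im) *
        (|(n : ℝ)| * |(n : ℝ)| ^ (-(5 / 2) : ℝ)) := by rw [h3]; ring
    _ = _ := by rw [h4]

lemma summable_abs_rpow : Summable fun n : ℤ => |(n : ℝ)| ^ (-(3 / 2) : ℝ) :=
  Real.summable_abs_int_rpow (by norm_num)

lemma summable_theta {ψ : ℤ → ℂ} {B : ℝ} (hB : ∀ n, ‖ψ n‖ ≤ B) {N : ℕ} (hN : 0 < N) {τ : ℂ}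
    (hτ : 0 < τ.im) : Summable fun n : ℤ => ψ n * n * cexp (Real.pi * I * n ^ 2 * τ / N) := by
  obtain ⟨C, p, -, -, h⟩ := norm_theta_term_le hB hN
  exact (summable_abs_rpow.mul_left _).of_norm_bounded (h τ · hτ)

lemma norm_theta_le {ψ : ℤ → ℂ} {B : ℝ} (hB : ∀ n, ‖ψ n‖ ≤ B) {N : ℕ} (hN : 0 < N) :
    ∃ C p : ℝ, 0 ≤ C ∧ 0 < p ∧ ∀ τ : ℂ, 0 < τ.im →
      ‖theta ψ N τ‖ ≤ C * τ.im ^ (-(5 / 4) : ℝ) * Real.exp (-p * τ.im) := by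
  obtain ⟨C, p, hC, hp, h⟩ := norm_theta_term_le hB hN
  refine ⟨C * ∑' n : ℤ, |(n : ℝ)| ^ (-(3 / 2) : ℝ), p,
    mul_nonneg hC (tsum_nonneg fun n => by positivity), hp, fun τ hτ => ?_⟩
  refine (tsum_of_norm_bounded (summable_abs_rpow.hasSum.mul_left _) (h τ · hτ)).trans
    (le_of_eq ?_)
  ring

lemma differentiableAt_theta {ψ : ℤ → ℂ} {B : ℝ} (hB : ∀ n, ‖ψ n‖ ≤ B) {N : ℕ} (hN : 0 < N)
    {τ : ℂ} (hτ : 0 < τ.im) : DifferentiableAt ℂ (theta ψ N) τ := by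
  obtain ⟨C, p, hC, hp, h⟩ := norm_theta_term_le hB hN
  have hU : IsOpen {u : ℂ | τ.im / 2 < u.im} := isOpen_lt continuous_const continuous_im
  have := differentiableOn_tsum_of_summable_norm (U := {u : ℂ | τ.im / 2 < u.im})
    (F := fun (n : ℤ) (u : ℂ) => ψ n * n * cexp (Real.pi * I * n ^ 2 * u / N))
    (summable_abs_rpow.mul_left (C * (τ.im / 2) ^ (-(5 / 4) : ℝ) * 1))
    (fun n => by fun_prop) hU (fun n u hu => ?_)
  · exact this.differentiableAt (hU.mem_nhds (by show τ.im / 2 < τ.im; linarith))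
  · have hu : τ.im / 2 < u.im := hu
    have hu0 : 0 < u.im := by linarith
    refine (h u n hu0).trans ?_
    gcongr C * ?_ * ?_ * _
    · exact Real.rpow_le_rpow_of_nonpos (by positivity) hu.le (by norm_num)
    · rw [Real.exp_le_one_iff]; nlinarith

/-- The discrete Fourier transform of a sequence modulo `N`. -/
noncomputable def dft (ψ : ℤ → ℂ) (N : ℕ) (n : ℤ) : ℂ :=
  ∑ j ∈ Finset.range N, ψ j * cexp (-(2 * Real.pi * I * j * n / N))

lemma norm_dft_le (ψ : ℤ → ℂ) (N : ℕ) (n : ℤ) : ‖dft ψ N n‖ ≤ ∑ j ∈ Finset.range N, ‖ψ j‖ := by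
  refine (norm_sum_le _ _).trans (Finset.sum_le_sum fun j _ => ?_)
  rw [norm_mul]
  have : -(2 * Real.pi * I * j * n / N : ℂ) = ((-(2 * Real.pi * j * n / N) : ℝ) : ℂ) * I := by
    push_cast; ring
  rw [this, norm_exp_ofReal_mul_I, mul_one]

lemma periodic_add_mul {ψ : ℤ → ℂ} {N : ℕ} (hψ : ∀ n, ψ (n + N) = ψ n) (k j : ℤ) :
    ψ (k * N + j) = ψ j := by
  have : Function.Periodic ψ (N : ℤ) := hψ
  have := this.int_mul k j
  rwa [add_comm] at this

lemma norm_le_of_periodic {ψ : ℤ → ℂ} {N : ℕ} (hN : 0 < N) (hψ : ∀ n, ψ (n + N) = ψ n) (n : ℤ) :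
    ‖ψ n‖ ≤ ∑ j ∈ Finset.range N, ‖ψ j‖ := by
  have hN' : (0 : ℤ) < N := by exact_mod_cast hN
  have h1 := periodic_add_mul hψ (n / N) (n % N)
  rw [mul_comm, Int.mul_ediv_add_emod] at h1
  have h2 := Int.emod_nonneg n hN'.ne'
  have h3 := Int.emod_lt_of_pos n hN'
  obtain ⟨j, hj⟩ := Int.eq_ofNat_of_zero_le h2
  rw [h1, hj]
  exact Finset.single_le_sum (f := fun j : ℕ => ‖ψ j‖) (fun _ _ => norm_nonneg _)
    (Finset.mem_range.2 (by omega))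

/-- The theta series over a residue class and its image under the inversion. -/
lemma tsum_residue {N : ℕ} (hN : 0 < N) : ∃ K : ℂ, ∀ (j : ℕ) (τ : ℂ), 0 < τ.im →
    ∑' n : ℤ, (n * N + j : ℂ) * cexp (Real.pi * I * (n * N + j) ^ 2 * τ / N) =
      K / rt τ ^ 3 * ∑' n : ℤ, cexp (-(2 * Real.pi * I * j * n / N)) * n *
        cexp (Real.pi * I * n ^ 2 * (-1 / τ) / N) := by
  have hN0 : (N : ℂ) ≠ 0 := by exact_mod_cast hN.ne'
  have hpi : (Real.pi : ℂ) ≠ 0 := by exact_mod_cast Real.pi_ne_zero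
  -- The constant does not depend on j, which allows the residue classes to be recombined with
  -- arbitrary weights.
  refine ⟨I * (((N : ℝ)⁻¹ : ℝ) : ℂ) ^ (1 / 2 : ℂ), fun j τ hτ => ?_⟩
  have hτ0 : τ ≠ 0 := ne_zero_of_im_pos hτ
  have hr0 := rt_ne_zero hτ0
  have hrsq : τ = I * rt τ ^ 2 := by rw [rt_sq]; linear_combination τ * I_sq
  -- The z-derivative of the Jacobi theta function supplies the factor n. The arguments are chosen
  -- so that the transformed point is (jτ, Nτ), whose terms become those of the residue class j mod
  -- N after completing the square.
  have hfe := jacobiTheta₂'_functional_equation (-(j : ℂ) / N) (-1 / (N * τ))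
  have e1 : -(j : ℂ) / N / (-1 / (N * τ)) = j * τ := by field_simp
  have e2 : -1 / (-1 / (N * τ)) = N * τ := by field_simp
  rw [e1, e2] at hfe
  have hNτ : 0 < ((N : ℂ) * τ).im := by
    simp only [mul_im, natCast_re, natCast_im, zero_mul, add_zero]
    have : (0 : ℝ) < N := by exact_mod_cast hN
    positivity
  have hs1 := hasSum_jacobiTheta₂'_term (j * τ) hNτ
  have hs2 := hasSum_jacobiTheta₂_term (j * τ) hNτ
  have hs3 := (hs1.sub (hs2.mul_left (2 * Real.pi * I * (-(j : ℂ) / N)))).mul_left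
    (cexp (-Real.pi * I * (-(j : ℂ) / N) ^ 2 / (-1 / (N * τ))))
  have hL : HasSum (fun n : ℤ => 2 * Real.pi * I / N * ((n * N + j : ℂ) *
      cexp (Real.pi * I * (n * N + j) ^ 2 * τ / N)))
      (cexp (-Real.pi * I * (-(j : ℂ) / N) ^ 2 / (-1 / (N * τ))) *
        (jacobiTheta₂' (j * τ) (N * τ) -
          2 * Real.pi * I * (-(j : ℂ) / N) * jacobiTheta₂ (j * τ) (N * τ))) := by
    convert! hs3 using 2 with n
    -- Completing the square: the j² part is exactly the Gaussian prefactor of the functional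
    -- equation.
    have e5 : cexp (Real.pi * I * (n * N + j) ^ 2 * τ / N) =
        cexp (-Real.pi * I * (-(j : ℂ) / N) ^ 2 / (-1 / (N * τ))) *
          cexp (2 * Real.pi * I * n * (j * τ) + Real.pi * I * n ^ 2 * (N * τ)) := by
      rw [← Complex.exp_add]
      congr 1
      field_simp
      ring
    rw [jacobiTheta₂'_term, jacobiTheta₂_term, e5]
    field_simp
    ring
  have hR : jacobiTheta₂' (-(j : ℂ) / N) (-1 / (N * τ)) = 2 * Real.pi * I *
      ∑' n : ℤ, cexp (-(2 * Real.pi * I * j * n / N)) * n *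
        cexp (Real.pi * I * n ^ 2 * (-1 / τ) / N) := by
    rw [jacobiTheta₂', ← tsum_mul_left]
    refine tsum_congr fun n => ?_
    rw [jacobiTheta₂'_term, jacobiTheta₂_term, Complex.exp_add]
    have e3 : 2 * Real.pi * I * n * (-(j : ℂ) / N) = -(2 * Real.pi * I * j * n / N) := by ring
    have e4 : Real.pi * I * n ^ 2 * (-1 / (N * τ)) = Real.pi * I * n ^ 2 * (-1 / τ) / N := by
      field_simp
    rw [e3, e4]; ring
  have hA : (-I * (-1 / (N * τ))) ^ (1 / 2 : ℂ) =
      (((N : ℝ)⁻¹ : ℝ) : ℂ) ^ (1 / 2 : ℂ) / rt τ := by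
    have h1 : -I * (-1 / (N * τ)) = (((N : ℝ)⁻¹ : ℝ) : ℂ) * (-I * τ)⁻¹ := by
      push_cast
      rw [mul_inv, inv_neg, inv_I]
      field_simp
    have h2 : (-I * τ).arg ≠ Real.pi := by
      have := neg_I_mul_mem_slitPlane (Or.inl hτ)
      exact (mem_slitPlane_iff_arg.1 this).1
    rw [h1, ofReal_mul_cpow (by positivity) _ _ (by norm_num), inv_cpow _ _ h2, ← div_eq_mul_inv]
    rfl
  have hL' := hL.tsum_eq
  rw [tsum_mul_left] at hL'
  have hq : (((N : ℝ)⁻¹ : ℝ) : ℂ) ^ (1 / 2 : ℂ) ≠ 0 := by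
    rw [Ne, cpow_eq_zero_iff]
    simp [hN0]
  generalize (((N : ℝ)⁻¹ : ℝ) : ℂ) ^ (1 / 2 : ℂ) = q at *
  have aux : ∀ E B : ℂ, 1 / (q / rt τ) * E / (-1 / (N * τ)) * B =
      -(rt τ / q * (N * τ)) * (E * B) := by
    intro E B
    field_simp
  rw [hR, hA, aux, ← hL'] at hfe
  generalize (∑' n : ℤ, (n * N + j : ℂ) * cexp (Real.pi * I * (n * N + j) ^ 2 * τ / N)) = X at *
  generalize (∑' n : ℤ, cexp (-(2 * Real.pi * I * j * n / N)) * n *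
        cexp (Real.pi * I * n ^ 2 * (-1 / τ) / N)) = Y at *
  generalize rt τ = r at *
  have hY : Y = -(r * τ / q) * X := by
    have h2 : (2 * Real.pi * I : ℂ) ≠ 0 := two_pi_I_ne_zero
    refine mul_left_cancel₀ h2 (hfe.trans ?_)
    field_simp
  rw [hY, hrsq]
  field_simp
  linear_combination X * I_sq

/-- The inversion formula for theta functions. -/
theorem theta_inversion {ψ : ℤ → ℂ} {N : ℕ} (hN : 0 < N) (hψ : ∀ n, ψ (n + N) = ψ n) :
    ∃ K : ℂ, ∀ τ : ℂ, 0 < τ.im → theta ψ N τ = K / rt τ ^ 3 * theta (dft ψ N) N (-1 / τ) := by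
  obtain ⟨K, hK⟩ := tsum_residue hN
  refine ⟨K, fun τ hτ => ?_⟩
  have : NeZero N := ⟨hN.ne'⟩
  have hτ' : 0 < (-1 / τ).im := by
    rw [div_im]
    simp only [neg_im, one_im, neg_zero, zero_mul, zero_div, neg_re, one_re, zero_sub]
    have := normSq_pos.2 (ne_zero_of_im_pos hτ)
    rw [neg_one_mul, neg_div, neg_neg]
    positivity
  have hsum := summable_theta (norm_le_of_periodic hN hψ) hN hτ
  have hL : theta ψ N τ = ∑ j ∈ Finset.range N, ψ j *
      ∑' n : ℤ, (n * N + j : ℂ) * cexp (Real.pi * I * (n * N + j) ^ 2 * τ / N) := by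
    -- Splitting the sum into residue classes mod N makes ψ constant on each inner sum. After
    -- inversion the finite sum over j reassembles into the Fourier transform.
    let e : Fin N × ℤ ≃ ℤ := (Equiv.prodComm _ _).trans (Int.divModEquiv N).symm
    have he : ∀ x : Fin N × ℤ, e x = x.2 * N + ((x.1 : ℕ) : ℤ) := fun x => rfl
    have h1 := e.summable_iff.2 hsum
    have h2 : theta ψ N τ = _ := (e.tsum_eq _).symm
    have h3 := h1.tsum_prod
    simp only [Function.comp_apply] at h3
    rw [h2, h3, tsum_fintype, Finset.sum_range]
    refine Finset.sum_congr rfl fun j _ => ?_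
    rw [← tsum_mul_left]
    refine tsum_congr fun n => ?_
    simp only [he, periodic_add_mul hψ]
    push_cast
    ring
  have hR : theta (dft ψ N) N (-1 / τ) = ∑ j ∈ Finset.range N, ψ j *
      ∑' n : ℤ, cexp (-(2 * Real.pi * I * j * n / N)) * n *
        cexp (Real.pi * I * n ^ 2 * (-1 / τ) / N) := by
    have h1 : ∀ j : ℕ, Summable fun n : ℤ => cexp (-(2 * Real.pi * I * j * n / N)) * n *
        cexp (Real.pi * I * n ^ 2 * (-1 / τ) / N) := fun j =>
      summable_theta (ψ := fun n => cexp (-(2 * Real.pi * I * j * n / N))) (B := 1)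
        (fun n => by
          have : -(2 * Real.pi * I * j * n / N : ℂ) =
              ((-(2 * Real.pi * j * n / N) : ℝ) : ℂ) * I := by push_cast; ring
          rw [this, norm_exp_ofReal_mul_I]) hN hτ'
    simp_rw [← tsum_mul_left]
    rw [← Summable.tsum_finsetSum fun j _ => (h1 j).mul_left _]
    refine tsum_congr fun n => ?_
    rw [dft, Finset.sum_mul, Finset.sum_mul]
    exact Finset.sum_congr rfl fun j _ => by ring
  rw [hL, hR, Finset.mul_sum]
  refine Finset.sum_congr rfl fun j _ => ?_
  rw [hK j τ hτ]
  ring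

/-! ### Transformation and boundedness of theta functions -/

lemma im_neg_one_div_pos {τ : ℂ} (hτ : 0 < τ.im) : 0 < (-1 / τ).im := by
  rw [neg_div, one_div, neg_im, inv_im, neg_div, neg_neg]
  exact div_pos hτ (normSq_pos.2 (ne_zero_of_im_pos hτ))

lemma theta_add {ψ : ℤ → ℂ} {N : ℕ} {s ω : ℂ}
    (h : ∀ n : ℤ, ψ n ≠ 0 → cexp (Real.pi * I * n ^ 2 * s / N) = ω) (τ : ℂ) :
    theta ψ N (τ + s) = ω * theta ψ N τ := by
  rw [theta, theta, ← tsum_mul_left]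
  refine tsum_congr fun n => ?_
  rcases eq_or_ne (ψ n) 0 with h0 | h0
  · simp [h0]
  · rw [← h n h0, mul_add, add_div, Complex.exp_add]; ring

/-- The behaviour of a theta function under `τ ↦ τ / (1 - sτ)`. -/
theorem theta_lower {ψ : ℤ → ℂ} {N : ℕ} (hN : 0 < N) (hψ : ∀ n, ψ (n + N) = ψ n) {s : ℝ} {ω : ℂ}
    (h : ∀ n : ℤ, dft ψ N n ≠ 0 → cexp (Real.pi * I * n ^ 2 * s / N) = ω) {τ : ℂ}
    (hτ : 0 < τ.im) :
    theta ψ N (mob 1 0 (-s) 1 τ) =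
      ω * rt τ ^ 3 / rt (mob 1 0 (-s) 1 τ) ^ 3 * theta ψ N τ := by
  obtain ⟨K, hK⟩ := theta_inversion hN hψ
  have hdet : (1 : ℝ) * 1 - 0 * (-s) = 1 := by ring
  have hm := mob_im_pos hdet hτ
  -- Conjugation by the inversion turns the lower unipotent map into translation by s.
  have h1 : -1 / mob 1 0 (-s) 1 τ = -1 / τ + s := by
    have hd := mob_den_ne_zero hdet hτ
    have h0 := ne_zero_of_im_pos hτ
    rw [mob]
    push_cast at hd ⊢
    rw [one_mul, add_zero]
    field_simp
    ring
  rw [hK _ hm, hK _ hτ, h1, theta_add h]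
  have := rt_ne_zero (ne_zero_of_im_pos hτ)
  field_simp

/-- For t ≤ 1 the inversion costs t^(-3/2), while the transformed series at height 1/t contributes
t^(5/4) from growth and another t^(5/4) from exponential decay, leaving a bound proportional to t.
-/
lemma theta_vertical_bounded {ψ : ℤ → ℂ} {N : ℕ} (hN : 0 < N) (hψ : ∀ n, ψ (n + N) = ψ n) :
    ∃ C : ℝ, ∀ t : ℝ, 0 < t → ‖theta ψ N (I * t)‖ ≤ C := by
  obtain ⟨K, hK⟩ := theta_inversion hN hψ
  obtain ⟨C₁, p₁, hC₁, hp₁, h₁⟩ := norm_theta_le (norm_le_of_periodic hN hψ) hN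
  obtain ⟨C₂, p₂, hC₂, hp₂, h₂⟩ := norm_theta_le (norm_dft_le ψ N) hN
  refine ⟨max C₁ (‖K‖ * C₂ * (2 * p₂ ^ (-(5 / 4) : ℝ))), fun t ht => ?_⟩
  have him : (I * (t : ℂ)).im = t := by simp
  have hpos : 0 < (I * (t : ℂ)).im := by rwa [him]
  rcases le_total 1 t with h | h
  · refine le_max_of_le_left ((h₁ _ hpos).trans ?_)
    rw [him, mul_assoc]
    refine mul_le_of_le_one_right hC₁ (mul_le_one₀
      (Real.rpow_le_one_of_one_le_of_nonpos h (by norm_num)) (Real.exp_nonneg _) ?_)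
    rw [Real.exp_le_one_iff]; nlinarith
  · refine le_max_of_le_right ?_
    have him2 : (-1 / (I * (t : ℂ))).im = t⁻¹ := by
      have : -1 / (I * (t : ℂ)) = I * ((t⁻¹ : ℝ) : ℂ) := by
        push_cast
        rw [neg_div, one_div, mul_inv, inv_I]; ring
      rw [this]; simp
    have hn : ‖rt (I * t)‖ = t ^ (1 / 2 : ℝ) := by
      rw [norm_rt, norm_mul, norm_I, one_mul, norm_real, Real.norm_of_nonneg ht.le,
        Real.sqrt_eq_rpow]
    have h3 := h₂ _ (im_neg_one_div_pos hpos)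
    rw [him2] at h3
    rw [hK _ hpos, norm_mul, norm_div, norm_pow, hn]
    have h4 := exp_neg_le_rpow (x := p₂ * t⁻¹) (by positivity)
    rw [Real.mul_rpow hp₂.le (by positivity)] at h4
    have h5 : (t⁻¹) ^ (-(5 / 4) : ℝ) = t ^ (5 / 4 : ℝ) := by
      rw [Real.inv_rpow ht.le, ← Real.rpow_neg ht.le, neg_neg]
    rw [h5] at h3 h4
    have h6 : (t ^ (1 / 2 : ℝ)) ^ 3 = t ^ (3 / 2 : ℝ) := by
      rw [← Real.rpow_natCast, ← Real.rpow_mul ht.le]; norm_num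
    have h7 : t ^ (5 / 4 : ℝ) * t ^ (5 / 4 : ℝ) = t * t ^ (3 / 2 : ℝ) := by
      nth_rw 3 [← Real.rpow_one t]
      rw [← Real.rpow_add ht, ← Real.rpow_add ht]; norm_num
    have h8 : 0 < t ^ (3 / 2 : ℝ) := by positivity
    rw [h6]
    calc ‖K‖ / t ^ (3 / 2 : ℝ) * ‖theta (dft ψ N) N (-1 / (I * t))‖
        ≤ ‖K‖ / t ^ (3 / 2 : ℝ) * (C₂ * t ^ (5 / 4 : ℝ) *
            (2 * (p₂ ^ (-(5 / 4) : ℝ) * t ^ (5 / 4 : ℝ)))) := by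
          gcongr
          refine h3.trans ?_
          gcongr
          rwa [neg_mul]
      _ = ‖K‖ * C₂ * (2 * p₂ ^ (-(5 / 4) : ℝ)) *
            (t ^ (5 / 4 : ℝ) * t ^ (5 / 4 : ℝ) / t ^ (3 / 2 : ℝ)) := by ring
      _ = ‖K‖ * C₂ * (2 * p₂ ^ (-(5 / 4) : ℝ)) * t := by
          rw [h7, mul_div_assoc, div_self h8.ne', mul_one]
      _ ≤ _ := mul_le_of_le_one_right (by positivity) h

lemma cexp_mul_two_pi_I_int {x y : ℂ} (k : ℤ) (h : x = y + k * (2 * Real.pi * I)) :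
    cexp x = cexp y := by
  rw [h, Complex.exp_add, exp_int_mul_two_pi_mul_I, mul_one]

/-- Moving to another rational multiplies the coefficients by a periodic phase. The bound over 0
then applies to the new coefficients, whose period is 2N times the denominator. -/
lemma theta_vertical_bounded_rat {ψ : ℤ → ℂ} {N : ℕ} (hN : 0 < N) (hψ : ∀ n, ψ (n + N) = ψ n)
    (r : ℚ) : ∃ C : ℝ, ∀ t : ℝ, 0 < t → ‖theta ψ N (r + I * t)‖ ≤ C := by
  set L : ℕ := N * (2 * r.den) with hL
  have hr : 0 < r.den := r.den_pos
  have hL0 : 0 < L := by positivity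
  have hNC : (N : ℂ) ≠ 0 := by exact_mod_cast hN.ne'
  have hden : (r.den : ℂ) ≠ 0 := by exact_mod_cast hr.ne'
  have hrr : (r : ℂ) = r.num / r.den := by exact_mod_cast (Rat.num_div_den r).symm
  set φ : ℤ → ℂ := fun n => ψ n * cexp (Real.pi * I * n ^ 2 * r / N) with hφ
  have hper : ∀ n, φ (n + L) = φ n := by
    intro n
    have h1 : ψ (n + L) = ψ n := by
      have := periodic_add_mul hψ (2 * r.den) n
      rw [add_comm, hL]; push_cast
      rw [mul_comm]; exact this
    simp only [hφ, h1]
    congr 1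
    refine cexp_mul_two_pi_I_int (2 * n * r.num + 2 * N * r.den * r.num) ?_
    rw [hL, hrr]
    push_cast
    field_simp
    ring
  obtain ⟨C, hC⟩ := theta_vertical_bounded hL0 hper
  refine ⟨C, fun t ht => ?_⟩
  have : theta ψ N (r + I * t) = theta φ L (I * ((t * (2 * r.den) : ℝ) : ℂ)) := by
    refine tsum_congr fun n => ?_
    simp only [hφ]
    rw [mul_add, add_div, Complex.exp_add]
    have : Real.pi * I * n ^ 2 * (I * ((t * (2 * r.den) : ℝ) : ℂ)) / (L : ℂ) =
        Real.pi * I * n ^ 2 * (I * t) / N := by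
      rw [hL]; push_cast; field_simp
    rw [this]; ring
  rw [this]
  exact hC _ (by positivity)

lemma isCuspidal_theta {ψ : ℤ → ℂ} {N : ℕ} (hN : 0 < N) (hψ : ∀ n, ψ (n + N) = ψ n)
    (κ : ℂ) {q : ℚ} (hq : 0 < q) : IsCuspidal fun u => κ * theta ψ N (q * u) := by
  have him : ∀ u : ℂ, ((q : ℂ) * u).im = q * u.im := fun u => by
    simp
  have hq' : (0 : ℝ) < q := by exact_mod_cast hq
  have hB := norm_le_of_periodic hN hψ
  refine ⟨fun u hu => ?_, ?_, fun ρ => ?_⟩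
  · refine DifferentiableAt.const_mul ?_ _
    exact DifferentiableAt.comp u (g := theta ψ N) (f := fun u => (q : ℂ) * u)
      (differentiableAt_theta hB hN (by rw [him]; positivity)) (by fun_prop)
  · obtain ⟨C, p, hC, hp, h⟩ := norm_theta_le hB hN
    refine ⟨‖κ‖ * (C * (q : ℝ) ^ (-(5 / 4) : ℝ)), p * q, by positivity, by positivity,
      fun u hu => ?_⟩
    have := h (q * u) (by rw [him]; positivity)
    rw [him, Real.mul_rpow hq'.le hu.le] at this
    rw [norm_mul]
    calc _ ≤ _ := mul_le_mul_of_nonneg_left this (norm_nonneg κ)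
      _ = _ := by ring_nf
  · obtain ⟨C, hC⟩ := theta_vertical_bounded_rat hN hψ (q * ρ)
    refine ⟨‖κ‖ * C, fun t ht => ?_⟩
    have := hC (q * t) (by positivity)
    rw [norm_mul]
    gcongr
    convert! this using 3
    push_cast
    ring

/-! ### The characters -/

/-- The odd periodic extension of `χ_m` to the integers. -/
def chiZ (m : ℕ) (n : ℤ) : ℤ :=
  match m with
  | 1 => if n % 4 = 1 then 1 else if n % 4 = 3 then -1 else 0
  | 2 => if n % 8 = 1 ∨ n % 8 = 3 then 1 else if n % 8 = 5 ∨ n % 8 = 7 then -1 else 0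
  | 3 => if n % 3 = 1 then 1 else if n % 3 = 2 then -1 else 0
  | 4 => if n % 24 = 1 ∨ n % 24 = 5 ∨ n % 24 = 7 ∨ n % 24 = 11 then 1
      else if n % 24 = 13 ∨ n % 24 = 17 ∨ n % 24 = 19 ∨ n % 24 = 23 then -1 else 0
  | 5 => if n % 6 = 1 then 1 else if n % 6 = 5 then -1 else 0
  | 6 => if n % 6 = 1 ∨ n % 6 = 2 then 1 else if n % 6 = 4 ∨ n % 6 = 5 then -1 else 0
  | _ => 0

lemma chiZ_neg (m : ℕ) (n : ℤ) : chiZ m (-n) = -chiZ m n := by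
  unfold chiZ
  split <;> (try split_ifs) <;> omega

lemma chiZ_abs_le (m : ℕ) (n : ℤ) : |chiZ m n| ≤ 1 := by
  unfold chiZ
  split <;> (try split_ifs) <;> simp

/-- For odd m the number c_m is twice a period of the extension; for even m it is twice an
antiperiod. This uniform sign rule determines the parity of the Fourier support. -/
lemma chiZ_add_half {m : ℕ} (hm : m ∈ T) (n : ℤ) :
    chiZ m (n + (c m / 2 : ℕ)) = (-1) ^ (m + 1) * chiZ m n := by
  simp only [T, mem_insert_iff, mem_singleton_iff] at hm
  rcases hm with rfl | rfl | rfl | rfl | rfl | rfl <;> simp [chiZ, c, a] <;> split_ifs <;> omega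

lemma two_mul_half_c {m : ℕ} (hm : m ∈ T) : 2 * (c m / 2) = c m := by
  simp only [T, mem_insert_iff, mem_singleton_iff] at hm
  rcases hm with rfl | rfl | rfl | rfl | rfl | rfl <;> rfl

lemma c_pos {m : ℕ} (hm : m ∈ T) : 0 < c m := by
  simp only [T, mem_insert_iff, mem_singleton_iff] at hm
  rcases hm with rfl | rfl | rfl | rfl | rfl | rfl <;> simp [c, a]

lemma jacobiSym_even_right {x : ℤ} (hx : Even x) {n : ℕ} (hn : 0 < n) (h : Even n) :
    jacobiSym x n = 0 := by
  rw [jacobiSym.eq_zero_iff]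
  refine ⟨hn.ne', fun hg => ?_⟩
  have h2 : (2 : ℤ) ∣ x.gcd n := Int.dvd_coe_gcd hx.two_dvd (by exact_mod_cast h.two_dvd)
  rw [hg] at h2
  norm_num at h2

/-- Since 12 = 3·2², the symbol at 2 enters squared and only detects parity. -/
lemma jacobiSym_twelve (x : ℤ) :
    jacobiSym x 12 = jacobiSym x 3 * if x % 2 = 0 then 0 else 1 := by
  have h : jacobiSym x 12 = jacobiSym x 3 * jacobiSym x 2 ^ 2 := by
    rw [show (12 : ℕ) = 3 * 2 ^ 2 from rfl, jacobiSym.mul_right, jacobiSym.pow_right]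
  rw [h]
  congr 1
  split_ifs with h2
  · rw [(jacobiSym.eq_zero_iff (a := x) (b := 2)).2 ⟨two_ne_zero, fun hg => ?_⟩]
    · rfl
    · have : (2 : ℤ) ∣ x.gcd (2 : ℕ) := Int.dvd_coe_gcd (Int.dvd_of_emod_eq_zero h2) (by norm_num)
      rw [hg] at this
      norm_num at this
  · refine jacobiSym.sq_one ?_
    have : IsCoprime x 2 := ⟨1, -(x / 2), by omega⟩
    exact_mod_cast Int.isCoprime_iff_gcd_eq_one.1 this

lemma chi_eq_chiZ {m : ℕ} (hm : m ∈ T) {n : ℕ} (hn : 0 < n) : chi m n = chiZ m n := by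
  have odd_case : ∀ (x : ℤ) (M : ℕ), 4 * x.natAbs = M → Odd n →
      jacobiSym x n = jacobiSym x (n % M : ℕ) := by
    rintro x M rfl ho
    exact jacobiSym.mod_right x ho
  have left_case : ∀ M : ℕ, jacobiSym n M = jacobiSym (n % M : ℕ) M := by
    intro M
    rw [jacobiSym.mod_left]; norm_cast
  simp only [T, mem_insert_iff, mem_singleton_iff] at hm
  rcases hm with rfl | rfl | rfl | rfl | rfl | rfl
  · rcases Nat.even_or_odd n with he | ho
    · simp only [chi, jacobiSym_even_right (by decide : Even (-4 : ℤ)) hn he, chiZ]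
      rw [Nat.even_iff] at he
      split_ifs <;> omega
    · simp only [chi, odd_case (-4) 16 rfl ho, chiZ]
      have h1 := Nat.odd_iff.1 ho
      have : n % 16 < 16 := Nat.mod_lt _ (by norm_num)
      have h2 : (n : ℤ) % 4 = ((n % 16 : ℕ) : ℤ) % 4 := by omega
      have h3 : (n % 16) % 2 = 1 := by omega
      rw [h2]
      interval_cases n % 16 <;> simp at h3 ⊢ <;> norm_num
  · rcases Nat.even_or_odd n with he | ho
    · simp only [chi, jacobiSym_even_right (by decide : Even (-2 : ℤ)) hn he, chiZ]
      rw [Nat.even_iff] at he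
      split_ifs <;> omega
    · simp only [chi, odd_case (-2) 8 rfl ho, chiZ]
      have h1 := Nat.odd_iff.1 ho
      have : n % 8 < 8 := Nat.mod_lt _ (by norm_num)
      have h2 : (n : ℤ) % 8 = ((n % 8 : ℕ) : ℤ) := by omega
      have h3 : (n % 8) % 2 = 1 := by omega
      rw [h2]
      interval_cases n % 8 <;> simp at h3 ⊢ <;> norm_num
  · simp only [chi, left_case 3, chiZ]
    have : n % 3 < 3 := Nat.mod_lt _ (by norm_num)
    have h2 : (n : ℤ) % 3 = ((n % 3 : ℕ) : ℤ) := by omega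
    rw [h2]
    interval_cases n % 3 <;> norm_num
  · rcases Nat.even_or_odd n with he | ho
    · simp only [chi, jacobiSym_even_right (by decide : Even (-6 : ℤ)) hn he, chiZ]
      rw [Nat.even_iff] at he
      split_ifs <;> omega
    · simp only [chi, odd_case (-6) 24 rfl ho, chiZ]
      have h1 := Nat.odd_iff.1 ho
      have : n % 24 < 24 := Nat.mod_lt _ (by norm_num)
      have h2 : (n : ℤ) % 24 = ((n % 24 : ℕ) : ℤ) := by omega
      have h3 : (n % 24) % 2 = 1 := by omega
      rw [h2]
      interval_cases n % 24 <;> simp at h3 ⊢ <;> norm_num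
  · simp only [chi, left_case 12, jacobiSym_twelve, chiZ]
    have : n % 12 < 12 := Nat.mod_lt _ (by norm_num)
    have h2 : (n : ℤ) % 6 = ((n % 12 : ℕ) : ℤ) % 6 := by omega
    rw [h2]
    interval_cases n % 12 <;> norm_num
  · have h3 : jacobiSym n 3 = jacobiSym (n % 12 : ℕ) 3 := by
      rw [left_case 3, ← Nat.mod_mod_of_dvd n (by norm_num : 3 ∣ 12), ← jacobiSym.mod_left']
      omega
    simp only [chi, left_case 12, jacobiSym_twelve, h3, chiZ]
    have : n % 12 < 12 := Nat.mod_lt _ (by norm_num)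
    have h2 : (n : ℤ) % 6 = ((n % 12 : ℕ) : ℤ) % 6 := by omega
    rw [h2]
    interval_cases n % 12 <;> norm_num

/-! ### The functions `E_m(2u/c_m²)` -/

/-- The function `E_m(2u/c_m²)`. -/
noncomputable def scaledE (m : ℕ) (u : ℂ) : ℂ := E m (2 * u / (c m : ℂ) ^ 2)

lemma chiZ_add_c {m : ℕ} (hm : m ∈ T) (n : ℤ) : (chiZ m (n + c m) : ℂ) = chiZ m n := by
  have h : (c m : ℤ) = (c m / 2 : ℕ) + (c m / 2 : ℕ) := by
    have := two_mul_half_c hm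
    omega
  rw [h, ← add_assoc, chiZ_add_half hm, chiZ_add_half hm, ← mul_assoc, ← pow_add,
    Even.neg_one_pow ⟨_, rfl⟩, one_mul]

lemma scaledE_eq_theta {m : ℕ} (hm : m ∈ T) {u : ℂ} (hu : 0 < u.im) :
    scaledE m u = 1 / 2 * theta (fun n => chiZ m n) (c m) (((4 / c m : ℚ) : ℂ) * u) := by
  have hc : (0 : ℝ) < c m := by exact_mod_cast c_pos hm
  have hc' : (c m : ℂ) ≠ 0 := by exact_mod_cast (c_pos hm).ne'
  have him : 0 < (((4 / c m : ℚ) : ℂ) * u).im := by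
    have : (((4 / c m : ℚ) : ℂ) * u).im = 4 / c m * u.im := by
      have := im_ofReal_mul (4 / c m : ℝ) u
      push_cast at this ⊢
      exact this
    rw [this]; positivity
  have hs := summable_theta (ψ := fun n => (chiZ m n : ℂ))
    (norm_le_of_periodic (c_pos hm) (chiZ_add_c hm)) (c_pos hm) him
  rw [theta, tsum_int_eq_zero_add_two_mul_tsum_pnat (fun n => by simp [chiZ_neg]) hs]
  simp only [Int.cast_zero, mul_zero, zero_mul, zero_add]
  rw [scaledE, E, nsmul_eq_mul, Nat.cast_ofNat, ← mul_assoc, one_div, inv_mul_cancel₀ two_ne_zero,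
    one_mul]
  refine tsum_congr fun n => ?_
  rw [← chi_eq_chiZ hm n.pos]
  push_cast
  congr 2
  field_simp
  ring

lemma IsCuspidal.congr {f g : ℂ → ℂ} (hf : IsCuspidal f) (h : ∀ u : ℂ, 0 < u.im → g u = f u) :
    IsCuspidal g := by
  refine ⟨fun u hu => (hf.differentiableAt u hu).congr_of_eventuallyEq ?_, ?_, fun ρ => ?_⟩
  · filter_upwards [(isOpen_lt continuous_const continuous_im).mem_nhds hu] with v hv using h v hv
  · obtain ⟨C, p, hC, hp, hb⟩ := hf.growth
    exact ⟨C, p, hC, hp, fun u hu => by rw [h u hu]; exact hb u hu⟩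
  · obtain ⟨C, hC⟩ := hf.bounded ρ
    exact ⟨C, fun t ht => by rw [h _ (by simpa using ht)]; exact hC t ht⟩

lemma isCuspidal_scaledE {m : ℕ} (hm : m ∈ T) : IsCuspidal (scaledE m) := by
  have hc : (0 : ℚ) < c m := by exact_mod_cast c_pos hm
  exact (isCuspidal_theta (c_pos hm) (chiZ_add_c hm) (1 / 2) (q := 4 / c m)
    (by positivity)).congr fun u hu => scaledE_eq_theta hm hu

/-- The multiplier of `E_m(2u/c_m²)` for `u ↦ u / (1 - ku)`. -/
noncomputable def lowerMult (m k : ℕ) : ℂ := if Even m then zeta 8 ^ k else 1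

/-- Pairing j with j + c_m/2 multiplies the summand by (-1)^(m+1+n), so paired terms cancel. -/
lemma dft_eq_zero {m : ℕ} (hm : m ∈ T) {n : ℤ} (hn : Odd (m + 1 + n)) :
    dft (fun n => (chiZ m n : ℂ)) (c m) n = 0 := by
  set h := c m / 2 with hh
  have hc : c m = h + h := by have := two_mul_half_c hm; omega
  have hh0 : (h : ℂ) ≠ 0 := by
    have := c_pos hm
    have : h ≠ 0 := by omega
    exact_mod_cast this
  rw [dft, show Finset.range (c m) = Finset.range (h + h) by rw [← hc], Finset.sum_range_add, ← Finset.sum_add_distrib]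
  refine Finset.sum_eq_zero fun j _ => ?_
  have h1 : (chiZ m ((h + j : ℕ) : ℤ) : ℂ) = (-1) ^ (m + 1) * chiZ m j := by
    have := chiZ_add_half hm j
    rw [← hh] at this
    push_cast
    rw [add_comm (h : ℤ), this]
    push_cast; ring
  have h2 : cexp (-(2 * Real.pi * I * ((h + j : ℕ) : ℂ) * n / c m)) =
      (-1) ^ n * cexp (-(2 * Real.pi * I * j * n / c m)) := by
    have : (-1 : ℂ) ^ n = cexp (-(Real.pi * I * n)) := by
      rw [← exp_neg_pi_mul_I, ← Complex.exp_int_mul]; ring_nf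
    rw [this, ← Complex.exp_add, hc]
    congr 1
    push_cast
    field_simp
    ring
  have h3 : (-1 : ℂ) ^ (m + 1) * (-1) ^ n = -1 := by
    rw [← zpow_natCast, ← zpow_add₀ (by norm_num)]
    push_cast
    exact hn.neg_one_zpow
  rw [h1, h2]
  linear_combination (chiZ m j * cexp (-(2 * Real.pi * I * j * n / c m))) * h3

/-- The exponential is e(n²k/8). For even m only odd n occur, where n² ≡ 1 mod 8; for odd m both n
and k are even and the phase is trivial. -/
lemma dft_multiplier {m k : ℕ} (hm : m ∈ T) (hk : Even m ∨ Even k) {n : ℤ}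
    (hn : dft (fun n => (chiZ m n : ℂ)) (c m) n ≠ 0) :
    cexp (Real.pi * I * n ^ 2 * ((k * c m / 4 : ℝ) : ℂ) / c m) = lowerMult m k := by
  have hpar : Even (m + 1 + n) := by
    rw [← Int.not_odd_iff_even]
    exact fun h => hn (dft_eq_zero hm h)
  have hc' : (c m : ℂ) ≠ 0 := by exact_mod_cast (c_pos hm).ne'
  rw [lowerMult]
  split_ifs with he
  · have hno : Odd n := by
      have : Even (m : ℤ) := by exact_mod_cast he
      rw [Int.even_add, Int.even_add] at hpar
      simp [this] at hpar
      exact hpar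
    obtain ⟨q, hq⟩ := Int.eight_dvd_sq_sub_one_of_odd hno
    have hq' : (n : ℂ) ^ 2 = 8 * q + 1 := by
      have : n ^ 2 = 8 * q + 1 := by omega
      exact_mod_cast this
    rw [zeta, ← Complex.exp_nat_mul]
    refine cexp_mul_two_pi_I_int (q * k) ?_
    rw [hq']
    push_cast
    field_simp
    ring
  · have hk' : Even k := by tauto
    obtain ⟨k', rfl⟩ := hk'
    have hne : Even n := by
      have : ¬ Even (m : ℤ) := by exact_mod_cast he
      rw [Int.even_add, Int.even_add] at hpar
      simp [this] at hpar
      exact hpar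
    obtain ⟨q, rfl⟩ := hne
    rw [← Complex.exp_zero]
    refine cexp_mul_two_pi_I_int (q ^ 2 * k') ?_
    push_cast
    field_simp
    ring

/-- The behaviour of `E_m(2u/c_m²)` under `u ↦ u / (1 - ku)`. -/
theorem scaledE_lower {m k : ℕ} (hm : m ∈ T) (hk : Even m ∨ Even k) {u : ℂ} (hu : 0 < u.im) :
    scaledE m (mob 1 0 (-k) 1 u) =
      lowerMult m k * rt u ^ 3 / rt (mob 1 0 (-k) 1 u) ^ 3 * scaledE m u := by
  have hdet : (1 : ℝ) * 1 - 0 * (-k) = 1 := by ring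
  have hcq : (0 : ℝ) < 4 / c m := by
    have : (0 : ℝ) < c m := by exact_mod_cast c_pos hm
    positivity
  have hc' : (c m : ℂ) ≠ 0 := by exact_mod_cast (c_pos hm).ne'
  have hq : ((4 / c m : ℚ) : ℂ) = ((4 / c m : ℝ) : ℂ) := by push_cast; rfl
  have hm' := mob_im_pos hdet hu
  have him : 0 < (((4 / c m : ℝ) : ℂ) * u).im := by rw [im_ofReal_mul]; positivity
  have hmob : ((4 / c m : ℝ) : ℂ) * mob 1 0 (-k) 1 u =
      mob 1 0 (-(k * c m / 4 : ℝ)) 1 (((4 / c m : ℝ) : ℂ) * u) := by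
    rw [mob, mob]
    push_cast
    have : (-(k * c m / 4) * (4 / c m * u) + 1 : ℂ) = -k * u + 1 := by field_simp
    rw [this]
    ring
  have h := theta_lower (c_pos hm) (chiZ_add_c hm) (fun n hn => dft_multiplier hm hk hn) him
  rw [← hmob, rt_ofReal_mul hcq.le, rt_ofReal_mul hcq.le] at h
  rw [scaledE_eq_theta hm hm', scaledE_eq_theta hm hu, hq, h]
  have hx : (((4 / c m : ℝ) : ℂ)) ^ (1 / 2 : ℂ) ≠ 0 := by
    rw [Ne, cpow_eq_zero_iff]
    have : ((4 / c m : ℝ) : ℂ) ≠ 0 := by exact_mod_cast hcq.ne'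
    tauto
  have hr := rt_ne_zero (ne_zero_of_im_pos hm')
  generalize ((4 / c m : ℝ) : ℂ) ^ (1 / 2 : ℂ) = y at *
  field_simp

/-! ### Translation by multiples of b_m -/

lemma two_mul_b_mul_a {m : ℕ} (hm : m ∈ T) : 2 * b m * a m = c m ^ 2 := by
  simp only [T, mem_insert_iff, mem_singleton_iff] at hm
  rcases hm with rfl | rfl | rfl | rfl | rfl | rfl <;> rfl

lemma a_dvd_sq_sub_one {m : ℕ} (hm : m ∈ T) {n : ℤ} (hn : chiZ m n ≠ 0) :
    (a m : ℤ) ∣ n ^ 2 - 1 := by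
  have key : ∀ M r : ℤ, n % M = r → (r * r - 1) % M = 0 → M ∣ n ^ 2 - 1 := by
    rintro M r rfl h
    apply Int.dvd_of_emod_eq_zero
    rw [← h, pow_two, Int.sub_emod, Int.mul_emod, ← Int.sub_emod]
  simp only [T, mem_insert_iff, mem_singleton_iff] at hm
  rcases hm with rfl | rfl | rfl | rfl | rfl | rfl
  · have : n % 8 = 1 ∨ n % 8 = 3 ∨ n % 8 = 5 ∨ n % 8 = 7 := by
      simp only [chiZ] at hn; split_ifs at hn <;> omega
    rcases this with h | h | h | h <;> exact key _ _ h (by decide)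
  · have : n % 8 = 1 ∨ n % 8 = 3 ∨ n % 8 = 5 ∨ n % 8 = 7 := by
      simp only [chiZ] at hn; split_ifs at hn <;> omega
    rcases this with h | h | h | h <;> exact key _ _ h (by decide)
  · have : n % 3 = 1 ∨ n % 3 = 2 := by
      simp only [chiZ] at hn; split_ifs at hn <;> omega
    rcases this with h | h <;> exact key _ _ h (by decide)
  · have : n % 24 = 1 ∨ n % 24 = 5 ∨ n % 24 = 7 ∨ n % 24 = 11 ∨ n % 24 = 13 ∨ n % 24 = 17 ∨
        n % 24 = 19 ∨ n % 24 = 23 := by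
      simp only [chiZ] at hn; split_ifs at hn <;> omega
    rcases this with h | h | h | h | h | h | h | h <;> exact key _ _ h (by decide)
  · have : n % 12 = 1 ∨ n % 12 = 5 ∨ n % 12 = 7 ∨ n % 12 = 11 := by
      simp only [chiZ] at hn; split_ifs at hn <;> omega
    rcases this with h | h | h | h <;> exact key _ _ h (by decide)
  · have : n % 3 = 1 ∨ n % 3 = 2 := by
      simp only [chiZ] at hn; split_ifs at hn <;> omega
    rcases this with h | h <;> exact key _ _ h (by decide)

lemma a_pos {m : ℕ} (hm : m ∈ T) : 0 < a m := by
  simp only [T, mem_insert_iff, mem_singleton_iff] at hm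
  rcases hm with rfl | rfl | rfl | rfl | rfl | rfl <;> simp [a]

/-- Here 2b_m/c_m² = 1/a_m, and n² ≡ 1 mod a_m on the support of the character, so the phase is
independent of n. -/
lemma cexp_translation {m : ℕ} (hm : m ∈ T) (κ : ℕ) {n : ℕ+} (hn : chi m n ≠ 0) :
    cexp (-(2 * Real.pi * I * (2 * (κ * b m) / (c m : ℂ) ^ 2) * (n : ℂ) ^ 2)) =
      (zeta (a m) ^ κ)⁻¹ := by
  rw [chi_eq_chiZ hm n.pos] at hn
  obtain ⟨q, hq⟩ := a_dvd_sq_sub_one hm hn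
  have ha : (a m : ℂ) ≠ 0 := by exact_mod_cast (a_pos hm).ne'
  have hc : (c m : ℂ) ≠ 0 := by exact_mod_cast (c_pos hm).ne'
  have hab : 2 * (b m : ℂ) * a m = (c m : ℂ) ^ 2 := by exact_mod_cast two_mul_b_mul_a hm
  have hb : 2 * (b m : ℂ) = (c m : ℂ) ^ 2 / a m := by rw [← hab]; field_simp
  have hq' : (n : ℂ) ^ 2 = a m * q + 1 := by
    have : ((n : ℕ) : ℤ) ^ 2 = a m * q + 1 := by linarith
    exact_mod_cast congrArg (Int.cast : ℤ → ℂ) this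
  rw [zeta, ← Complex.exp_nat_mul, ← Complex.exp_neg]
  refine cexp_mul_two_pi_I_int (-(κ * q)) ?_
  have : 2 * ((κ : ℂ) * b m) / (c m : ℂ) ^ 2 = κ / a m := by
    rw [mul_left_comm, hb]; field_simp
  rw [hq', this]
  push_cast
  field_simp
  ring

/-- `E_m(2u/c_m²)` is an eigenfunction of the translation by `κ b_m`. -/
theorem scaledE_sub {m : ℕ} (hm : m ∈ T) (κ : ℕ) (u : ℂ) :
    scaledE m (u - κ * b m) = (zeta (a m) ^ κ)⁻¹ * scaledE m u := by
  rw [scaledE, scaledE, E, E, ← tsum_mul_left]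
  refine tsum_congr fun n => ?_
  rcases eq_or_ne (chi m n) 0 with h | h
  · simp [h]
  · rw [← cexp_translation hm κ h, mul_left_comm, ← Complex.exp_add]
    congr 2
    ring

lemma norm_zeta (N : ℕ) : ‖zeta N‖ = 1 := by
  have : (2 * Real.pi * I / N : ℂ) = ((2 * Real.pi / N : ℝ) : ℂ) * I := by push_cast; ring
  rw [zeta, this, norm_exp_ofReal_mul_I]

lemma norm_lowerMult (m k : ℕ) : ‖lowerMult m k‖ = 1 := by
  rw [lowerMult]
  split_ifs
  · rw [norm_pow, norm_zeta, one_pow]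
  · exact norm_one

/-! ### The values of the partial theta functions at rational numbers -/

lemma rt_I_mul {t : ℝ} (ht : 0 < t) : rt (I * t) = ((t ^ (1 / 2 : ℝ) : ℝ) : ℂ) := by
  have : -I * (I * t) = t := by linear_combination (-(t : ℂ)) * I_sq
  rw [rt, this, ofReal_cpow ht.le]
  norm_num

lemma integral_rpow_mul_exp {B : ℝ} (hB : 0 < B) :
    ∫ t in Ioi (0 : ℝ), t ^ (-(1 / 2) : ℝ) * Real.exp (-B * t) = √(Real.pi / B) := by
  have := Real.integral_rpow_mul_exp_neg_mul_Ioi (a := 1 / 2) (by norm_num) hB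
  rw [Real.Gamma_one_half_eq, ← Real.sqrt_eq_rpow, ← Real.sqrt_mul (by positivity)] at this
  rw [show (-(1 / 2) : ℝ) = 1 / 2 - 1 by norm_num]
  simp_rw [neg_mul]
  rw [this]
  congr 1
  ring

/-- A partial theta function as an integral over a shifted vertical path. -/
lemma integral_shifted_scaledE {m : ℕ} (hm : m ∈ T) (ρ : ℝ) {ε : ℝ} (hε : 0 < ε) :
    ∫ t in Ioi (0 : ℝ), scaledE m (ρ + I * ((t + ε : ℝ) : ℂ)) * ((t ^ (-(1 / 2) : ℝ) : ℝ) : ℂ) =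
      c m / 2 * Etilde m (-(2 * ρ / (c m : ℂ) ^ 2) - I * ((2 * ε / (c m : ℝ) ^ 2 : ℝ) : ℂ)) := by
  have hc : (0 : ℝ) < c m := by exact_mod_cast c_pos hm
  have hcC : (c m : ℂ) ≠ 0 := by exact_mod_cast (c_pos hm).ne'
  have hpi := Real.pi_pos
  set B : ℕ+ → ℝ := fun n => 4 * Real.pi * (n : ℝ) ^ 2 / (c m : ℝ) ^ 2 with hBdef
  have hn0 : ∀ n : ℕ+, (0 : ℝ) < n := fun n => by exact_mod_cast n.pos
  have hB : ∀ n, 0 < B n := fun n => by have := hn0 n; simp only [hBdef]; positivity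
  set A : ℕ+ → ℂ := fun n => chi m n * n * cexp (2 * Real.pi * I *
    (2 * (ρ + I * ε) / (c m : ℂ) ^ 2) * (n : ℂ) ^ 2) with hA
  have hnormA : ∀ n, ‖A n‖ ≤ n * Real.exp (-B n * ε) := by
    intro n
    have h1 : ‖(chi m n : ℂ)‖ ≤ 1 := by
      rw [chi_eq_chiZ hm n.pos, norm_intCast]
      exact_mod_cast chiZ_abs_le m n
    have h2 : 2 * Real.pi * I * (2 * (ρ + I * ε) / (c m : ℂ) ^ 2) * (n : ℂ) ^ 2 =
        ((-B n * ε : ℝ) : ℂ) + ((B n * ρ : ℝ) : ℂ) * I := by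
      simp only [hBdef]
      push_cast
      field_simp
      linear_combination (4 * ε : ℂ) * I_sq
    simp only [hA]
    rw [h2, Complex.exp_add, norm_mul, norm_mul, norm_mul, norm_exp_ofReal_mul_I, mul_one,
      ← ofReal_exp, norm_real, Real.norm_of_nonneg (Real.exp_nonneg _)]
    have h3 : ‖(n : ℂ)‖ = n := by simp
    rw [h3]
    gcongr
    exact mul_le_of_le_one_left (hn0 n).le h1
  -- This Gamma integral cancels the factor n in E_m. The shift ε supplies the decay in n that
  -- justifies integrating term by term.
  have hsqrt : ∀ n, √(Real.pi / B n) = c m / (2 * n) := by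
    intro n
    have := hn0 n
    have : Real.pi / B n = (c m / (2 * n)) ^ 2 := by
      simp only [hBdef]; field_simp; ring
    rw [this, Real.sqrt_sq (by positivity)]
  set F : ℕ+ → ℝ → ℂ := fun n t =>
    A n * ((t ^ (-(1 / 2) : ℝ) * Real.exp (-B n * t) : ℝ) : ℂ) with hF
  have hint : ∀ n, Integrable (F n) (volume.restrict (Ioi 0)) := fun n =>
    (integrableOn_rpow_mul_exp (hB n)).ofReal.const_mul _
  have hInt : ∀ n, ∫ t in Ioi (0 : ℝ), F n t = A n * ((c m / (2 * n) : ℝ) : ℂ) := by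
    intro n
    simp only [hF]
    rw [integral_const_mul, integral_complex_ofReal, integral_rpow_mul_exp (hB n), hsqrt]
  have hnorm : ∀ n, ∫ t in Ioi (0 : ℝ), ‖F n t‖ = ‖A n‖ * (c m / (2 * n)) := by
    intro n
    rw [← hsqrt n, ← integral_rpow_mul_exp (hB n), ← integral_const_mul]
    refine setIntegral_congr_fun measurableSet_Ioi fun t ht => ?_
    have ht : (0 : ℝ) < t := ht
    simp only [hF]
    rw [norm_mul, norm_real, Real.norm_of_nonneg (by positivity)]
  have hsum : Summable fun n : ℕ+ => ∫ t in Ioi (0 : ℝ), ‖F n t‖ := by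
    have hg : Summable fun n : ℕ+ => c m / 2 * Real.exp ((n : ℕ) *
        (-(4 * Real.pi / (c m : ℝ) ^ 2 * ε))) := by
      have h1 : Summable fun n : ℕ => Real.exp (n * (-(4 * Real.pi / (c m : ℝ) ^ 2 * ε))) := by
        refine Real.summable_exp_nat_mul_iff.2 ?_
        have : 0 < 4 * Real.pi / (c m : ℝ) ^ 2 * ε := by positivity
        linarith
      exact (h1.comp_injective PNat.coe_injective).mul_left _
    refine hg.of_nonneg_of_le (fun n => integral_nonneg fun t => norm_nonneg _) fun n => ?_
    have hn := hn0 n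
    have hn1 : (1 : ℝ) ≤ n := by exact_mod_cast n.pos
    rw [hnorm]
    calc ‖A n‖ * (c m / (2 * n)) ≤ n * Real.exp (-B n * ε) * (c m / (2 * n)) := by
          gcongr; exact hnormA n
      _ = c m / 2 * Real.exp (-B n * ε) := by field_simp
      _ ≤ _ := by
          gcongr c m / 2 * Real.exp ?_
          have h1 : B n = 4 * Real.pi / (c m : ℝ) ^ 2 * (n : ℝ) ^ 2 := by
            simp only [hBdef]; ring
          have h2 : 0 < 4 * Real.pi / (c m : ℝ) ^ 2 * ε := by positivity
          rw [h1]
          have h3 : (n : ℝ) ≤ (n : ℝ) ^ 2 := by nlinarith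
          nlinarith [mul_le_mul_of_nonneg_left h3 h2.le]
  have hmain := hasSum_integral_of_summable_integral_norm hint hsum
  have hE : ∀ t ∈ Ioi (0 : ℝ), ∑' n, F n t =
      scaledE m (ρ + I * ((t + ε : ℝ) : ℂ)) * ((t ^ (-(1 / 2) : ℝ) : ℝ) : ℂ) := by
    intro t ht
    rw [scaledE, E, ← tsum_mul_right]
    refine tsum_congr fun n => ?_
    simp only [hF, hA]
    have h2 : 2 * Real.pi * I * (2 * (ρ + I * ((t + ε : ℝ) : ℂ)) / (c m : ℂ) ^ 2) * (n : ℂ) ^ 2 =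
        2 * Real.pi * I * (2 * (ρ + I * ε) / (c m : ℂ) ^ 2) * (n : ℂ) ^ 2 +
          ((-B n * t : ℝ) : ℂ) := by
      simp only [hBdef]
      push_cast
      field_simp
      linear_combination (4 * t : ℂ) * I_sq
    rw [h2, Complex.exp_add]
    push_cast
    ring
  rw [← setIntegral_congr_fun measurableSet_Ioi hE, ← hmain.tsum_eq, Etilde, ← tsum_mul_left]
  refine tsum_congr fun n => ?_
  have hnC : (n : ℂ) ≠ 0 := by exact_mod_cast n.pos.ne'
  rw [hInt]
  simp only [hA]
  have h2 : 2 * Real.pi * I * (2 * (ρ + I * ε) / (c m : ℂ) ^ 2) * (n : ℂ) ^ 2 =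
      -2 * Real.pi * I * (-(2 * ρ / (c m : ℂ) ^ 2) - I * ((2 * ε / (c m : ℝ) ^ 2 : ℝ) : ℂ)) *
        (n : ℂ) ^ 2 := by
    push_cast; ring
  rw [h2]
  push_cast
  field_simp

/-- Dominated convergence with majorant C t^(-1/2) exp(-pt), uniform in ε because f is controlled on
the whole vertical line over a rational. -/
lemma IsCuspidal.tendsto_shift {f : ℂ → ℂ} (hf : IsCuspidal f) (ρ : ℚ) :
    Tendsto (fun ε : ℝ => ∫ t in Ioi (0 : ℝ),
      f ((ρ : ℝ) + I * ((t + ε : ℝ) : ℂ)) * ((t ^ (-(1 / 2) : ℝ) : ℝ) : ℂ)) (𝓝[>] 0)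
      (𝓝 (-I * vertInt (kern f ρ) ρ)) := by
  obtain ⟨C, p, hC, hp, h⟩ := hf.vertical_bound ρ
  have hlim : -I * vertInt (kern f ρ) ρ = ∫ t in Ioi (0 : ℝ),
      f ((ρ : ℝ) + I * (t : ℂ)) * ((t ^ (-(1 / 2) : ℝ) : ℝ) : ℂ) := by
    rw [vertInt, ← integral_const_mul]
    refine setIntegral_congr_fun measurableSet_Ioi fun t ht => ?_
    have ht : (0 : ℝ) < t := ht
    simp only [kern, ofReal_ratCast, add_sub_cancel_left]
    rw [rt_I_mul ht, Real.rpow_neg ht.le]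
    push_cast
    linear_combination (-(f (ρ + I * t) / ((t ^ (1 / 2 : ℝ) : ℝ) : ℂ))) * I_sq
  rw [hlim]
  refine tendsto_integral_filter_of_dominated_convergence
    (fun t => C * (t ^ (-(1 / 2) : ℝ) * Real.exp (-p * t))) ?_ ?_
    ((integrableOn_rpow_mul_exp hp).const_mul C) ?_
  · filter_upwards [self_mem_nhdsWithin] with ε hε
    have hε : 0 < ε := hε
    have hcont : ContinuousOn (fun t : ℝ => f ((ρ : ℝ) + I * ((t + ε : ℝ) : ℂ)) *
        ((t ^ (-(1 / 2) : ℝ) : ℝ) : ℂ)) (Ioi 0) := by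
      intro t ht
      have ht : (0 : ℝ) < t := ht
      have h1 : ContinuousAt f ((ρ : ℝ) + I * ((t + ε : ℝ) : ℂ)) :=
        (hf.differentiableAt _ (by simp; positivity)).continuousAt
      have h2 : ContinuousAt (fun t : ℝ => (((ρ : ℝ) : ℂ) + I * ((t + ε : ℝ) : ℂ))) t := by
        fun_prop
      have h3 : ContinuousAt (fun t : ℝ => t ^ (-(1 / 2) : ℝ)) t :=
        Real.continuousAt_rpow_const _ _ (Or.inl ht.ne')
      exact ((ContinuousAt.comp (f := fun t : ℝ => (((ρ : ℝ) : ℂ) + I * ((t + ε : ℝ) : ℂ))) h1 h2).mul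
        (continuous_ofReal.continuousAt.comp h3)).continuousWithinAt
    exact hcont.aestronglyMeasurable measurableSet_Ioi
  · filter_upwards [self_mem_nhdsWithin] with ε hε
    have hε : 0 < ε := hε
    refine (ae_restrict_iff' measurableSet_Ioi).2 (Eventually.of_forall fun t ht => ?_)
    have ht : (0 : ℝ) < t := ht
    rw [norm_mul, norm_real, Real.norm_of_nonneg (by positivity), mul_left_comm, mul_comm]
    gcongr
    refine le_trans ?_ (mul_le_mul_of_nonneg_left
      (Real.exp_le_exp.2 (by nlinarith : -p * (t + ε) ≤ -p * t)) hC)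
    exact_mod_cast h (t + ε) (by positivity)
  · refine (ae_restrict_iff' measurableSet_Ioi).2 (Eventually.of_forall fun t ht => ?_)
    have ht : (0 : ℝ) < t := ht
    refine Tendsto.mul_const _ ?_
    have h1 : ContinuousAt f ((ρ : ℝ) + I * ((t + 0 : ℝ) : ℂ)) :=
      (hf.differentiableAt _ (by simpa using ht)).continuousAt
    have h2 : ContinuousAt (fun ε : ℝ => (((ρ : ℝ) : ℂ) + I * ((t + ε : ℝ) : ℂ))) 0 := by
      fun_prop
    have h3 := ContinuousAt.comp (f := fun ε : ℝ => (((ρ : ℝ) : ℂ) + I * ((t + ε : ℝ) : ℂ))) h1 h2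
    have h4 := h3.tendsto.mono_left (nhdsWithin_le_nhds (s := Ioi 0))
    simpa [Function.comp_def] using h4

/-- The value of `Ẽ_m` at a rational number as a period integral. -/
theorem hasValueAt {m : ℕ} (hm : m ∈ T) (x : ℚ) :
    HasValueAt m (2 * x / (c m : ℚ) ^ 2)
      (-(2 * I / c m) * vertInt (kern (scaledE m) (-x : ℚ)) (-x : ℚ)) := by
  have hc : (0 : ℝ) < c m := by exact_mod_cast c_pos hm
  have hcC : (c m : ℂ) ≠ 0 := by exact_mod_cast (c_pos hm).ne'
  have h1 := (isCuspidal_scaledE hm).tendsto_shift (-x)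
  -- The substitution ε = c_m² t/2 undoes the scaling of the argument, so that the approach to the
  -- rational is at height exactly t.
  have h2 : Tendsto (fun t : ℝ => (c m : ℝ) ^ 2 / 2 * t) (𝓝[>] 0) (𝓝[>] 0) := by
    rw [tendsto_nhdsWithin_iff]
    constructor
    · have : Continuous fun t : ℝ => (c m : ℝ) ^ 2 / 2 * t := by fun_prop
      have := this.tendsto 0
      rw [mul_zero] at this
      exact this.mono_left nhdsWithin_le_nhds
    · filter_upwards [self_mem_nhdsWithin] with t ht
      have ht : 0 < t := ht
      simp only [mem_Ioi]; positivity
  have h3 := (h1.comp h2).const_mul (2 / c m : ℂ)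
  have h4 : (2 / c m : ℂ) * (-I * vertInt (kern (scaledE m) (-x : ℚ)) (-x : ℚ)) =
      -(2 * I / c m) * vertInt (kern (scaledE m) (-x : ℚ)) (-x : ℚ) := by ring
  rw [h4] at h3
  refine h3.congr' ?_
  filter_upwards [self_mem_nhdsWithin] with t ht
  have ht : 0 < t := ht
  simp only [Function.comp_apply]
  rw [integral_shifted_scaledE hm _ (by positivity), ← mul_assoc]
  have h5 : (2 / c m * (c m / 2) : ℂ) = 1 := by field_simp
  rw [h5, one_mul]
  congr 1
  push_cast
  field_simp

lemma etildeRat_eq {m : ℕ} (hm : m ∈ T) (x : ℚ) : EtildeRat m (2 * x / (c m : ℚ) ^ 2) =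
    -(2 * I / c m) * vertInt (kern (scaledE m) (-x : ℚ)) (-x : ℚ) :=
  (hasValueAt hm x).limUnder_eq

lemma hasValueAt_etildeRat {m : ℕ} (hm : m ∈ T) (r : ℚ) : HasValueAt m r (EtildeRat m r) := by
  have hc : (c m : ℚ) ≠ 0 := by exact_mod_cast (c_pos hm).ne'
  have hr : r = 2 * (r * (c m : ℚ) ^ 2 / 2) / (c m : ℚ) ^ 2 := by field_simp
  rw [hr, etildeRat_eq hm]
  exact hasValueAt hm _

lemma etilde_conj (m : ℕ) (z : ℂ) : Etilde m (-conj z) = conj (Etilde m z) := by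
  rw [Etilde, Etilde, Complex.conj_tsum]
  refine tsum_congr fun n => ?_
  rw [map_mul, ← Complex.exp_conj]
  congr 1
  · simp
  · congr 1
    simp only [map_mul, map_neg, map_pow, conj_I, conj_ofReal, map_natCast, map_ofNat]
    ring

/-- The coefficients are real, and conjugating the approach r - it corresponds to the approach -r -
it. -/
lemma etildeRat_neg {m : ℕ} (hm : m ∈ T) (r : ℚ) : EtildeRat m (-r) = conj (EtildeRat m r) := by
  have h1 := hasValueAt_etildeRat hm (-r)
  have h2 := (continuous_conj.tendsto _).comp (hasValueAt_etildeRat hm r)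
  refine tendsto_nhds_unique (h1.congr fun t => ?_) h2
  rw [Function.comp_apply, ← etilde_conj]
  congr 1
  simp
  ring

lemma etildeRat_add {m : ℕ} (hm : m ∈ T) (κ : ℕ) (x : ℚ) :
    EtildeRat m (2 * x / (c m : ℚ) ^ 2) =
      zeta (a m) ^ κ * EtildeRat m (2 * (x + κ * b m) / (c m : ℚ) ^ 2) := by
  have h1 := hasValueAt_etildeRat hm (2 * x / (c m : ℚ) ^ 2)
  have h2 := (hasValueAt_etildeRat hm (2 * (x + κ * b m) / (c m : ℚ) ^ 2)).const_mul
    (zeta (a m) ^ κ)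
  refine tendsto_nhds_unique h1 (h2.congr fun t => ?_)
  rw [Etilde, Etilde, ← tsum_mul_left]
  refine tsum_congr fun n => ?_
  rcases eq_or_ne (chi m n) 0 with h | h
  · simp [h]
  · have hz : zeta (a m) ^ κ ≠ 0 := pow_ne_zero _ (by rw [zeta]; exact Complex.exp_ne_zero _)
    have h3 := cexp_translation hm κ h
    have h4 : cexp (-2 * Real.pi * I * (((2 * (x + κ * b m) / (c m : ℚ) ^ 2 : ℚ) : ℂ) - I * t) *
        (n : ℂ) ^ 2) = cexp (-2 * Real.pi * I * (((2 * x / (c m : ℚ) ^ 2 : ℚ) : ℂ) - I * t) *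
        (n : ℂ) ^ 2) * (zeta (a m) ^ κ)⁻¹ := by
      rw [← h3, ← Complex.exp_add]
      congr 1
      push_cast
      ring
    rw [h4]
    field_simp

/-! ### Real analyticity of the period integrals -/

lemma hasDerivAt_rt {z : ℂ} (h : 0 < z.im ∨ z.re ≠ 0) : HasDerivAt rt (-I / (2 * rt z)) z := by
  have hz : z ≠ 0 := by
    rintro rfl
    simp at h
  have h1 := (differentiableAt_rt h).hasDerivAt
  have h2 := h1.pow 2
  have h3 : HasDerivAt (fun z => rt z ^ 2) (-I) z := by
    have : (fun z => rt z ^ 2) = fun z => -I * z := funext rt_sq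
    rw [this]
    simpa using (hasDerivAt_id z).const_mul (-I)
  have h4 := h2.unique h3
  have h5 := rt_ne_zero hz
  refine h1.congr_deriv ?_
  rw [eq_div_iff (mul_ne_zero two_ne_zero h5), ← h4]
  push_cast
  ring

/-- The variable x extends to a complex disc of radius |ρ + x₀|/2, on which the argument of the root
keeps its real part away from 0. The integral is holomorphic there, and its restriction to the real
line is real analytic. -/
lemma IsCuspidal.analyticAt_vertInt {f : ℂ → ℂ} (hf : IsCuspidal f) (ρ : ℚ) {x₀ : ℝ}
    (hx₀ : (ρ : ℝ) + x₀ ≠ 0) :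
    AnalyticAt ℝ (fun x : ℝ => vertInt (kern f (-x)) ρ) x₀ := by
  obtain ⟨C, p, hC, hp, h⟩ := hf.vertical_bound ρ
  set r : ℝ := |(ρ : ℝ) + x₀| / 2 with hr
  have hr0 : 0 < r := by positivity
  set W : Set ℂ := Metric.ball (x₀ : ℂ) r with hW
  have hWo : IsOpen W := Metric.isOpen_ball
  set w : ℂ → ℝ → ℂ := fun z t => ρ + I * t + z with hw
  have hre : ∀ z ∈ W, ∀ t : ℝ, r ≤ |(w z t).re| := by
    intro z hz t
    have h1 : |(z - x₀).re| < r := (abs_re_le_norm _).trans_lt (mem_ball_iff_norm.1 hz)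
    have h2 : (w z t).re = ρ + x₀ + (z - x₀).re := by simp [hw]
    have h3 : |(ρ : ℝ) + x₀| = 2 * r := by rw [hr]; ring
    have h4 := abs_sub_abs_le_abs_sub ((ρ : ℝ) + x₀) (-(z - x₀).re)
    rw [abs_neg, sub_neg_eq_add] at h4
    rw [h2]
    linarith
  have hre0 : ∀ z ∈ W, ∀ t : ℝ, (w z t).re ≠ 0 := fun z hz t h0 => by
    have := hre z hz t
    rw [h0, abs_zero] at this
    linarith
  have hwne : ∀ z ∈ W, ∀ t : ℝ, w z t ≠ 0 := fun z hz t h0 =>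
    hre0 z hz t (by rw [h0]; rfl)
  have hrt : ∀ z ∈ W, ∀ t : ℝ, √r ≤ ‖rt (w z t)‖ := fun z hz t => by
    rw [norm_rt]
    exact Real.sqrt_le_sqrt ((hre z hz t).trans (abs_re_le_norm _))
  have hsr : 0 < √r := Real.sqrt_pos.2 hr0
  have hfc : ContinuousOn (fun t : ℝ => f (ρ + I * t)) (Ioi 0) := by
    intro t ht
    have ht : (0 : ℝ) < t := ht
    have h1 : ContinuousAt f (ρ + I * t) :=
      (hf.differentiableAt _ (by simpa using ht)).continuousAt
    exact (ContinuousAt.comp (f := fun t : ℝ => (ρ : ℂ) + I * t) h1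
      (by fun_prop)).continuousWithinAt
  have hrc : ∀ z ∈ W, Continuous fun t : ℝ => rt (w z t) := fun z hz => by
    refine continuous_iff_continuousAt.2 fun t => ?_
    exact ContinuousAt.comp (f := fun t : ℝ => w z t)
      (differentiableAt_rt (Or.inr (hre0 z hz t))).continuousAt (by simp only [hw]; fun_prop)
  set F : ℂ → ℝ → ℂ := fun z t => f (ρ + I * t) / rt (w z t) * I with hF
  set F' : ℂ → ℝ → ℂ := fun z t =>
    f (ρ + I * t) * (-(-I / (2 * rt (w z t))) / rt (w z t) ^ 2) * I with hF'
  have hmeas : ∀ z ∈ W, AEStronglyMeasurable (F z) (volume.restrict (Ioi 0)) := fun z hz =>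
    ((hfc.div (hrc z hz).continuousOn fun t _ => rt_ne_zero (hwne z hz t)).mul
      continuousOn_const).aestronglyMeasurable measurableSet_Ioi
  have hmeas' : ∀ z ∈ W, AEStronglyMeasurable (F' z) (volume.restrict (Ioi 0)) := fun z hz =>
    ((hfc.mul (ContinuousOn.div (continuousOn_const.div
      (continuousOn_const.mul (hrc z hz).continuousOn)
        fun t _ => mul_ne_zero two_ne_zero (rt_ne_zero (hwne z hz t))).neg
      ((hrc z hz).continuousOn.pow 2) fun t _ => pow_ne_zero _ (rt_ne_zero (hwne z hz t)))).mul
      continuousOn_const).aestronglyMeasurable measurableSet_Ioi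
  have hint : ∀ z ∈ W, Integrable (F z) (volume.restrict (Ioi 0)) := by
    intro z hz
    refine ((integrableOn_exp_neg_mul hp C).mul_const (√r)⁻¹).mono' (hmeas z hz) ?_
    refine (ae_restrict_iff' measurableSet_Ioi).2 (Eventually.of_forall fun t ht => ?_)
    simp only [hF]
    rw [norm_mul, norm_I, mul_one, norm_div, div_eq_mul_inv]
    gcongr
    · exact h t ht
    · exact hrt z hz t
  have hdiff : ∀ z ∈ W, HasDerivAt (fun z => ∫ t in Ioi (0 : ℝ), F z t)
      (∫ t in Ioi (0 : ℝ), F' z t) z := by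
    intro z hz
    refine (hasDerivAt_integral_of_dominated_loc_of_deriv_le (hWo.mem_nhds hz)
      (bound := fun t => C * Real.exp (-p * t) * ((2 * √r)⁻¹ / √r ^ 2))
      ?_ (hint z hz) (hmeas' z hz) ?_ ((integrableOn_exp_neg_mul hp C).mul_const _) ?_).2
    · filter_upwards [hWo.mem_nhds hz] with y hy using hmeas y hy
    · refine (ae_restrict_iff' measurableSet_Ioi).2 (Eventually.of_forall fun t ht y hy => ?_)
      simp only [hF']
      rw [norm_mul, norm_I, mul_one, norm_mul, norm_div, norm_neg, norm_div, norm_neg, norm_I,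
        norm_mul, norm_pow, one_div, RCLike.norm_ofNat]
      have := hrt y hy t
      gcongr
      exact h t ht
    · refine Eventually.of_forall fun t y hy => ?_
      have h1 := hasDerivAt_rt (Or.inr (hre0 y hy t))
      have h2 : HasDerivAt (fun y => w y t) 1 y := (hasDerivAt_id y).const_add _
      have h3 := h1.comp y h2
      rw [mul_one] at h3
      have h4 := ((h3.inv (rt_ne_zero (hwne y hy t))).const_mul (f (ρ + I * t))).mul_const I
      exact h4
  have han : AnalyticAt ℂ (fun z => ∫ t in Ioi (0 : ℝ), F z t) (x₀ : ℂ) := by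
    have : DifferentiableOn ℂ (fun z => ∫ t in Ioi (0 : ℝ), F z t) W :=
      fun z hz => (hdiff z hz).differentiableAt.differentiableWithinAt
    exact this.analyticAt (hWo.mem_nhds (Metric.mem_ball_self hr0))
  have han2 := AnalyticAt.comp (f := fun x : ℝ => (x : ℂ)) (x := x₀) (han.restrictScalars (𝕜 := ℝ))
    (ofRealCLM.analyticAt x₀)
  convert! han2 using 1
  ext x
  simp only [vertInt, kern, Function.comp_apply, hF, hw]
  push_cast
  simp only [sub_neg_eq_add]

/-! ### Matrices -/

/-- The Moebius transformation `τ ↦ -γ(-τ)`. -/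
noncomputable def mirror (γ : SL(2, ℤ)) (τ : ℂ) : ℂ :=
  mob (γ 0 0) (-(γ 0 1)) (-(γ 1 0)) (γ 1 1) τ

/-- The denominator of `τ ↦ -γ(-τ)`. -/
noncomputable def mirrorDen (γ : SL(2, ℤ)) (τ : ℂ) : ℂ := ((-(γ 1 0) : ℝ) : ℂ) * τ + ((γ 1 1 : ℝ) : ℂ)

lemma mirror_det (γ : SL(2, ℤ)) :
    ((γ 0 0 : ℤ) : ℝ) * (γ 1 1 : ℤ) - (-(γ 0 1 : ℤ) : ℝ) * (-(γ 1 0 : ℤ) : ℝ) = 1 := by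
  have h := γ.det_coe
  rw [Matrix.det_fin_two] at h
  have h' : ((γ 0 0 : ℤ) : ℝ) * (γ 1 1 : ℤ) - (γ 0 1 : ℤ) * (γ 1 0 : ℤ) = 1 := by exact_mod_cast h
  linarith

lemma mirrorDen_ne_zero (γ : SL(2, ℤ)) {τ : ℂ} (hτ : 0 < τ.im) : mirrorDen γ τ ≠ 0 :=
  mob_den_ne_zero (mirror_det γ) hτ

lemma mirror_im_pos (γ : SL(2, ℤ)) {τ : ℂ} (hτ : 0 < τ.im) : 0 < (mirror γ τ).im :=
  mob_im_pos (mirror_det γ) hτ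

lemma continuousOn_mirror (γ : SL(2, ℤ)) : ContinuousOn (mirror γ) {τ | 0 < τ.im} := fun _ hτ =>
  (hasDerivAt_mob (mirror_det γ) (mirrorDen_ne_zero γ hτ)).continuousAt.continuousWithinAt

lemma mirror_mul_mirrorDen (γ : SL(2, ℤ)) {τ : ℂ} (hτ : 0 < τ.im) :
    mirror γ τ * mirrorDen γ τ = (γ 0 0 : ℤ) * τ - (γ 0 1 : ℤ) := by
  have h : mirror γ τ = (((γ 0 0 : ℤ) : ℝ) * τ + ((-(γ 0 1 : ℤ) : ℝ) : ℂ)) / mirrorDen γ τ := rfl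
  rw [h, div_mul_cancel₀ _ (mirrorDen_ne_zero γ hτ)]
  push_cast
  ring

lemma mirrorDen_apply (γ : SL(2, ℤ)) (τ : ℂ) : mirrorDen γ τ = (γ 1 1 : ℤ) - (γ 1 0 : ℤ) * τ := by
  rw [mirrorDen]; push_cast; ring

lemma mirrorDen_mul (γ₁ γ₂ : SL(2, ℤ)) {τ : ℂ} (hτ : 0 < τ.im) :
    mirrorDen (γ₁ * γ₂) τ = mirrorDen γ₁ (mirror γ₂ τ) * mirrorDen γ₂ τ := by
  have h := mirror_mul_mirrorDen γ₂ hτ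
  rw [mirrorDen_apply γ₁, sub_mul, mul_assoc, h, mirrorDen_apply, mirrorDen_apply]
  simp only [Matrix.SpecialLinearGroup.coe_mul, Matrix.mul_apply, Fin.sum_univ_two]
  push_cast
  ring

lemma mirror_mul (γ₁ γ₂ : SL(2, ℤ)) {τ : ℂ} (hτ : 0 < τ.im) :
    mirror (γ₁ * γ₂) τ = mirror γ₁ (mirror γ₂ τ) := by
  have h := mirror_mul_mirrorDen γ₂ hτ
  have h1 := mirror_mul_mirrorDen γ₁ (mirror_im_pos γ₂ hτ)
  refine mul_right_cancel₀ (mirrorDen_ne_zero (γ₁ * γ₂) hτ) ?_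
  rw [mirror_mul_mirrorDen _ hτ, mirrorDen_mul γ₁ γ₂ hτ, ← mul_assoc, h1, sub_mul, mul_assoc, h,
    mirrorDen_apply]
  simp only [Matrix.SpecialLinearGroup.coe_mul, Matrix.mul_apply, Fin.sum_univ_two]
  push_cast
  ring

lemma mirror_one (τ : ℂ) : mirror 1 τ = τ := by simp [mirror, mob]

lemma mirrorDen_one (τ : ℂ) : mirrorDen 1 τ = 1 := by simp [mirrorDen]

/-- Modularity of weight `3/2` under `τ ↦ -γ(-τ)`, with an unspecified branch of the automorphy
factor and an unspecified multiplier. -/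
def IsModularFor (f : ℂ → ℂ) (γ : SL(2, ℤ)) : Prop :=
  ∃ (J : ℂ → ℂ) (ω : ℂ), ContinuousOn J {τ | 0 < τ.im} ∧ ‖ω‖ = 1 ∧
    ∀ τ : ℂ, 0 < τ.im → J τ ^ 2 = ω * mirrorDen γ τ ^ 3 ∧ f (mirror γ τ) = J τ * f τ

lemma IsModularFor.one (f : ℂ → ℂ) : IsModularFor f 1 :=
  ⟨fun _ => 1, 1, continuousOn_const, norm_one, fun τ _ => by
    simp [mirror_one, mirrorDen_one]⟩

/-- Automorphy factors compose by the cocycle relation of `mirrorDen`. Leaving the branch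
unspecified avoids any sign bookkeeping for products. -/
lemma IsModularFor.mul {f : ℂ → ℂ} {γ₁ γ₂ : SL(2, ℤ)} (h₁ : IsModularFor f γ₁)
    (h₂ : IsModularFor f γ₂) : IsModularFor f (γ₁ * γ₂) := by
  obtain ⟨J₁, ω₁, hc₁, hn₁, h₁⟩ := h₁
  obtain ⟨J₂, ω₂, hc₂, hn₂, h₂⟩ := h₂
  refine ⟨fun τ => J₁ (mirror γ₂ τ) * J₂ τ, ω₁ * ω₂,
    (hc₁.comp (continuousOn_mirror γ₂) fun τ hτ => mirror_im_pos γ₂ hτ).mul hc₂,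
    by rw [norm_mul, hn₁, hn₂, one_mul], fun τ hτ => ?_⟩
  obtain ⟨a1, a2⟩ := h₁ _ (mirror_im_pos γ₂ hτ)
  obtain ⟨b1, b2⟩ := h₂ τ hτ
  constructor
  · rw [mul_pow, a1, b1, mirrorDen_mul γ₁ γ₂ hτ]; ring
  · rw [mirror_mul γ₁ γ₂ hτ, a2, b2]; ring

lemma IsModularFor.inv {f : ℂ → ℂ} {γ : SL(2, ℤ)} (h : IsModularFor f γ) :
    IsModularFor f γ⁻¹ := by
  obtain ⟨J, ω, hc, hn, h⟩ := h
  have hω : ω ≠ 0 := by rintro rfl; simp at hn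
  have hJ : ∀ τ : ℂ, 0 < τ.im → J τ ≠ 0 := by
    intro τ hτ h0
    have := (h τ hτ).1
    rw [h0] at this
    have h2 := mul_ne_zero hω (pow_ne_zero 3 (mirrorDen_ne_zero γ hτ))
    rw [← this] at h2
    simp at h2
  refine ⟨fun τ => (J (mirror γ⁻¹ τ))⁻¹, ω⁻¹, ContinuousOn.inv₀
    (hc.comp (continuousOn_mirror γ⁻¹) fun τ hτ => mirror_im_pos γ⁻¹ hτ)
    fun τ hτ => hJ _ (mirror_im_pos γ⁻¹ hτ), by rw [norm_inv, hn, inv_one], fun τ hτ => ?_⟩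
  obtain ⟨a1, a2⟩ := h _ (mirror_im_pos γ⁻¹ hτ)
  have h1 := mirrorDen_mul γ γ⁻¹ hτ
  have h2 := mirror_mul γ γ⁻¹ hτ
  rw [mul_inv_cancel, mirrorDen_one] at h1
  rw [mul_inv_cancel, mirror_one] at h2
  constructor
  · rw [inv_pow, a1, mul_inv]
    congr 1
    rw [← inv_pow]
    congr 1
    exact (eq_inv_of_mul_eq_one_right h1.symm).symm
  · rw [← h2] at a2
    rw [a2, inv_mul_cancel_left₀ (hJ _ (mirror_im_pos γ⁻¹ hτ))]

/-! ### Modularity for the generators and for the group they generate -/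

lemma mirror_lowerUnip (k : ℕ) (τ : ℂ) : mirror (lowerUnip k) τ = mob 1 0 (-k) 1 τ := by
  simp [mirror, lowerUnip]

lemma continuousOn_rt {S : Set ℂ} {g : ℂ → ℂ} (hg : ContinuousOn g S) (h : ∀ z ∈ S, 0 < (g z).im) :
    ContinuousOn (fun z => rt (g z)) S := fun z hz =>
  (differentiableAt_rt (Or.inl (h z hz))).continuousAt.comp_continuousWithinAt (hg z hz)

/-- The automorphy factor of `E_m(2u/c_m²)` for `u ↦ u / (1 - ku)`. -/
noncomputable def lowerFactor (m k : ℕ) (τ : ℂ) : ℂ :=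
  lowerMult m k * rt τ ^ 3 / rt (mob 1 0 (-k) 1 τ) ^ 3

lemma lower_det (k : ℕ) : (1 : ℝ) * 1 - 0 * (-k) = 1 := by ring

lemma continuousOn_lowerFactor (m k : ℕ) : ContinuousOn (lowerFactor m k) {τ | 0 < τ.im} := by
  have h1 : ContinuousOn (mob 1 0 (-k) 1) {τ | 0 < τ.im} := fun τ hτ =>
    (hasDerivAt_mob (lower_det k) (mob_den_ne_zero (lower_det k) hτ)).continuousAt.continuousWithinAt
  refine (continuousOn_const.mul ((continuousOn_rt continuousOn_id fun τ hτ => hτ).pow 3)).div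
    ((continuousOn_rt h1 fun τ hτ => mob_im_pos (lower_det k) hτ).pow 3) fun τ hτ => ?_
  exact pow_ne_zero _ (rt_ne_zero (ne_zero_of_im_pos (mob_im_pos (lower_det k) hτ)))

lemma lowerFactor_sq (m k : ℕ) {τ : ℂ} (hτ : 0 < τ.im) : lowerFactor m k τ ^ 2 =
    lowerMult m k ^ 2 * (((-k : ℝ) : ℂ) * τ + ((1 : ℝ) : ℂ)) ^ 3 := by
  have h0 := ne_zero_of_im_pos hτ
  have h1 := mob_den_ne_zero (lower_det k) hτ
  have h2 : ((((1 : ℝ) : ℂ)) * τ + ((0 : ℝ) : ℂ)) = τ := by push_cast; ring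
  rw [lowerFactor, div_pow, mul_pow, ← pow_mul, ← pow_mul, mul_comm 3 2, pow_mul, pow_mul, rt_sq,
    rt_sq, mob, h2]
  generalize ((-k : ℝ) : ℂ) * τ + ((1 : ℝ) : ℂ) = D at *
  field_simp

lemma isModularFor_lowerUnip {m k : ℕ} (hm : m ∈ T) (hk : Even m ∨ Even k) :
    IsModularFor (scaledE m) (lowerUnip k) := by
  refine ⟨lowerFactor m k, lowerMult m k ^ 2, continuousOn_lowerFactor m k,
    by rw [norm_pow, norm_lowerMult, one_pow], fun τ hτ => ⟨?_, ?_⟩⟩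
  · rw [lowerFactor_sq m k hτ]
    congr 2
    simp [mirrorDen, lowerUnip]
  · rw [mirror_lowerUnip, scaledE_lower hm hk hτ, lowerFactor]

lemma isModularFor_upperUnip {m : ℕ} (hm : m ∈ T) (κ : ℕ) :
    IsModularFor (scaledE m) (upperUnip (κ * b m : ℕ)) := by
  refine ⟨fun _ => (zeta (a m) ^ κ)⁻¹, ((zeta (a m) ^ κ)⁻¹) ^ 2, continuousOn_const,
    by rw [norm_pow, norm_inv, norm_pow, norm_zeta]; simp, fun τ hτ => ⟨?_, ?_⟩⟩
  · simp [mirrorDen, upperUnip]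
  · rw [← scaledE_sub hm]
    congr 1
    simp [mirror, mob, upperUnip]
    ring

lemma even_ellPair {m n : ℕ} (hm : m ∈ T) : Even m ∨ Even (ellPair m n) := by
  simp only [T, mem_insert_iff, mem_singleton_iff] at hm
  unfold ellPair ell
  split_ifs with h1 h2
  · exact Or.inr even_two
  · left
    rcases hm with rfl | rfl | rfl | rfl | rfl | rfl <;> first | decide | (exfalso; omega)
  · exact Or.inr even_two

lemma isModularFor_of_mem {m n : ℕ} (hm : m ∈ T) {γ : SL(2, ℤ)} (hγ : γ ∈ G m n) :
    IsModularFor (scaledE m) γ := by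
  induction hγ using Subgroup.closure_induction with
  | mem x hx =>
    rcases hx with rfl | rfl
    · exact isModularFor_lowerUnip hm (even_ellPair hm)
    · exact isModularFor_upperUnip hm _
  | one => exact IsModularFor.one _
  | mul x y _ _ hx hy => exact hx.mul hy
  | inv x _ hx => exact hx.inv

/-! ### Quantum modularity -/

lemma IsCuspidal.vertInt_of_branch {f : ℂ → ℂ} (hf : IsCuspidal f) {a b c d : ℝ}
    (hdet : a * d - b * c = 1) (hc : c ≠ 0) {σ σ' ρ : ℚ} (hD : c * σ + d ≠ 0)
    (hσ' : (σ' : ℝ) = (a * σ + b) / (c * σ + d)) (hρ : (ρ : ℝ) = -d / c) {J : ℂ → ℂ} {δ : ℂ}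
    (hJ : ∀ τ : ℂ, 0 < τ.im → f (mob a b c d τ) = J τ * f τ)
    (hδ : ∀ τ σ : ℂ, 0 < τ.im → σ.im ≤ 0 → σ ≠ ((ρ : ℝ) : ℂ) → J τ * rt (τ - σ) =
      δ * (rt (mob a b c d τ - mob a b c d σ) * (c * τ + d) ^ 2 * rt ((ρ : ℝ) - σ))) :
    vertInt (kern f σ') σ' =
      δ * rt (ρ - σ) * (vertInt (kern f σ) σ - vertInt (kern f σ) ρ) := by
  refine hf.vertInt_mob hdet hc hD hσ' hρ hJ fun τ hτ => ?_
  have h1 : (σ : ℂ) ≠ ((ρ : ℝ) : ℂ) := by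
    intro h
    have h' : (σ : ℝ) = ρ := by exact_mod_cast h
    apply hD
    rw [h', hρ]
    field_simp
    ring
  have h2 := hδ τ σ hτ (by simp) h1
  have h3 : mob a b c d σ = σ' := by
    rw [mob]
    have := congrArg ((↑) : ℝ → ℂ) hσ'
    push_cast at this
    exact this.symm
  rw [h3, ofReal_ratCast] at h2
  have h4 : 0 < (mob a b c d τ - σ').im := by simpa using mob_im_pos hdet hτ
  have h5 : 0 < (τ - σ).im := by simpa using hτ
  rw [div_eq_div_iff (mul_ne_zero (rt_ne_zero (ne_zero_of_im_pos h4))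
    (pow_ne_zero _ (mob_den_ne_zero hdet hτ))) (rt_ne_zero (ne_zero_of_im_pos h5)), h2]
  ring

lemma sqrt_mul_rt_inv_mul {g : ℝ} (hg : 0 < g) (z : ℂ) :
    (√g : ℂ) * rt (((g⁻¹ : ℝ) : ℂ) * z) = rt z := by
  have h : (√g : ℂ) * ((g⁻¹ : ℝ) : ℂ) ^ (1 / 2 : ℂ) = 1 := by
    have : ((g⁻¹ : ℝ) : ℂ) ^ (1 / 2 : ℂ) = (((g⁻¹) ^ (1 / 2 : ℝ) : ℝ) : ℂ) := by
      rw [ofReal_cpow (by positivity)]; norm_num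
    rw [this, ← ofReal_mul, ← Real.sqrt_eq_rpow, Real.sqrt_inv,
      mul_inv_cancel₀ (Real.sqrt_pos.2 hg).ne', ofReal_one]
  rw [rt_ofReal_mul (by positivity), ← mul_assoc, h, one_mul]

lemma factor_half_apply (γ : SL(2, ℤ)) (x : ℚ) : factor (1 / 2) γ x =
    if 0 ≤ γ 1 0 then ((den γ x : ℂ) ^ (1 / 2 : ℂ))⁻¹
      else conj (((den γ x : ℂ) ^ (1 / 2 : ℂ))⁻¹) := by
  rw [factor, ← cpow_neg]
  norm_num

lemma norm_rt_one : ‖rt 1‖ = 1 := by simp [norm_rt]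

/-- The factor `(cx + d)^{-1/2}` in terms of `√(-i(x + d/c))`. -/
lemma exists_factor_eq {γ : SL(2, ℤ)} (hγ : γ 1 0 ≠ 0) : ∃ w : ℂ, ‖w‖ = 1 ∧ ∀ x : ℚ,
    ((√|((γ 1 0 : ℤ) : ℝ)| : ℂ) * rt (((den γ x / (γ 1 0 : ℤ) : ℚ) : ℂ)))⁻¹ =
      w * factor (1 / 2) γ x := by
  rcases lt_or_gt_of_ne hγ with h | h
  · refine ⟨(conj (rt 1))⁻¹, by simp [norm_rt_one], fun x => ?_⟩
    have hg : (0 : ℝ) < -((γ 1 0 : ℤ) : ℝ) := by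
      have : ((γ 1 0 : ℤ) : ℝ) < 0 := by exact_mod_cast h
      linarith
    have h1 := sqrt_mul_rt_inv_mul hg (-((den γ x : ℝ) : ℂ))
    have h2 : (((-((γ 1 0 : ℤ) : ℝ))⁻¹ : ℝ) : ℂ) * -((den γ x : ℝ) : ℂ) =
        ((den γ x / (γ 1 0 : ℤ) : ℚ) : ℂ) := by
      push_cast
      rw [inv_neg, neg_mul_neg]
      ring
    rw [h2, rt_neg_ofReal, rt_ofReal] at h1
    -- For a negative lower left entry the positive scaling leaves `rt` at the negated denominator,
    -- and negating a real argument conjugates `rt`; this matches the conjugate in `factor`.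
    rw [factor_half_apply, if_neg (not_le.2 h), abs_of_neg (by linarith), h1, map_mul, map_inv₀,
      mul_inv, mul_comm, ofReal_ratCast]
  · refine ⟨(rt 1)⁻¹, by simp [norm_rt_one], fun x => ?_⟩
    have hg : (0 : ℝ) < ((γ 1 0 : ℤ) : ℝ) := by exact_mod_cast h
    have h1 := sqrt_mul_rt_inv_mul hg ((den γ x : ℝ) : ℂ)
    have h2 : (((((γ 1 0 : ℤ) : ℝ))⁻¹ : ℝ) : ℂ) * ((den γ x : ℝ) : ℂ) =
        ((den γ x / (γ 1 0 : ℤ) : ℚ) : ℂ) := by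
      push_cast
      ring
    rw [h2, rt_ofReal] at h1
    rw [factor_half_apply, if_pos h.le, abs_of_pos hg, h1, mul_inv, mul_comm, ofReal_ratCast]

/-- The error functions of `Ẽ_m` are real analytic: the case `c ≠ 0`. -/
lemma quantum_of_ne_zero {m : ℕ} (hm : m ∈ T) {γ : SL(2, ℤ)} (hγ : γ 1 0 ≠ 0)
    (hmod : IsModularFor (scaledE m) γ) : ∃ ε : ℂ, ‖ε‖ = 1 ∧
    ∃ h : ℝ → ℂ, AnalyticOnNhd ℝ h {x : ℝ | (γ 1 0 : ℝ) * x + (γ 1 1 : ℝ) ≠ 0} ∧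
      ∀ x : ℚ, den γ x ≠ 0 → h x = EtildeRat m (2 * x / (c m : ℚ) ^ 2) -
        ε * factor (1 / 2) γ x * EtildeRat m (2 * act γ x / (c m : ℚ) ^ 2) := by
  obtain ⟨J, ω, hJc, hω, hJ⟩ := hmod
  have hf := isCuspidal_scaledE hm
  have hdet := mirror_det γ
  have hg : ((γ 1 0 : ℤ) : ℝ) ≠ 0 := by exact_mod_cast hγ
  have hgQ : ((γ 1 0 : ℤ) : ℚ) ≠ 0 := by exact_mod_cast hγ
  set ρ : ℚ := (γ 1 1 : ℤ) / (γ 1 0 : ℤ) with hρ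
  have hρ' : (ρ : ℝ) = -((γ 1 1 : ℤ) : ℝ) / (-((γ 1 0 : ℤ) : ℝ)) := by
    rw [hρ]; push_cast; rw [neg_div_neg_eq]
  obtain ⟨δ, hδn, hδ⟩ := exists_branch hdet (neg_ne_zero.2 hg) hρ' hJc hω fun τ hτ => (hJ τ hτ).1
  rw [abs_neg] at hδn
  obtain ⟨w, hw, hfac⟩ := exists_factor_eq hγ
  have hs0 : √|((γ 1 0 : ℤ) : ℝ)| ≠ 0 := (Real.sqrt_pos.2 (abs_pos.2 hg)).ne'
  have hs0C : (√|((γ 1 0 : ℤ) : ℝ)| : ℂ) ≠ 0 := by exact_mod_cast hs0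
  have hδ0 : δ ≠ 0 := by
    intro h
    rw [h, norm_zero] at hδn
    exact hs0 hδn.symm
  -- The branch constant δ has modulus √|c|, so this multiplier has modulus one. The error function
  -- is the Eichler integral started at ρ = d/c instead of at -x.
  refine ⟨(√|((γ 1 0 : ℤ) : ℝ)| : ℂ) * δ⁻¹ * w, ?_,
    fun x => -(2 * I / c m) * vertInt (kern (scaledE m) (-x)) ρ, ?_, fun x hx => ?_⟩
  · rw [norm_mul, norm_mul, norm_inv, hδn, hw, norm_real,
      Real.norm_of_nonneg (Real.sqrt_nonneg _), mul_inv_cancel₀ hs0, one_mul]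
  · intro x hx
    refine analyticAt_const.mul (hf.analyticAt_vertInt ρ ?_)
    intro h
    apply hx
    rw [hρ] at h
    push_cast at h
    field_simp at h
    linarith
  · have hden : -((γ 1 0 : ℤ) : ℝ) * ((-x : ℚ) : ℝ) + ((γ 1 1 : ℤ) : ℝ) = (den γ x : ℝ) := by
      rw [den]; push_cast; ring
    have hden0 : (den γ x : ℝ) ≠ 0 := by exact_mod_cast hx
    have key := hf.vertInt_of_branch hdet (neg_ne_zero.2 hg) (σ := -x) (σ' := -act γ x) (ρ := ρ)
      (by rw [hden]; exact hden0)
      (by rw [hden, act]; push_cast; rw [← neg_div]; congr 1; ring) hρ'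
      (fun τ hτ => (hJ τ hτ).2) hδ
    have hρσ : (ρ : ℂ) - ((-x : ℚ) : ℂ) = ((den γ x / (γ 1 0 : ℤ) : ℚ) : ℂ) := by
      rw [hρ, den]
      have : ((γ 1 0 : ℤ) : ℂ) ≠ 0 := by exact_mod_cast hγ
      push_cast
      field_simp
      ring
    rw [hρσ] at key
    have hr0 : rt ((den γ x / (γ 1 0 : ℤ) : ℚ) : ℂ) ≠ 0 := by
      refine rt_ne_zero ?_
      have : den γ x / (γ 1 0 : ℤ) ≠ 0 := div_ne_zero hx hgQ
      exact_mod_cast this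
    rw [etildeRat_eq hm, etildeRat_eq hm, key, mul_assoc (_ * δ⁻¹), ← hfac]
    have hcast : (-(x : ℝ)) = ((-x : ℚ) : ℝ) := by push_cast; rfl
    simp only [hcast]
    field_simp
    ring

/-- The error functions of `Ẽ_m` are real analytic: the case `c = 0`. -/
lemma quantum_of_eq_zero {m : ℕ} (hm : m ∈ T) {γ : SL(2, ℤ)} (hγ : γ 1 0 = 0)
    (hmod : IsModularFor (scaledE m) γ) : ∃ ε : ℂ, ‖ε‖ = 1 ∧
    ∃ h : ℝ → ℂ, AnalyticOnNhd ℝ h {x : ℝ | (γ 1 0 : ℝ) * x + (γ 1 1 : ℝ) ≠ 0} ∧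
      ∀ x : ℚ, den γ x ≠ 0 → h x = EtildeRat m (2 * x / (c m : ℚ) ^ 2) -
        ε * factor (1 / 2) γ x * EtildeRat m (2 * act γ x / (c m : ℚ) ^ 2) := by
  obtain ⟨J, ω, hJc, hω, hJ⟩ := hmod
  have hdet : (γ 0 0 : ℤ) * γ 1 1 = 1 := by
    have h := γ.det_coe
    rw [Matrix.det_fin_two, hγ, mul_zero, sub_zero] at h
    exact h
  have hcase : (γ 0 0 = 1 ∧ γ 1 1 = 1) ∨ (γ 0 0 = -1 ∧ γ 1 1 = -1) :=
    Int.mul_eq_one_iff_eq_one_or_neg_one.1 hdet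
  have hd1 : ‖((γ 1 1 : ℤ) : ℂ)‖ = 1 := by rcases hcase with h | h <;> simp [h.2]
  have hω0 : ω ≠ 0 := by rintro rfl; simp at hω
  have hd0 : ((γ 1 1 : ℤ) : ℂ) ≠ 0 := by
    intro h
    rw [h, norm_zero] at hd1
    exact zero_ne_one hd1
  obtain ⟨j₀, hj₀⟩ : ∃ j₀ : ℂ, j₀ ^ 2 = ω * ((γ 1 1 : ℤ) : ℂ) ^ 3 :=
    IsAlgClosed.exists_pow_nat_eq _ (by norm_num)
  have hj0 : j₀ ≠ 0 := by
    rintro rfl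
    have := mul_ne_zero hω0 (pow_ne_zero 3 hd0)
    rw [← hj₀] at this
    simp at this
  -- With c = 0 the square of J is constant, hence so is J. Since γ acts as a translation, the two
  -- Eichler integrals are then proportional.
  obtain ⟨j, hj, hjJ⟩ : ∃ j : ℂ, ‖j‖ = 1 ∧ ∀ τ : ℂ, 0 < τ.im → J τ = j := by
    have hn : ‖j₀‖ = 1 := by
      have := congrArg norm hj₀
      rw [norm_pow, norm_mul, norm_pow, hω, hd1, one_pow, mul_one] at this
      exact (pow_eq_one_iff_of_nonneg (norm_nonneg _) two_ne_zero).1 this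
    have hsq : EqOn (J ^ 2) ((fun _ => j₀) ^ 2) {τ | 0 < τ.im} := by
      intro τ hτ
      simp only [Pi.pow_apply]
      rw [(hJ τ hτ).1, hj₀, mirrorDen_apply, hγ, Int.cast_zero, zero_mul, sub_zero]
    rcases (convex_halfSpace_im_gt 0).isPreconnected.eq_or_eq_neg_of_sq_eq hJc
      continuousOn_const hsq (fun _ => hj0) with h | h
    · exact ⟨j₀, hn, h⟩
    · exact ⟨-j₀, by rwa [norm_neg], h⟩
  have hj_ne : j ≠ 0 := by
    intro h
    rw [h, norm_zero] at hj
    exact zero_ne_one hj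
  have hV : ∀ x : ℚ, EtildeRat m (2 * act γ x / (c m : ℚ) ^ 2) =
      j * EtildeRat m (2 * x / (c m : ℚ) ^ 2) := by
    intro x
    rw [etildeRat_eq hm, etildeRat_eq hm, mul_left_comm]
    congr 1
    rw [vertInt, vertInt, ← integral_const_mul]
    refine setIntegral_congr_fun measurableSet_Ioi fun t ht => ?_
    have ht : (0 : ℝ) < t := ht
    have h1 : mirror γ (((-x : ℚ) : ℂ) + I * t) = ((-act γ x : ℚ) : ℂ) + I * t := by
      rw [mirror, mob, act, den, hγ]
      rcases hcase with h | h <;> rw [h.1, h.2] <;> push_cast <;> ring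
    have h2 : 0 < (((-x : ℚ) : ℂ) + I * t).im := by
      rw [add_im, ratCast_im]; simpa using ht
    have h3 := (hJ _ h2).2
    rw [h1, hjJ _ h2] at h3
    simp only [kern, h3, ofReal_ratCast, add_sub_cancel_left]
    ring
  set q : ℂ := (((γ 1 1 : ℤ) : ℂ) ^ (1 / 2 : ℂ))⁻¹ with hq
  have hqn : ‖q‖ = 1 := by
    rw [hq, norm_inv]
    rcases hcase with h | h
    · rw [h.2]; simp
    · rw [h.2]
      push_cast
      rw [cpow_half_neg_one, norm_I, inv_one]
  have hfac : ∀ x : ℚ, factor (1 / 2) γ x = q := by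
    intro x
    rw [factor_half_apply, hγ, if_pos le_rfl, den, hγ, hq]
    push_cast
    rw [zero_mul, zero_add]
  have hq0 : q ≠ 0 := by
    intro h
    rw [h, norm_zero] at hqn
    exact zero_ne_one hqn
  refine ⟨(j * q)⁻¹, by rw [norm_inv, norm_mul, hj, hqn]; simp, fun _ => 0, fun _ _ => analyticAt_const,
    fun x _ => ?_⟩
  rw [hfac, hV]
  field_simp
  ring

theorem isQuantumModularForm {m n : ℕ} (hm : m ∈ T) (R : Set ℚ) :
    IsQuantumModularForm (1 / 2) R (G m n)
      {x : ℚ | ∃ L : ℂ, HasValueAt m (2 * x / (c m : ℚ) ^ 2) L}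
      (fun x : ℚ => EtildeRat m (2 * x / (c m : ℚ) ^ 2)) := by
  have h : ∀ γ : SL(2, ℤ), γ ∈ G m n → ∃ ε : ℂ, ‖ε‖ = 1 ∧
      ∃ h : ℝ → ℂ, AnalyticOnNhd ℝ h {x : ℝ | (γ 1 0 : ℝ) * x + (γ 1 1 : ℝ) ≠ 0} ∧
        ∀ x : ℚ, den γ x ≠ 0 → h x = EtildeRat m (2 * x / (c m : ℚ) ^ 2) -
          ε * factor (1 / 2) γ x * EtildeRat m (2 * act γ x / (c m : ℚ) ^ 2) := by
    intro γ hγ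
    by_cases h0 : γ 1 0 = 0
    · exact quantum_of_eq_zero hm h0 (isModularFor_of_mem hm hγ)
    · exact quantum_of_ne_zero hm h0 (isModularFor_of_mem hm hγ)
  refine ⟨fun x _ => ⟨_, hasValueAt hm x⟩, fun γ _ x _ _ => ⟨_, hasValueAt hm _⟩, ?_⟩
  choose! ε hε using h
  refine ⟨ε, fun γ hγ => ⟨(hε γ hγ).1, ?_⟩⟩
  obtain ⟨h, ha, hx⟩ := (hε γ hγ).2
  exact ⟨h, ha, fun x _ hd => hx x hd⟩

/-! ### The transformation laws -/

lemma lowerMult_ne_zero (m k : ℕ) : lowerMult m k ≠ 0 := by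
  intro h
  have := norm_lowerMult m k
  rw [h, norm_zero] at this
  exact zero_ne_one this

/-- The transformation law under `x ↦ x / (kx + 1)`. -/
theorem transformation_lower {m k : ℕ} (hm : m ∈ T) (hk0 : 0 < k) (hk : Even m ∨ Even k) {x : ℚ}
    (hx : (k : ℚ) * x + 1 ≠ 0) :
    EtildeRat m (2 * x / (c m : ℚ) ^ 2) - (lowerMult m k)⁻¹ * ((k : ℂ) * x + 1) ^ (-1 / 2 : ℂ) *
      EtildeRat m (2 * (x / (k * x + 1)) / (c m : ℚ) ^ 2) =
        -(2 * I / c m) * periodIntegral m (1 / k) x := by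
  have hf := isCuspidal_scaledE hm
  have hkR : (0 : ℝ) < k := by exact_mod_cast hk0
  have hkC : (k : ℂ) ≠ 0 := by exact_mod_cast hk0.ne'
  have hdet := lower_det k
  have hρ' : (((1 / k : ℚ)) : ℝ) = -1 / (-(k : ℝ)) := by push_cast; rw [neg_div_neg_eq]
  obtain ⟨δ, -, hδ⟩ := exists_branch hdet (neg_ne_zero.2 hkR.ne') hρ' (continuousOn_lowerFactor m k)
    (ω := lowerMult m k ^ 2) (by rw [norm_pow, norm_lowerMult, one_pow])
    fun τ hτ => lowerFactor_sq m k hτ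
  -- The branch identity is evaluated at τ = i, σ = 0. Since 0 is fixed by the map, both sides
  -- contain fourth powers of roots, which are free of branch ambiguity and equal explicit squares.
  have hδk : δ * rt ((1 / k : ℚ) : ℂ) = lowerMult m k := by
    have hI : (0 : ℝ) < I.im := by simp
    have h1 := hδ I 0 hI (by simp) (by
      rw [ofReal_ratCast]
      push_cast
      exact (one_div_ne_zero hkC).symm)
    have h2 : mob 1 0 (-k) 1 0 = 0 := by simp [mob]
    have hmi := mob_im_pos hdet hI
    have h3 := rt_ne_zero (ne_zero_of_im_pos hmi)
    have h5 := mob_den_ne_zero hdet hI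
    have h6 : mob 1 0 (-k) 1 I * (((-k : ℝ) : ℂ) * I + ((1 : ℝ) : ℂ)) = I := by
      rw [mob, div_mul_cancel₀ _ h5]; push_cast; ring
    rw [h2, sub_zero, sub_zero, sub_zero, ofReal_ratCast, lowerFactor] at h1
    have h7 := rt_sq I
    have h8 := rt_sq (mob 1 0 (-k) 1 I)
    generalize mob 1 0 (-k) 1 I = M at *
    generalize ((-k : ℝ) : ℂ) * I + ((1 : ℝ) : ℂ) = D at *
    generalize rt ((1 / k : ℚ) : ℂ) = r at *
    have h9 : lowerMult m k * (rt I ^ 2) ^ 2 = δ * r * ((rt M ^ 2) * D) ^ 2 := by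
      field_simp at h1
      linear_combination h1
    rw [h7, h8, mul_assoc (-I) M D, h6] at h9
    have : (-I * I : ℂ) = 1 := by rw [neg_mul, I_mul_I, neg_neg]
    rw [this] at h9
    simpa using h9.symm
  have hxR : -(k : ℝ) * ((-x : ℚ) : ℝ) + 1 = ((k * x + 1 : ℚ) : ℝ) := by push_cast; ring
  have hx0 : ((k * x + 1 : ℚ) : ℝ) ≠ 0 := by exact_mod_cast hx
  have key := hf.vertInt_of_branch hdet (neg_ne_zero.2 hkR.ne') (σ := -x)
    (σ' := -(x / (k * x + 1))) (ρ := 1 / k) (by rw [hxR]; exact hx0)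
    (by rw [hxR]; push_cast; rw [← neg_div]; congr 1; ring) hρ'
    (fun τ hτ => scaledE_lower hm hk hτ) hδ
  have hrt : δ * rt (((1 / k : ℚ) : ℂ) - ((-x : ℚ) : ℂ)) =
      lowerMult m k * ((k : ℂ) * x + 1) ^ (1 / 2 : ℂ) := by
    have h1 : ((1 / k : ℚ) : ℂ) - ((-x : ℚ) : ℂ) =
        (((k : ℝ)⁻¹ : ℝ) : ℂ) * (((k * x + 1 : ℚ) : ℝ) : ℂ) := by
      push_cast; field_simp; ring
    have h2 : ((1 / k : ℚ) : ℂ) = (((k : ℝ)⁻¹ : ℝ) : ℂ) * 1 := by push_cast; ring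
    rw [h2, rt_ofReal_mul (by positivity)] at hδk
    rw [h1, rt_ofReal_mul (by positivity), rt_ofReal, ← hδk]
    push_cast
    ring
  rw [hrt] at key
  have hxC : ((k : ℂ) * x + 1) ≠ 0 := by exact_mod_cast hx
  have hr0 : ((k : ℂ) * x + 1) ^ (1 / 2 : ℂ) ≠ 0 := by
    rw [Ne, cpow_eq_zero_iff]; tauto
  have hneg : ((k : ℂ) * x + 1) ^ (-1 / 2 : ℂ) = (((k : ℂ) * x + 1) ^ (1 / 2 : ℂ))⁻¹ := by
    rw [← cpow_neg]; norm_num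
  have hperiod : periodIntegral m (1 / k) x =
      vertInt (kern (scaledE m) (-x : ℚ)) ((1 / k : ℚ) : ℂ) := by
    rw [periodIntegral, vertInt]
    congr 1
    ext t
    simp only [periodIntegrand, kern, scaledE, rt]
    push_cast
    simp only [sub_neg_eq_add]
  have hl := lowerMult_ne_zero m k
  rw [etildeRat_eq hm, etildeRat_eq hm, key, hneg, hperiod]
  field_simp
  ring

lemma integrableOn_periodIntegrand {m : ℕ} (hm : m ∈ T) (ρ x : ℚ) :
    IntegrableOn (periodIntegrand m ρ x) (Ioi 0) := by
  have := (isCuspidal_scaledE hm).integrableOn_kern ρ (-x : ℚ)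
  refine this.congr_fun (fun t _ => ?_) measurableSet_Ioi
  simp only [periodIntegrand, kern, scaledE, rt]
  push_cast
  simp only [sub_neg_eq_add]

lemma zeta_four : zeta 4 = I := by
  have h : (2 * Real.pi * I / (4 : ℕ) : ℂ) = Real.pi / 2 * I := by push_cast; ring
  rw [zeta, h, exp_pi_div_two_mul_I]

lemma zeta_eight_sq : zeta 8 ^ 2 = I := by
  have h : ((2 : ℕ) : ℂ) * (2 * Real.pi * I / (8 : ℕ)) = Real.pi / 2 * I := by push_cast; ring
  rw [zeta, ← Complex.exp_nat_mul, h, exp_pi_div_two_mul_I]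

/-- For odd m this is i² = -1 against a trivial multiplier; for even m it is i = -1/i with ζ_8² = i.
-/
lemma zeta_four_pow_ell {m : ℕ} (hm : m ∈ T) : zeta 4 ^ ell m = -(lowerMult m 2)⁻¹ := by
  rw [zeta_four, lowerMult, zeta_eight_sq]
  simp only [T, mem_insert_iff, mem_singleton_iff] at hm
  rcases hm with rfl | rfl | rfl | rfl | rfl | rfl <;> simp [ell, Nat.even_iff]

theorem transformationLaws {m : ℕ} (hm : m ∈ T) (n : ℕ) :
    TransformationLaws m n (fun x : ℚ => 1 / 2 * EtildeRat m (2 * x / (c m : ℚ) ^ 2)) where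
  integrable_half x _ _ := by
    have := integrableOn_periodIntegrand hm (1 / 2) x
    push_cast at this
    exact this
  law_i x _ hx := by
    have h0 : ((2 : ℕ) : ℚ) * x + 1 ≠ 0 := by
      intro h
      apply hx
      push_cast at h
      linarith
    have h := transformation_lower hm two_pos (Or.inr even_two) h0
    push_cast at h
    rw [zeta_four_pow_ell hm]
    linear_combination (1 / 2 : ℂ) * h
  integrable_one _ _ x _ _ := by
    have := integrableOn_periodIntegrand hm 1 x
    push_cast at this
    exact this
  law_ii _ he x _ hx := by
    have h0 : ((1 : ℕ) : ℚ) * x + 1 ≠ 0 := by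
      intro h
      apply hx
      push_cast at h
      linarith
    have heven : Even m := by rcases he with rfl | rfl | rfl <;> decide
    have h := transformation_lower hm one_pos (Or.inl heven) h0
    rw [lowerMult, if_pos heven, pow_one] at h
    push_cast at h
    simp only [one_mul, div_one] at h
    linear_combination (1 / 2 : ℂ) * h
  law_iii x _ := by
    have h := etildeRat_add hm (kappa m n) x
    rw [h]
    ring

end EtaTheta

open EtaTheta in
theorem proposition1p4 (m : ℕ) (hm : m ∈ T) :
    -- the values of the partial theta function at rational numbers exist, and the values at
    -- opposite rational numbers are complex conjugates
    (∀ r : ℚ, HasValueAt m r (EtildeRat m r) ∧ EtildeRat m (-r) = conj (EtildeRat m r)) ∧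
    (∀ n : ℕ, Admissible m n →
      IsQuantumModularForm (1 / 2) (Sset m n \ {-1 / (ellPair m n : ℚ)}) (G m n)
        {x : ℚ | ∃ L : ℂ, HasValueAt m (2 * x / (c m : ℚ) ^ 2) L}
        (fun x : ℚ => EtildeRat m (2 * x / (c m : ℚ) ^ 2))) ∧
    (∃ α : ℂ, α ≠ 0 ∧ ∀ n : ℕ, Admissible m n →
      TransformationLaws m n (fun x : ℚ => α * EtildeRat m (2 * x / (c m : ℚ) ^ 2))) :=
  ⟨fun r => ⟨hasValueAt_etildeRat hm r, etildeRat_neg hm r⟩,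
    fun _ _ => isQuantumModularForm hm _,
    1 / 2, by norm_num, fun n _ => transformationLaws hm n⟩
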